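/- Let $k$ be a commutative ring and let $Q$ be a quiver (not necessarily finite) such that for each vertex there are only finitely many paths starting in it and only finitely many paths ending in it. Let $kQ$ be the $k$-linearization of $Q$, so that $kQ(i,j)$ is the free $k$-module on the paths from $i$ to $j$, and write $D=\operatorname{Hom}_k(-,k)$. For a $k$-linear abelian category $\mathcal B$ let $\mathcal B^{kQ}$ be the category of $k$-linear functors $kQ\to\mathcal B$, i.e. of representations $F=(F(i),f_\alpha)$ of $Q$ over $\mathcal B$. Let $i^*\colon \mathcal B^{kQ}\to\prod_{i\in Q_0}\mathcal B$, $F\mapsto (F(i))_i$, be the evaluation functor, let $i_!$ be its left adjoint, put $P_{\mathcal B^{kQ}}=i_!\circ i^*$, and let $\nu\colon \mathcal B^{kQ}\to\mathcal B^{kQ}$ be the Nakayama functor $\nu(F)(i)=D(kQ(i,-))\otimes_{kQ}F$, with right adjoint $\nu^-$. An object of $\mathcal B^{kQ}$ is called $P$-projective if it is a direct summand of an object $P(F)$, where $P=P_{\mathcal B^{kQ}}$. An object $X$ is called Gorenstein $P$-projective if there is an exact sequence $A_\bullet=\cdots\to A_1\to A_0\xrightarrow{f_0}A_{-1}\to\cdots$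 of $P$-projective objects such that $\nu(A_\bullet)$ is exact and $X\cong\operatorname{Ker}f_0$. The endofunctor $P$ is called $m$-Gorenstein if there is an integer $n\ge 0$ with $L_i\nu=0$ and $R^i\nu^-=0$ for all $i>n$, and the following three numbers are all equal to $m$: the supremum over all objects $Y$ of the smallest length of a finite resolution of $Y$ by Gorenstein $P$-projective objects; the smallest integer $r\ge 0$ with $L_i\nu=0$ for all $i>r$; the smallest integer $s\ge 0$ with $R^i\nu^-=0$ for all $i>s$. A representation $F$ is called monic if for every vertex $i$ the morphism $(f_\alpha)_{t(\alpha)=i}\colon\bigoplus_{t(\alpha)=i}F(s(\alpha))\to F(i)$ is a monomorphism. Then: 1. The endofunctor $P_{kQ\text{-}\mathrm{Mod}}$ (the case $\mathcal B=k\text{-}\mathrm{Mod}$) is $m$-Gorenstein for some $m\le 1$. 2. For every $k$-linear abelian category $\mathcal B$, a representation $F\in\mathcal B^{kQ}$ is monic if and only if it is Gorenstein $P_{\mathcal B^{kQ}}$-projective. -/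

import Mathlib

open CategoryTheory CategoryTheory.Limits

universe v u v₁ u₁ w

attribute [local instance] Abelian.hasFiniteBiproducts

/-! ### Gorenstein homological algebra relative to an endofunctor

`P` is the endofunctor `f_! ∘ f^*` of an abelian category `A`, and `ν` is a Nakayama functor with
right adjoint `ν'`. -/

namespace RelGorenstein

section

variable {A : Type u₁} [Category.{v₁} A] [Abelian A]

/-- `X` is `P`-projective: a direct summand of an object `P(Y)`. -/
def IsRelProjective (P : A ⥤ A) (X : A) : Prop :=
  ∃ Y : A, Nonempty (Retract X (P.obj Y))

/-- `X` is Gorenstein `P`-projective: there is an exact sequence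
`⋯ ⟶ K₁ ⟶ K₀ ⟶ K₋₁ ⟶ ⋯` of `P`-projective objects which stays exact under `ν`
and such that `X` is the kernel of `K₀ ⟶ K₋₁`. -/
def IsGorensteinProjective (P ν : A ⥤ A) [ν.PreservesZeroMorphisms] (X : A) : Prop :=
  ∃ K : ChainComplex A ℤ,
    (∀ i, IsRelProjective P (K.X i)) ∧ K.Acyclic ∧
    ((ν.mapHomologicalComplex (ComplexShape.down ℤ)).obj K).Acyclic ∧
    Nonempty (X ≅ kernel (K.d 0 (-1)))

/-- There is an exact sequence `0 ⟶ Xₙ ⟶ ⋯ ⟶ X₁ ⟶ X₀ ⟶ Y ⟶ 0` with all `Xᵢ` in `𝒳`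
(cut into short exact sequences `0 ⟶ K ⟶ X₀ ⟶ Y ⟶ 0`). -/
def HasResolutionOfLength (𝒳 : A → Prop) : ℕ → A → Prop
  | 0, Y => ∃ X₀ : A, 𝒳 X₀ ∧ Nonempty (X₀ ≅ Y)
  | n + 1, Y => ∃ S : ShortComplex A, S.ShortExact ∧ 𝒳 S.X₂ ∧ Nonempty (S.X₃ ≅ Y) ∧
      HasResolutionOfLength 𝒳 n S.X₁

/-- The resolution dimension of `Y` with respect to `𝒳`: the smallest length of a finite
resolution of `Y` by objects of `𝒳`, and `∞` if there is none. -/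
noncomputable def resolutionDim (𝒳 : A → Prop) (Y : A) : ℕ∞ :=
  ⨅ n : {n : ℕ // HasResolutionOfLength 𝒳 n Y}, ((n : ℕ) : ℕ∞)

/-- The global resolution dimension of `A` with respect to `𝒳`. -/
noncomputable def globalResolutionDim (𝒳 : A → Prop) : ℕ∞ :=
  ⨆ Y : A, resolutionDim 𝒳 Y

variable [HasProjectiveResolutions A] [HasInjectiveResolutions A]

/-- `P` is Iwanaga-Gorenstein: there is `n` with `Lᵢ ν = 0` and `Rⁱ ν' = 0` for all `i > n`. -/
def IsIwanagaGorenstein (ν ν' : A ⥤ A) [ν.Additive] [ν'.Additive] : Prop :=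
  ∃ n : ℕ, ∀ i > n, IsZero (ν.leftDerived i) ∧ IsZero (ν'.rightDerived i)

/-- `P` is `n`-Gorenstein: it is Iwanaga-Gorenstein, and `n` is at once the global resolution
dimension of `A` with respect to the Gorenstein `P`-projective objects, the smallest `r` such that
`Lᵢ ν = 0` for all `i > r`, and the smallest `s` such that `Rⁱ ν' = 0` for all `i > s`. -/
structure IsGorensteinOfDim (P ν ν' : A ⥤ A) [ν.Additive] [ν'.Additive] (n : ℕ) : Prop where
  isIwanagaGorenstein : IsIwanagaGorenstein ν ν'
  globalResolutionDim_eq : globalResolutionDim (IsGorensteinProjective P ν) = n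
  isLeast_leftDerived : IsLeast {r : ℕ | ∀ i > r, IsZero (ν.leftDerived i)} n
  isLeast_rightDerived : IsLeast {s : ℕ | ∀ i > s, IsZero (ν'.rightDerived i)} n

end

end RelGorenstein

/-! ### Locally bounded quivers and their representations -/

/-- For each vertex there are only finitely many paths starting in it and only finitely many
paths ending in it. -/
class LocallyBoundedQuiver (Q : Type u) [Quiver.{v} Q] : Prop where
  finite_from : ∀ i : Q, Finite (Σ j : Q, Quiver.Path i j)
  finite_to : ∀ i : Q, Finite (Σ j : Q, Quiver.Path j i)

namespace QuiverRep

section Finiteness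

variable {Q : Type u} [Quiver.{v} Q]

/-- The paths starting in `i`. -/
abbrev PathsFrom (i : Q) : Type (max u v) := Σ j : Q, Quiver.Path i j

/-- The paths ending in `i`. -/
abbrev PathsTo (i : Q) : Type (max u v) := Σ j : Q, Quiver.Path j i

variable [LocallyBoundedQuiver Q]

instance finite_pathsFrom (i : Q) : Finite (PathsFrom i) := LocallyBoundedQuiver.finite_from i

instance finite_pathsTo (i : Q) : Finite (PathsTo i) := LocallyBoundedQuiver.finite_to i

instance finite_path (i j : Q) : Finite (Quiver.Path i j) :=
  Finite.of_injective (fun p => (⟨j, p⟩ : PathsFrom i)) (fun p q h => by simpa using h)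

instance finite_arrowsFrom (i : Q) : Finite (Σ j : Q, (i ⟶ j)) :=
  Finite.of_injective (fun a => (⟨a.1, a.2.toPath⟩ : PathsFrom i)) (by
    rintro ⟨j, a⟩ ⟨j', a'⟩ h
    obtain ⟨h₁, h⟩ := Sigma.mk.inj h
    dsimp only at h₁ h
    subst h₁
    have := Quiver.Path.hom_heq_of_cons_eq_cons (eq_of_heq h)
    rw [eq_of_heq this])

instance finite_arrowsTo (i : Q) : Finite (Σ j : Q, (j ⟶ i)) :=
  Finite.of_injective (fun a => (⟨a.1, a.2.toPath⟩ : PathsTo i)) (by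
    rintro ⟨j, a⟩ ⟨j', a'⟩ h
    obtain ⟨h₁, h⟩ := Sigma.mk.inj h
    dsimp only at h₁ h
    subst h₁
    have := Quiver.Path.hom_heq_of_cons_eq_cons (eq_of_heq h)
    rw [eq_of_heq this])

noncomputable instance fintype_path (i j : Q) : Fintype (Quiver.Path i j) := Fintype.ofFinite _

end Finiteness

section Representations

variable {Q : Type u} [Quiver.{v} Q] {B : Type u₁} [Category.{v₁} B]

/-- The object `F(i)` of a representation `F`. -/
abbrev vert (F : Paths Q ⥤ B) (i : Q) : B := F.obj ((Paths.of Q).obj i)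

/-- The morphism `f_α : F(i) ⟶ F(j)` of a representation `F` at an arrow `α : i ⟶ j`. -/
abbrev arr (F : Paths Q ⥤ B) {i j : Q} (α : i ⟶ j) : vert F i ⟶ vert F j :=
  F.map ((Paths.of Q).map α)

lemma naturality_of_arr {F G : Paths Q ⥤ B} (φ : ∀ i : Paths Q, F.obj i ⟶ G.obj i)
    (h : ∀ {i j : Q} (α : i ⟶ j),
      arr F α ≫ φ ((Paths.of Q).obj j) = φ ((Paths.of Q).obj i) ≫ arr G α)
    {i j : Paths Q} (p : i ⟶ j) : F.map p ≫ φ j = φ i ≫ G.map p := by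
  induction p using Paths.induction with
  | id => simp
  | comp p q hp =>
    rw [F.map_comp, G.map_comp, Category.assoc, h q, ← Category.assoc, hp, Category.assoc]

/-- A morphism of representations given on the vertices. -/
def mkHom {F G : Paths Q ⥤ B} (φ : ∀ i : Q, vert F i ⟶ vert G i)
    (h : ∀ {i j : Q} (α : i ⟶ j), arr F α ≫ φ j = φ i ≫ arr G α) : F ⟶ G where
  app i := φ i
  naturality _ _ p := naturality_of_arr (fun i => φ i) h p

/-- The component at a vertex of a morphism of representations. -/
abbrev comp {F G : Paths Q ⥤ B} (f : F ⟶ G) (i : Q) : vert F i ⟶ vert G i :=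
  f.app ((Paths.of Q).obj i)

lemma comp_mkHom {F G : Paths Q ⥤ B} (φ : ∀ i : Q, vert F i ⟶ vert G i)
    (h : ∀ {i j : Q} (α : i ⟶ j), arr F α ≫ φ j = φ i ≫ arr G α) (i : Q) :
    comp (mkHom φ h) i = φ i := rfl

lemma hom_ext {F G : Paths Q ⥤ B} {f g : F ⟶ G} (h : ∀ i : Q, comp f i = comp g i) : f = g :=
  NatTrans.ext (funext h)

lemma comp_naturality {F G : Paths Q ⥤ B} (f : F ⟶ G) {i j : Q} (α : i ⟶ j) :
    arr F α ≫ comp f j = comp f i ≫ arr G α :=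
  f.naturality _

/-- The representation with objects `X i` and morphisms `f α`. -/
def mkRep (X : Q → B) (f : ∀ {i j : Q}, (i ⟶ j) → (X i ⟶ X j)) : Paths Q ⥤ B :=
  Paths.lift { obj := X, map := f }

lemma arr_mkRep (X : Q → B) (f : ∀ {i j : Q}, (i ⟶ j) → (X i ⟶ X j)) {i j : Q} (α : i ⟶ j) :
    arr (mkRep X f) α = f α :=
  Paths.lift_toPath _ α

/-- A morphism from the representation with data `X`, `f` to `F`. -/
def descRep {X : Q → B} {f : ∀ {i j : Q}, (i ⟶ j) → (X i ⟶ X j)} {F : Paths Q ⥤ B}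
    (φ : ∀ i : Q, X i ⟶ vert F i)
    (h : ∀ {i j : Q} (α : i ⟶ j), f α ≫ φ j = φ i ≫ arr F α) : mkRep X f ⟶ F :=
  mkHom φ fun {i j} α => (congrArg (fun t : X i ⟶ X j => t ≫ φ j) (arr_mkRep X f α)).trans (h α)

/-- A morphism from `F` to the representation with data `X`, `f`. -/
def liftRep {X : Q → B} {f : ∀ {i j : Q}, (i ⟶ j) → (X i ⟶ X j)} {F : Paths Q ⥤ B}
    (φ : ∀ i : Q, vert F i ⟶ X i)
    (h : ∀ {i j : Q} (α : i ⟶ j), arr F α ≫ φ j = φ i ≫ f α) : F ⟶ mkRep X f :=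
  mkHom φ fun {i j} α => (h α).trans
    (congrArg (fun t : X i ⟶ X j => φ i ≫ t) (arr_mkRep X f α)).symm

/-- A morphism between the representations with data `X`, `f` and `Y`, `g`. -/
def mapRep {X Y : Q → B} {f : ∀ {i j : Q}, (i ⟶ j) → (X i ⟶ X j)}
    {g : ∀ {i j : Q}, (i ⟶ j) → (Y i ⟶ Y j)} (φ : ∀ i : Q, X i ⟶ Y i)
    (h : ∀ {i j : Q} (α : i ⟶ j), f α ≫ φ j = φ i ≫ g α) : mkRep X f ⟶ mkRep Y g :=
  descRep φ fun {i j} α => (h α).trans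
    (congrArg (fun t : Y i ⟶ Y j => φ i ≫ t) (arr_mkRep Y g α)).symm

/-- The components of a morphism out of the representation with data `X`, `f`. -/
def compDesc {X : Q → B} {f : ∀ {i j : Q}, (i ⟶ j) → (X i ⟶ X j)} {F : Paths Q ⥤ B}
    (t : mkRep X f ⟶ F) (i : Q) : X i ⟶ vert F i := comp t i

/-- The components of a morphism into the representation with data `X`, `f`. -/
def compLift {X : Q → B} {f : ∀ {i j : Q}, (i ⟶ j) → (X i ⟶ X j)} {F : Paths Q ⥤ B}
    (t : F ⟶ mkRep X f) (i : Q) : vert F i ⟶ X i := comp t i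

lemma compDesc_naturality {X : Q → B} {f : ∀ {i j : Q}, (i ⟶ j) → (X i ⟶ X j)}
    {F : Paths Q ⥤ B} (t : mkRep X f ⟶ F) {i j : Q} (α : i ⟶ j) :
    f α ≫ compDesc t j = compDesc t i ≫ arr F α :=
  (congrArg (fun s : X i ⟶ X j => s ≫ compDesc t j) (arr_mkRep X f α)).symm.trans
    (comp_naturality t α)

lemma compLift_naturality {X : Q → B} {f : ∀ {i j : Q}, (i ⟶ j) → (X i ⟶ X j)}
    {F : Paths Q ⥤ B} (t : F ⟶ mkRep X f) {i j : Q} (α : i ⟶ j) :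
    arr F α ≫ compLift t j = compLift t i ≫ f α :=
  (comp_naturality t α).trans
    (congrArg (fun s : X i ⟶ X j => compLift t i ≫ s) (arr_mkRep X f α))

lemma compDesc_ext {X : Q → B} {f : ∀ {i j : Q}, (i ⟶ j) → (X i ⟶ X j)} {F : Paths Q ⥤ B}
    {s t : mkRep X f ⟶ F} (h : ∀ i : Q, compDesc s i = compDesc t i) : s = t := hom_ext h

lemma compLift_ext {X : Q → B} {f : ∀ {i j : Q}, (i ⟶ j) → (X i ⟶ X j)} {F : Paths Q ⥤ B}
    {s t : F ⟶ mkRep X f} (h : ∀ i : Q, compLift s i = compLift t i) : s = t := hom_ext h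

lemma compDesc_descRep {X : Q → B} {f : ∀ {i j : Q}, (i ⟶ j) → (X i ⟶ X j)} {F : Paths Q ⥤ B}
    (φ : ∀ i : Q, X i ⟶ vert F i)
    (h : ∀ {i j : Q} (α : i ⟶ j), f α ≫ φ j = φ i ≫ arr F α) (i : Q) :
    compDesc (descRep φ h) i = φ i := rfl

lemma compLift_liftRep {X : Q → B} {f : ∀ {i j : Q}, (i ⟶ j) → (X i ⟶ X j)} {F : Paths Q ⥤ B}
    (φ : ∀ i : Q, vert F i ⟶ X i)
    (h : ∀ {i j : Q} (α : i ⟶ j), arr F α ≫ φ j = φ i ≫ f α) (i : Q) :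
    compLift (liftRep φ h) i = φ i := rfl

lemma compDesc_mapRep_comp {X Y : Q → B} {f : ∀ {i j : Q}, (i ⟶ j) → (X i ⟶ X j)}
    {g : ∀ {i j : Q}, (i ⟶ j) → (Y i ⟶ Y j)} {F : Paths Q ⥤ B} (φ : ∀ i : Q, X i ⟶ Y i)
    (h : ∀ {i j : Q} (α : i ⟶ j), f α ≫ φ j = φ i ≫ g α) (t : mkRep Y g ⟶ F) (i : Q) :
    compDesc (mapRep φ h ≫ t) i = φ i ≫ compDesc t i := rfl

lemma compLift_comp_mapRep {X Y : Q → B} {f : ∀ {i j : Q}, (i ⟶ j) → (X i ⟶ X j)}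
    {g : ∀ {i j : Q}, (i ⟶ j) → (Y i ⟶ Y j)} {F : Paths Q ⥤ B} (φ : ∀ i : Q, X i ⟶ Y i)
    (h : ∀ {i j : Q} (α : i ⟶ j), f α ≫ φ j = φ i ≫ g α) (t : F ⟶ mkRep X f) (i : Q) :
    compLift (t ≫ mapRep φ h) i = compLift t i ≫ φ i := rfl

lemma compDesc_comp {X : Q → B} {f : ∀ {i j : Q}, (i ⟶ j) → (X i ⟶ X j)} {F G : Paths Q ⥤ B}
    (s : mkRep X f ⟶ F) (t : F ⟶ G) (i : Q) :
    compDesc (s ≫ t) i = compDesc s i ≫ comp t i := rfl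

lemma compLift_comp {X : Q → B} {f : ∀ {i j : Q}, (i ⟶ j) → (X i ⟶ X j)} {F G : Paths Q ⥤ B}
    (s : G ⟶ F) (t : F ⟶ mkRep X f) (i : Q) :
    compLift (s ≫ t) i = comp s i ≫ compLift t i := rfl

lemma mapRep_ext {X Y : Q → B} {f : ∀ {i j : Q}, (i ⟶ j) → (X i ⟶ X j)}
    {g : ∀ {i j : Q}, (i ⟶ j) → (Y i ⟶ Y j)} {φ ψ : ∀ i : Q, X i ⟶ Y i}
    {h : ∀ {i j : Q} (α : i ⟶ j), f α ≫ φ j = φ i ≫ g α}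
    {h' : ∀ {i j : Q} (α : i ⟶ j), f α ≫ ψ j = ψ i ≫ g α} (e : ∀ i, φ i = ψ i) :
    mapRep (f := f) (g := g) φ h = mapRep ψ h' := hom_ext e

lemma mapRep_id {X : Q → B} {f : ∀ {i j : Q}, (i ⟶ j) → (X i ⟶ X j)} {φ : ∀ i : Q, X i ⟶ X i}
    {h : ∀ {i j : Q} (α : i ⟶ j), f α ≫ φ j = φ i ≫ f α} (e : ∀ i, φ i = 𝟙 (X i)) :
    mapRep (f := f) φ h = 𝟙 (mkRep X f) := hom_ext e

lemma mapRep_comp {X Y Z : Q → B} {f : ∀ {i j : Q}, (i ⟶ j) → (X i ⟶ X j)}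
    {g : ∀ {i j : Q}, (i ⟶ j) → (Y i ⟶ Y j)} {l : ∀ {i j : Q}, (i ⟶ j) → (Z i ⟶ Z j)}
    {φ : ∀ i : Q, X i ⟶ Y i} {ψ : ∀ i : Q, Y i ⟶ Z i} {χ : ∀ i : Q, X i ⟶ Z i}
    {h : ∀ {i j : Q} (α : i ⟶ j), f α ≫ φ j = φ i ≫ g α}
    {h' : ∀ {i j : Q} (α : i ⟶ j), g α ≫ ψ j = ψ i ≫ l α}
    {h'' : ∀ {i j : Q} (α : i ⟶ j), f α ≫ χ j = χ i ≫ l α} (e : ∀ i, χ i = φ i ≫ ψ i) :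
    mapRep (f := f) (g := l) χ h'' = mapRep (g := g) φ h ≫ mapRep ψ h' := hom_ext e

/-- The morphism `F(i) ⟶ F(j)` of a representation `F` along a path from `i` to `j`. -/
abbrev pathMap (F : Paths Q ⥤ B) {i j : Q} (p : Quiver.Path i j) : vert F i ⟶ vert F j :=
  F.map (X := (Paths.of Q).obj i) (Y := (Paths.of Q).obj j) p

lemma pathMap_nil (F : Paths Q ⥤ B) (i : Q) :
    pathMap F (Quiver.Path.nil : Quiver.Path i i) = 𝟙 _ := F.map_id _

lemma pathMap_cons (F : Paths Q ⥤ B) {i j l : Q} (p : Quiver.Path i j) (α : j ⟶ l) :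
    pathMap F (p.cons α) = pathMap F p ≫ arr F α :=
  F.map_comp (X := (Paths.of Q).obj i) (Y := (Paths.of Q).obj j) (Z := (Paths.of Q).obj l)
    p ((Paths.of Q).map α)

lemma pathMap_toPath_comp (F : Paths Q ⥤ B) {i j l : Q} (α : i ⟶ j) (p : Quiver.Path j l) :
    pathMap F (α.toPath.comp p) = arr F α ≫ pathMap F p :=
  F.map_comp (X := (Paths.of Q).obj i) (Y := (Paths.of Q).obj j) (Z := (Paths.of Q).obj l)
    ((Paths.of Q).map α) p

lemma comp_pathMap {F G : Paths Q ⥤ B} (f : F ⟶ G) {i j : Q} (p : Quiver.Path i j) :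
    pathMap F p ≫ comp f j = comp f i ≫ pathMap G p :=
  f.naturality (X := (Paths.of Q).obj i) (Y := (Paths.of Q).obj j) p

/-- The evaluation functor `i^*`, sending `F` to the family `(F(i))ᵢ`. -/
def iStar (Q : Type u) [Quiver.{v} Q] (B : Type u₁) [Category.{v₁} B] :
    (Paths Q ⥤ B) ⥤ (Q → B) where
  obj F i := vert F i
  map f i := comp f i

end Representations

section Shriek

variable {Q : Type u} [Quiver.{v} Q] [LocallyBoundedQuiver Q]
  {B : Type u₁} [Category.{v₁} B] [Abelian B]

/-- `i_!(X)(j) = ⨁_c kQ(c, j) ⊗ X(c)`, a direct sum of copies of `X(c)` indexed by the paths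
from `c` to `j`. -/
noncomputable def shriekObj (X : Q → B) (j : Q) : B := ⨁ fun p : PathsTo j => X p.1

/-- The inclusion of the copy of `X(c)` that belongs to a path `p` from `c` to `j`. -/
noncomputable def shriekι (X : Q → B) {c j : Q} (p : Quiver.Path c j) : X c ⟶ shriekObj X j :=
  biproduct.ι (fun p : PathsTo j => X p.1) ⟨c, p⟩

/-- A morphism out of `i_!(X)(j)` is given by its components at all paths ending in `j`. -/
noncomputable def shriekDesc (X : Q → B) {j : Q} {Y : B}
    (g : ∀ {c : Q}, Quiver.Path c j → (X c ⟶ Y)) : shriekObj X j ⟶ Y :=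
  biproduct.desc (f := fun p : PathsTo j => X p.1) fun p => g p.2

lemma shriekι_desc (X : Q → B) {j : Q} {Y : B}
    (g : ∀ {c : Q}, Quiver.Path c j → (X c ⟶ Y)) {c : Q} (p : Quiver.Path c j) :
    shriekι X p ≫ shriekDesc X g = g p :=
  biproduct.ι_desc (f := fun p : PathsTo j => X p.1) _ _

lemma shriekι_desc_assoc (X : Q → B) {j : Q} {Y Z : B}
    (g : ∀ {c : Q}, Quiver.Path c j → (X c ⟶ Y)) {c : Q} (p : Quiver.Path c j) (h : Y ⟶ Z) :
    shriekι X p ≫ shriekDesc X g ≫ h = g p ≫ h := by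
  rw [← Category.assoc, shriekι_desc]

lemma shriek_ext {X : Q → B} {j : Q} {Y : B} {f g : shriekObj X j ⟶ Y}
    (h : ∀ {c : Q} (p : Quiver.Path c j), shriekι X p ≫ f = shriekι X p ≫ g) : f = g :=
  biproduct.hom_ext' _ _ fun p => h p.2

/-- The action of an arrow on `i_!(X)` by prolongation of paths. -/
noncomputable def shriekMap (X : Q → B) {i j : Q} (α : i ⟶ j) : shriekObj X i ⟶ shriekObj X j :=
  shriekDesc X fun p => shriekι X (p.cons α)

lemma shriekι_cons (X : Q → B) {c i j : Q} (p : Quiver.Path c i) (α : i ⟶ j) :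
    shriekι X (p.cons α) = shriekι X p ≫ shriekMap X α := by
  rw [shriekMap, shriekι_desc]

/-- The representation `i_!(X)`. -/
noncomputable abbrev shriek (X : Q → B) : Paths Q ⥤ B :=
  mkRep (shriekObj X) (fun α => shriekMap X α)

variable (Q B) in
/-- The functor `i_!`, left adjoint to `i^*`. -/
noncomputable def iShriek : (Q → B) ⥤ (Paths Q ⥤ B) where
  obj X := shriek X
  map {X Y} f := mapRep (fun i => shriekDesc X fun {c} p => f c ≫ shriekι Y p)
    (fun α => by
      refine shriek_ext fun p => ?_
      simp only [shriekMap, shriekι_desc, shriekι_desc_assoc, Category.assoc])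
  map_id X := mapRep_id fun i => shriek_ext fun p => by
    rw [shriekι_desc, Category.comp_id]
    exact Category.id_comp _
  map_comp {X Y Z} f g := mapRep_comp fun i => shriek_ext fun p => by
    rw [shriekι_desc, shriekι_desc_assoc, Category.assoc, shriekι_desc]
    exact Category.assoc _ _ _

lemma shriekι_compDesc {X : Q → B} {F : Paths Q ⥤ B} (t : shriek X ⟶ F) {c i : Q}
    (p : Quiver.Path c i) :
    (shriekι X (Quiver.Path.nil : Quiver.Path c c) ≫ compDesc t c) ≫ pathMap F p =
      shriekι X p ≫ compDesc t i := by
  induction p with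
  | nil => rw [pathMap_nil, Category.comp_id]
  | cons p α hp =>
    rw [pathMap_cons, ← Category.assoc, hp, shriekι_cons, Category.assoc, Category.assoc,
      ← compDesc_naturality]

/-- Morphisms `i_!(X) ⟶ F` correspond to families of morphisms `X(i) ⟶ F(i)`. -/
noncomputable def shriekHomEquiv (X : Q → B) (F : Paths Q ⥤ B) :
    (shriek X ⟶ F) ≃ (∀ i : Q, X i ⟶ vert F i) where
  toFun t i := shriekι X (Quiver.Path.nil : Quiver.Path i i) ≫ compDesc t i
  invFun g := descRep (fun i => shriekDesc X fun {c} p => g c ≫ pathMap F p) (fun α => by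
    refine shriek_ext fun p => ?_
    simp only [shriekMap, shriekι_desc, shriekι_desc_assoc, pathMap_cons, Category.assoc])
  left_inv t := compDesc_ext fun i => shriek_ext fun p => by
    rw [compDesc_descRep, shriekι_desc, shriekι_compDesc]
  right_inv g := funext fun i => by
    refine (shriekι_desc X (fun {c} p => g c ≫ pathMap F p) Quiver.Path.nil).trans ?_
    rw [pathMap_nil, Category.comp_id]

variable (Q B) in
/-- The adjunction `i_! ⊣ i^*`. -/
noncomputable def shriekAdjunction : iShriek Q B ⊣ iStar Q B :=
  Adjunction.mkOfHomEquiv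
    { homEquiv := fun X F => shriekHomEquiv X F
      homEquiv_naturality_left_symm := fun {X Y F} f g =>
        compDesc_ext fun i => shriek_ext fun p => by
          refine (shriekι_desc X
            (fun {c} p => (f c ≫ (g c : Y c ⟶ vert F c)) ≫ pathMap F p) p).trans ?_
          refine Eq.trans ?_ (shriekι_desc_assoc X (fun {c} p => f c ≫ shriekι Y p) p
            (shriekDesc Y fun {c} p => (g c : Y c ⟶ vert F c) ≫ pathMap F p)).symm
          rw [Category.assoc]
          exact (Category.assoc _ _ _).trans (congrArg (fun t => f _ ≫ t) (shriekι_desc Y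
            (fun {c} p => (g c : Y c ⟶ vert F c) ≫ pathMap F p) p).symm)
      homEquiv_naturality_right := fun {X F G} f g => funext fun i =>
        (Category.assoc (shriekι X (Quiver.Path.nil : Quiver.Path i i)) (compDesc f i)
          (comp g i)).symm }

end Shriek

section LowerStar

variable {Q : Type u} [Quiver.{v} Q] [LocallyBoundedQuiver Q]
  {B : Type u₁} [Category.{v₁} B] [Abelian B]

/-- `i_*(X)(j)`, a direct sum of copies of `X(c)` indexed by the paths from `j` to `c`. -/
noncomputable def starObj (X : Q → B) (j : Q) : B := ⨁ fun p : PathsFrom j => X p.1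

/-- The projection to the copy of `X(c)` that belongs to a path `p` from `j` to `c`. -/
noncomputable def starπ (X : Q → B) {j c : Q} (p : Quiver.Path j c) : starObj X j ⟶ X c :=
  biproduct.π (fun p : PathsFrom j => X p.1) ⟨c, p⟩

/-- A morphism into `i_*(X)(j)` is given by its components at all paths starting in `j`. -/
noncomputable def starLift (X : Q → B) {j : Q} {Y : B}
    (g : ∀ {c : Q}, Quiver.Path j c → (Y ⟶ X c)) : Y ⟶ starObj X j :=
  biproduct.lift (f := fun p : PathsFrom j => X p.1) fun p => g p.2

lemma starLift_π (X : Q → B) {j : Q} {Y : B}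
    (g : ∀ {c : Q}, Quiver.Path j c → (Y ⟶ X c)) {c : Q} (p : Quiver.Path j c) :
    starLift X g ≫ starπ X p = g p :=
  biproduct.lift_π (f := fun p : PathsFrom j => X p.1) _ _

lemma star_ext {X : Q → B} {j : Q} {Y : B} {f g : Y ⟶ starObj X j}
    (h : ∀ {c : Q} (p : Quiver.Path j c), f ≫ starπ X p = g ≫ starπ X p) : f = g :=
  biproduct.hom_ext _ _ fun p => h p.2

/-- The action of an arrow on `i_*(X)`. -/
noncomputable def starMap (X : Q → B) {i j : Q} (α : i ⟶ j) : starObj X i ⟶ starObj X j :=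
  starLift X fun p => starπ X (α.toPath.comp p)

/-- The representation `i_*(X)`. -/
noncomputable abbrev star (X : Q → B) : Paths Q ⥤ B :=
  mkRep (starObj X) (fun α => starMap X α)

variable (Q B) in
/-- The functor `i_*`, right adjoint to `i^*`. -/
noncomputable def iLowerStar : (Q → B) ⥤ (Paths Q ⥤ B) where
  obj X := star X
  map {X Y} f := mapRep (fun i => starLift Y fun {c} p => starπ X p ≫ f c)
    (fun α => by
      refine star_ext fun p => ?_
      rw [Category.assoc, Category.assoc, starLift_π, starMap, starMap, starLift_π, starLift_π,
        ← Category.assoc, starLift_π])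
  map_id X := mapRep_id fun i => star_ext fun p => by
    rw [starLift_π, Category.id_comp]
    exact Category.comp_id _
  map_comp {X Y Z} f g := mapRep_comp fun i => star_ext fun p => by
    rw [starLift_π, Category.assoc, starLift_π, ← Category.assoc, starLift_π]
    exact (Category.assoc _ _ _).symm

lemma pathMap_compLift {X : Q → B} {F : Paths Q ⥤ B} (t : F ⟶ star X) {i c : Q}
    (p : Quiver.Path i c) :
    pathMap F p ≫ compLift t c ≫ starπ X (Quiver.Path.nil : Quiver.Path c c) =
      compLift t i ≫ starπ X p := by
  suffices h : ∀ q : Quiver.Path c c, pathMap F p ≫ compLift t c ≫ starπ X q =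
      compLift t i ≫ starπ X (p.comp q) from h Quiver.Path.nil
  suffices h : ∀ {d : Q} (q : Quiver.Path c d), pathMap F p ≫ compLift t c ≫ starπ X q =
      compLift t i ≫ starπ X (p.comp q) from fun q => h q
  induction p with
  | nil =>
    intro d q
    rw [pathMap_nil, Category.id_comp, Quiver.Path.nil_comp]
  | cons p α hp =>
    intro d q
    have e : (p.cons α).comp q = p.comp (α.toPath.comp q) := by
      rw [← Quiver.Path.comp_assoc]; rfl
    rw [e, ← hp, pathMap_cons, Category.assoc]
    congr 1
    rw [← Category.assoc, compLift_naturality, Category.assoc, starMap, starLift_π]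

/-- Morphisms `F ⟶ i_*(X)` correspond to families of morphisms `F(i) ⟶ X(i)`. -/
noncomputable def starHomEquiv (F : Paths Q ⥤ B) (X : Q → B) :
    (∀ i : Q, vert F i ⟶ X i) ≃ (F ⟶ star X) where
  toFun g := liftRep (fun i => starLift X fun {c} p => pathMap F p ≫ g c) (fun α => by
    refine star_ext fun p => ?_
    rw [Category.assoc, Category.assoc, starMap, starLift_π, starLift_π, starLift_π,
      pathMap_toPath_comp, Category.assoc])
  invFun t i := compLift t i ≫ starπ X (Quiver.Path.nil : Quiver.Path i i)
  left_inv g := funext fun i => by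
    refine (starLift_π X (fun {c} p => pathMap F p ≫ g c) Quiver.Path.nil).trans ?_
    exact (congrArg (fun t => t ≫ g i) (pathMap_nil F i)).trans (Category.id_comp _)
  right_inv t := compLift_ext fun i => star_ext fun p => by
    rw [compLift_liftRep, starLift_π, pathMap_compLift]

variable (Q B) in
/-- The adjunction `i^* ⊣ i_*`. -/
noncomputable def starAdjunction : iStar Q B ⊣ iLowerStar Q B :=
  Adjunction.mkOfHomEquiv
    { homEquiv := fun F X => starHomEquiv F X
      homEquiv_naturality_left_symm := fun {F G X} f g => funext fun i =>
        Category.assoc (comp f i) (compLift g i) (starπ X (Quiver.Path.nil : Quiver.Path i i))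
      homEquiv_naturality_right := fun {F X Y} f g =>
        compLift_ext fun i => star_ext fun p => by
          refine (starLift_π Y
            (fun {c} p => pathMap F p ≫ (f c : vert F c ⟶ X c) ≫ g c) p).trans ?_
          refine Eq.trans ?_ (Category.assoc
            (starLift X fun {c} p => pathMap F p ≫ (f c : vert F c ⟶ X c))
            (starLift Y fun {c} p => starπ X p ≫ g c) (starπ Y p)).symm
          rw [starLift_π]
          exact (Category.assoc _ _ _).symm.trans ((congrArg (fun t => t ≫ g _) (starLift_π X
            (fun {c} p => pathMap F p ≫ (f c : vert F c ⟶ X c)) p).symm).trans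
              (Category.assoc _ _ _)) }

end LowerStar

section Enough

variable {Q : Type u} [Quiver.{v} Q] {B : Type u₁} [Category.{v₁} B] [Abelian B]

lemma mono_iff_comp {F G : Paths Q ⥤ B} (f : F ⟶ G) : Mono f ↔ ∀ i : Q, Mono (comp f i) :=
  NatTrans.mono_iff_mono_app f

lemma epi_iff_comp {F G : Paths Q ⥤ B} (f : F ⟶ G) : Epi f ↔ ∀ i : Q, Epi (comp f i) :=
  NatTrans.epi_iff_epi_app f

variable [LocallyBoundedQuiver Q]

/-- Representations over an abelian category with enough projectives have enough projectives. -/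
instance enoughProjectives [EnoughProjectives B] : EnoughProjectives (Paths Q ⥤ B) where
  presentation F := by
    let X : Q → B := fun i => Projective.over (vert F i)
    let π : ∀ i : Q, X i ⟶ vert F i := fun i => Projective.π (vert F i)
    refine ⟨{ p := shriek X, f := (shriekHomEquiv X F).symm π, projective := ?_, epi := ?_ }⟩
    · refine ⟨fun {E G} f e he => ?_⟩
      have he' : ∀ i : Q, Epi (comp e i) := (epi_iff_comp e).1 he
      refine ⟨(shriekHomEquiv X E).symm fun i =>
        Projective.factorThru (shriekHomEquiv X G f i) (comp e i), ?_⟩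
      refine (shriekHomEquiv X G).injective (funext fun i => ?_)
      have h : shriekHomEquiv X G ((shriekHomEquiv X E).symm (fun i =>
          Projective.factorThru (shriekHomEquiv X G f i) (comp e i)) ≫ e) i =
        shriekHomEquiv X E ((shriekHomEquiv X E).symm (fun i =>
          Projective.factorThru (shriekHomEquiv X G f i) (comp e i))) i ≫ comp e i :=
        (Category.assoc _ _ _).symm
      rw [h, Equiv.apply_symm_apply, Projective.factorThru_comp]
    · refine (epi_iff_comp _).2 fun i => ?_
      have h : shriekι X (Quiver.Path.nil : Quiver.Path i i) ≫
          compDesc ((shriekHomEquiv X F).symm π) i = π i :=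
        congrFun ((shriekHomEquiv X F).apply_symm_apply π) i
      have : Epi (shriekι X (Quiver.Path.nil : Quiver.Path i i) ≫
          compDesc ((shriekHomEquiv X F).symm π) i) := by
        rw [h]; exact Projective.π_epi _
      exact epi_of_epi (shriekι X (Quiver.Path.nil : Quiver.Path i i))
        (compDesc ((shriekHomEquiv X F).symm π) i)

/-- Representations over an abelian category with enough injectives have enough injectives. -/
instance enoughInjectives [EnoughInjectives B] : EnoughInjectives (Paths Q ⥤ B) where
  presentation F := by
    let X : Q → B := fun i => Injective.under (vert F i)
    let ι : ∀ i : Q, vert F i ⟶ X i := fun i => Injective.ι (vert F i)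
    refine ⟨{ J := star X, f := starHomEquiv F X ι, injective := ?_, mono := ?_ }⟩
    · refine ⟨fun {E G} f e he => ?_⟩
      have he' : ∀ i : Q, Mono (comp e i) := (mono_iff_comp e).1 he
      refine ⟨starHomEquiv G X fun i =>
        Injective.factorThru ((starHomEquiv E X).symm f i) (comp e i), ?_⟩
      refine (starHomEquiv E X).symm.injective (funext fun i => ?_)
      have h : (starHomEquiv E X).symm (e ≫ starHomEquiv G X (fun i =>
          Injective.factorThru ((starHomEquiv E X).symm f i) (comp e i))) i =
        comp e i ≫ (starHomEquiv G X).symm (starHomEquiv G X (fun i =>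
          Injective.factorThru ((starHomEquiv E X).symm f i) (comp e i))) i :=
        Category.assoc _ _ _
      rw [h, Equiv.symm_apply_apply, Injective.comp_factorThru]
    · refine (mono_iff_comp _).2 fun i => ?_
      have h : compLift (starHomEquiv F X ι) i ≫
          starπ X (Quiver.Path.nil : Quiver.Path i i) = ι i :=
        congrFun ((starHomEquiv F X).symm_apply_apply ι) i
      have : Mono (compLift (starHomEquiv F X ι) i ≫
          starπ X (Quiver.Path.nil : Quiver.Path i i)) := by
        rw [h]; exact Injective.ι_mono _
      exact mono_of_mono (compLift (starHomEquiv F X ι) i)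
        (starπ X (Quiver.Path.nil : Quiver.Path i i))

end Enough

section Nakayama

variable {Q : Type u} [Quiver.{v} Q] [LocallyBoundedQuiver Q]
  {B : Type u₁} [Category.{v₁} B] [Abelian B]

lemma sum_fiber {X Y Z M : Type*} [Fintype X] [Fintype Y] [DecidableEq X] [DecidableEq Z]
    [AddCommMonoid M] (f : X → Z)
    (g : Y → X) (h : Y → M) (z : Z) :
    (∑ x, if f x = z then (∑ y, if g y = x then h y else 0) else 0) =
      ∑ y, if f (g y) = z then h y else 0 := by
  have e : ∀ x, (if f x = z then (∑ y, if g y = x then h y else 0) else 0) =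
      ∑ y, if g y = x then (if f (g y) = z then h y else 0) else 0 := fun x => by
    split_ifs with hx
    · refine Finset.sum_congr rfl fun y _ => ?_
      split_ifs with h₁ h₂
      · rfl
      · exact absurd (h₁ ▸ hx) h₂
      · rfl
    · refine (Finset.sum_eq_zero fun y _ => ?_).symm
      split_ifs with h₁ h₂
      · exact absurd (h₁ ▸ h₂) hx
      · rfl
      · rfl
  rw [Finset.sum_congr rfl fun x _ => e x, Finset.sum_comm]
  exact Finset.sum_congr rfl fun y _ => by rw [Finset.sum_ite_eq, if_pos (Finset.mem_univ _)]

open Classical in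
/-- The relations `p^* ⊗ f_α(x) = (p^* · α) ⊗ x`, for paths `p` starting in `i`, arrows `α` ending
where `p` ends, and `x` in `F(s(α))`. Here `p^*` is the dual basis of `D(kQ(i, -))`, and
`p^* · α = ∑_q p^*(qα) q^*` is the sum of all `q^*` with `qα = p` (`q` followed by `α`). -/
noncomputable def nakRel (F : Paths Q ⥤ B) (i : Q) :
    (⨁ fun r : (Σ p : PathsFrom i, Σ j : Q, (j ⟶ p.1)) => vert F r.2.1) ⟶
      ⨁ fun p : PathsFrom i => vert F p.1 :=
  biproduct.desc fun r =>
    arr F r.2.2 ≫ biproduct.ι (fun p : PathsFrom i => vert F p.1) r.1 -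
      ∑ q : Quiver.Path i r.2.1, if q.cons r.2.2 = r.1.2 then
        biproduct.ι (fun p : PathsFrom i => vert F p.1) ⟨r.2.1, q⟩ else 0

/-- `ν(F)(i) = D(kQ(i, -)) ⊗_{kQ} F`, where `D = Hom_k(-, k)`: the direct sum of the
`p^* ⊗ F(t(p))` over all paths `p` starting in `i`, modulo the tensor relations. -/
noncomputable abbrev nakObj (F : Paths Q ⥤ B) (i : Q) : B := cokernel (nakRel F i)

/-- The morphism `x ↦ p^* ⊗ x` from `F(j)` to `ν(F)(i)`, for a path `p` from `i` to `j`. -/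
noncomputable def nakι (F : Paths Q ⥤ B) {i j : Q} (p : Quiver.Path i j) : vert F j ⟶ nakObj F i :=
  biproduct.ι (fun p : PathsFrom i => vert F p.1) ⟨j, p⟩ ≫ cokernel.π (nakRel F i)

open Classical in
lemma arr_nakι (F : Paths Q ⥤ B) {i j l : Q} (p : Quiver.Path i l) (α : j ⟶ l) :
    arr F α ≫ nakι F p = ∑ q : Quiver.Path i j, if q.cons α = p then nakι F q else 0 := by
  have h := biproduct.ι (fun r : (Σ p : PathsFrom i, Σ j : Q, (j ⟶ p.1)) => vert F r.2.1)
    ⟨⟨l, p⟩, ⟨j, α⟩⟩ ≫= cokernel.condition (nakRel F i)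
  rw [comp_zero, ← Category.assoc, nakRel, biproduct.ι_desc, Preadditive.sub_comp, sub_eq_zero,
    Preadditive.sum_comp, Category.assoc] at h
  refine h.trans (Finset.sum_congr rfl fun q _ => ?_)
  split_ifs
  · rfl
  · exact zero_comp

open Classical in
/-- The universal property of `ν(F)(i)`. -/
noncomputable def nakDesc (F : Paths Q ⥤ B) {i : Q} {Y : B}
    (g : ∀ {j : Q}, Quiver.Path i j → (vert F j ⟶ Y))
    (h : ∀ {j l : Q} (p : Quiver.Path i l) (α : j ⟶ l),
      arr F α ≫ g p = ∑ q : Quiver.Path i j, if q.cons α = p then g q else 0) : nakObj F i ⟶ Y :=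
  cokernel.desc (nakRel F i) (biproduct.desc fun p => g p.2) (by
    refine biproduct.hom_ext' _ _ fun r => ?_
    rw [nakRel, ← Category.assoc, biproduct.ι_desc, comp_zero, Preadditive.sub_comp, sub_eq_zero,
      Category.assoc, biproduct.ι_desc, h, Preadditive.sum_comp]
    refine Finset.sum_congr rfl fun q _ => ?_
    split_ifs
    · rw [biproduct.ι_desc]
    · rw [zero_comp])

open Classical in
lemma nakι_desc (F : Paths Q ⥤ B) {i : Q} {Y : B}
    (g : ∀ {j : Q}, Quiver.Path i j → (vert F j ⟶ Y))
    (h : ∀ {j l : Q} (p : Quiver.Path i l) (α : j ⟶ l),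
      arr F α ≫ g p = ∑ q : Quiver.Path i j, if q.cons α = p then g q else 0)
    {j : Q} (p : Quiver.Path i j) : nakι F p ≫ nakDesc F g h = g p := by
  rw [nakι, nakDesc, Category.assoc, cokernel.π_desc, biproduct.ι_desc]

lemma nak_ext {F : Paths Q ⥤ B} {i : Q} {Y : B} {f g : nakObj F i ⟶ Y}
    (h : ∀ {j : Q} (p : Quiver.Path i j), nakι F p ≫ f = nakι F p ≫ g) : f = g := by
  refine (cancel_epi (cokernel.π (nakRel F i))).1 (biproduct.hom_ext' _ _ fun p => ?_)
  have := h p.2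
  rwa [nakι, Category.assoc, Category.assoc] at this

open Classical in
lemma nakMap_rel (F : Paths Q ⥤ B) {i i' : Q} (β : i ⟶ i') {j l : Q} (p : Quiver.Path i l)
    (α : j ⟶ l) :
    (arr F α ≫ ∑ q : Quiver.Path i' l, if β.toPath.comp q = p then nakι F q else 0) =
      ∑ q : Quiver.Path i j, if q.cons α = p then
        (∑ q' : Quiver.Path i' j, if β.toPath.comp q' = q then nakι F q' else 0) else 0 := by
  have e : ∀ q : Quiver.Path i' l,
      arr F α ≫ (if β.toPath.comp q = p then nakι F q else 0) =
        if β.toPath.comp q = p then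
          (∑ q' : Quiver.Path i' j, if q'.cons α = q then nakι F q' else 0) else 0 := by
    intro q
    split_ifs
    · exact arr_nakι F q α
    · exact comp_zero
  rw [Preadditive.comp_sum, Finset.sum_congr rfl fun q _ => e q]
  exact (sum_fiber (fun q : Quiver.Path i' l => β.toPath.comp q)
    (fun q' : Quiver.Path i' j => q'.cons α) (fun q' => nakι F q') p).trans
    (sum_fiber (fun q : Quiver.Path i j => q.cons α)
    (fun q' : Quiver.Path i' j => β.toPath.comp q') (fun q' => nakι F q') p).symm

open Classical in
/-- The action of an arrow `β : i ⟶ i'` on `ν(F)`, induced by the dual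
`D(kQ(i, -)) ⟶ D(kQ(i', -))` of composition with `β`: it sends `p^*` to
`∑_q p^*(βq) q^*`, the sum of all `q^*` with `βq = p` (`β` followed by `q`). -/
noncomputable def nakMap (F : Paths Q ⥤ B) {i i' : Q} (β : i ⟶ i') : nakObj F i ⟶ nakObj F i' :=
  nakDesc F (fun {j} p => ∑ q : Quiver.Path i' j,
    if β.toPath.comp q = p then nakι F q else 0) (nakMap_rel F β)

open Classical in
lemma nakι_map (F : Paths Q ⥤ B) {i i' j : Q} (β : i ⟶ i') (p : Quiver.Path i j) :
    nakι F p ≫ nakMap F β =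
      ∑ q : Quiver.Path i' j, if β.toPath.comp q = p then nakι F q else 0 :=
  nakι_desc F _ (nakMap_rel F β) p

/-- The representation `ν(F) = D(kQ) ⊗_{kQ} F`. -/
noncomputable abbrev nak (F : Paths Q ⥤ B) : Paths Q ⥤ B :=
  mkRep (nakObj F) (fun β => nakMap F β)

open Classical in
lemma nakHom_rel {F G : Paths Q ⥤ B} (f : F ⟶ G) {i j l : Q} (p : Quiver.Path i l) (α : j ⟶ l) :
    arr F α ≫ comp f l ≫ nakι G p =
      ∑ q : Quiver.Path i j, if q.cons α = p then comp f j ≫ nakι G q else 0 := by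
  rw [← Category.assoc, comp_naturality, Category.assoc, arr_nakι, Preadditive.comp_sum]
  refine Finset.sum_congr rfl fun q _ => ?_
  split_ifs
  · rfl
  · exact comp_zero

/-- The morphism `ν(F)(i) ⟶ ν(G)(i)` induced by a morphism `F ⟶ G`. -/
noncomputable def nakHom {F G : Paths Q ⥤ B} (f : F ⟶ G) (i : Q) : nakObj F i ⟶ nakObj G i :=
  nakDesc F (fun {j} p => comp f j ≫ nakι G p) (nakHom_rel f)

lemma nakι_hom {F G : Paths Q ⥤ B} (f : F ⟶ G) {i j : Q} (p : Quiver.Path i j) :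
    nakι F p ≫ nakHom f i = comp f j ≫ nakι G p :=
  nakι_desc F _ (nakHom_rel f) p

lemma nakMap_nakHom {F G : Paths Q ⥤ B} (f : F ⟶ G) {i i' : Q} (β : i ⟶ i') :
    nakMap F β ≫ nakHom f i' = nakHom f i ≫ nakMap G β := by
  refine nak_ext fun {j} p => ?_
  rw [← Category.assoc, ← Category.assoc, nakι_map, nakι_hom, Category.assoc, nakι_map,
    Preadditive.sum_comp, Preadditive.comp_sum]
  refine Finset.sum_congr rfl fun q _ => ?_
  split_ifs
  · exact nakι_hom f q
  · rw [zero_comp, comp_zero]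

variable (Q B) in
/-- The Nakayama functor `ν = D(kQ) ⊗_{kQ} -`. -/
noncomputable def nakayama : (Paths Q ⥤ B) ⥤ (Paths Q ⥤ B) where
  obj F := nak F
  map f := mapRep (nakHom f) (nakMap_nakHom f)
  map_id F := mapRep_id fun i => nak_ext fun {j} p => by
    rw [nakι_hom, Category.comp_id]
    exact Category.id_comp _
  map_comp {F G H} f g := mapRep_comp fun i => nak_ext fun {j} p => by
    rw [nakι_hom, ← Category.assoc, nakι_hom, Category.assoc, nakι_hom]
    exact Category.assoc _ _ _

end Nakayama

section WeightedColimit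

variable {Q : Type u} [Quiver.{v} Q] [LocallyBoundedQuiver Q]
  {B : Type u₁} [Category.{v₁} B] [Abelian B] (k : Type w) [CommRing k] [Linear k B]

/-- The right `kQ`-module `D(kQ(i, -)) = Hom_k(kQ(i, -), k)` at the vertex `j`, where `kQ(i, j)` is
the free `k`-module on the paths from `i` to `j`. -/
abbrev DualPaths (i j : Q) : Type _ := Module.Dual k (Quiver.Path i j →₀ k)

/-- The right action `φ ↦ φ · α` of an arrow `α : j ⟶ l` on `D(kQ(i, -))`. -/
noncomputable abbrev dualAct {i j l : Q} (φ : DualPaths k i l) (α : j ⟶ l) : DualPaths k i j :=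
  φ ∘ₗ Finsupp.lmapDomain k k (fun q : Quiver.Path i j => q.cons α)

/-- The natural transformations `D(kQ(i, -)) ⟶ Hom_B(F(-), Y)` of right `kQ`-modules. -/
def WeightedCocone (F : Paths Q ⥤ B) (i : Q) (Y : B) : Type _ :=
  { g : ∀ j : Q, DualPaths k i j →ₗ[k] (vert F j ⟶ Y) //
    ∀ {j l : Q} (α : j ⟶ l) (φ : DualPaths k i l), g j (dualAct k φ α) = arr F α ≫ g l φ }

open Classical in
lemma dualAct_lapply {i j l : Q} (p : Quiver.Path i l) (α : j ⟶ l) :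
    dualAct k (Finsupp.lapply p) α =
      ∑ q : Quiver.Path i j,
        if q.cons α = p then (Finsupp.lapply q : DualPaths k i j) else 0 := by
  refine Finsupp.lhom_ext' fun q => LinearMap.ext_ring ?_
  have e : ∀ q' : Quiver.Path i j,
      (if q'.cons α = p then (Finsupp.lapply q' : DualPaths k i j) else 0) (Finsupp.single q 1) =
        if q = q' then (if q.cons α = p then 1 else 0) else 0 := by
    intro q'
    by_cases h : q = q'
    · subst h
      by_cases h' : q.cons α = p <;> simp [h']
    · by_cases h' : q'.cons α = p <;> simp [h, h']
  simp [dualAct, Finsupp.mapDomain_single, Finsupp.single_apply, e]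

lemma dual_expand {i j : Q} (φ : DualPaths k i j) :
    φ = ∑ p : Quiver.Path i j, φ (Finsupp.single p 1) • (Finsupp.lapply p : DualPaths k i j) := by
  classical
  refine Finsupp.lhom_ext' fun q => LinearMap.ext_ring ?_
  simp [Finsupp.single_apply]

open Classical in
lemma weighted_rel {F : Paths Q ⥤ B} {i : Q} {Y : B} (g : WeightedCocone k F i Y) {j l : Q}
    (p : Quiver.Path i l) (α : j ⟶ l) :
    arr F α ≫ g.1 l (Finsupp.lapply p) =
      ∑ q : Quiver.Path i j, if q.cons α = p then g.1 j (Finsupp.lapply q) else 0 := by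
  rw [← g.2 α, dualAct_lapply, map_sum]
  refine Finset.sum_congr rfl fun q _ => ?_
  split_ifs
  · rfl
  · exact map_zero _

open Classical in
/-- `ν(F)(i)` is the weighted colimit `D(kQ(i, -)) ⊗_{kQ} F`: morphisms `ν(F)(i) ⟶ Y` correspond
to natural transformations `D(kQ(i, -)) ⟶ Hom_B(F(-), Y)`. -/
noncomputable def nakWeightedEquiv (F : Paths Q ⥤ B) (i : Q) (Y : B) :
    (nakObj F i ⟶ Y) ≃ WeightedCocone k F i Y where
  toFun f := ⟨fun j =>
    { toFun := fun φ => ∑ p : Quiver.Path i j, φ (Finsupp.single p 1) • (nakι F p ≫ f)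
      map_add' := fun φ ψ => by
        simp only [LinearMap.add_apply, add_smul, Finset.sum_add_distrib]
      map_smul' := fun c φ => by
        simp only [LinearMap.smul_apply, smul_eq_mul, mul_smul, Finset.smul_sum,
          RingHom.id_apply] }, fun {j l} α φ => by
    have e : ∀ p : Quiver.Path i l,
        arr F α ≫ (φ (Finsupp.single p 1) • (nakι F p ≫ f)) =
          ∑ q : Quiver.Path i j,
            if q.cons α = p then φ (Finsupp.single (q.cons α) 1) • (nakι F q ≫ f) else 0 := by
      intro p
      rw [Linear.comp_smul, ← Category.assoc, arr_nakι, Preadditive.sum_comp, Finset.smul_sum]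
      refine Finset.sum_congr rfl fun q _ => ?_
      split_ifs with h
      · rw [h]
      · rw [zero_comp, smul_zero]
    refine Eq.trans ?_ (Preadditive.comp_sum _ _ _).symm
    rw [Finset.sum_congr rfl fun p _ => e p, Finset.sum_comm]
    refine Finset.sum_congr rfl fun q _ => ?_
    rw [Finset.sum_ite_eq, if_pos (Finset.mem_univ _)]
    simp [dualAct, Finsupp.mapDomain_single]⟩
  invFun g := nakDesc F (fun {j} p => g.1 j (Finsupp.lapply p)) (weighted_rel k g)
  left_inv f := nak_ext fun {j} p => by
    refine (nakι_desc F _ (weighted_rel k _) p).trans ?_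
    change ∑ p' : Quiver.Path i j, (Finsupp.lapply p : DualPaths k i j) (Finsupp.single p' 1) •
      (nakι F p' ≫ f) = nakι F p ≫ f
    simp [Finsupp.single_apply, ite_smul]
  right_inv g := by
    refine Subtype.ext (funext fun j => LinearMap.ext fun φ => ?_)
    refine (Finset.sum_congr rfl fun p _ => congrArg (fun t => φ (Finsupp.single p 1) • t)
      (nakι_desc F _ (weighted_rel k g) p)).trans ?_
    conv_rhs => rw [dual_expand k φ, map_sum]
    exact Finset.sum_congr rfl fun p _ => ((g.1 j).map_smul _ _).symm

end WeightedColimit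

section NakayamaRight

variable {Q : Type u} [Quiver.{v} Q] [LocallyBoundedQuiver Q]
  {B : Type u₁} [Category.{v₁} B] [Abelian B]

open Classical in
/-- The equations `g_β(h_p) = ∑_q p^*(βq) h_q` for paths `p` ending in `i` and arrows `β` starting
where `p` starts; the sum is over all `q` with `βq = p` (`β` followed by `q`). -/
noncomputable def nakRightRel (G : Paths Q ⥤ B) (i : Q) :
    (⨁ fun p : PathsTo i => vert G p.1) ⟶
      ⨁ fun r : (Σ p : PathsTo i, Σ j : Q, (p.1 ⟶ j)) => vert G r.2.1 :=
  biproduct.lift fun r =>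
    biproduct.π (fun p : PathsTo i => vert G p.1) r.1 ≫ arr G r.2.2 -
      ∑ q : Quiver.Path r.2.1 i, if r.2.2.toPath.comp q = r.1.2 then
        biproduct.π (fun p : PathsTo i => vert G p.1) ⟨r.2.1, q⟩ else 0

/-- `ν⁻(G)(i) = Hom_{kQ}(D(kQ(-, i)), G)`: the families `(h_p)` of elements of `G(s(p))`, indexed
by the paths `p` ending in `i` (the images of the `p^*`), that are `kQ`-linear. -/
noncomputable abbrev nakRightObj (G : Paths Q ⥤ B) (i : Q) : B := kernel (nakRightRel G i)

/-- The morphism `h ↦ h_p = h(p^*)` from `ν⁻(G)(i)` to `G(j)`, for a path `p` from `j` to `i`. -/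
noncomputable def nakRightπ (G : Paths Q ⥤ B) {j i : Q} (p : Quiver.Path j i) :
    nakRightObj G i ⟶ vert G j :=
  kernel.ι (nakRightRel G i) ≫ biproduct.π (fun p : PathsTo i => vert G p.1) ⟨j, p⟩

open Classical in
lemma nakRightπ_arr (G : Paths Q ⥤ B) {j l i : Q} (p : Quiver.Path j i) (β : j ⟶ l) :
    nakRightπ G p ≫ arr G β =
      ∑ q : Quiver.Path l i, if β.toPath.comp q = p then nakRightπ G q else 0 := by
  have h := kernel.condition (nakRightRel G i) =≫
    biproduct.π (fun r : (Σ p : PathsTo i, Σ j : Q, (p.1 ⟶ j)) => vert G r.2.1) ⟨⟨j, p⟩, ⟨l, β⟩⟩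
  rw [zero_comp, Category.assoc, nakRightRel, biproduct.lift_π, Preadditive.comp_sub, sub_eq_zero,
    Preadditive.comp_sum, ← Category.assoc] at h
  refine h.trans (Finset.sum_congr rfl fun q _ => ?_)
  split_ifs
  · rfl
  · exact comp_zero

open Classical in
/-- The universal property of `ν⁻(G)(i)`. -/
noncomputable def nakRightLift (G : Paths Q ⥤ B) {i : Q} {Y : B}
    (g : ∀ {j : Q}, Quiver.Path j i → (Y ⟶ vert G j))
    (h : ∀ {j l : Q} (p : Quiver.Path j i) (β : j ⟶ l),
      g p ≫ arr G β = ∑ q : Quiver.Path l i, if β.toPath.comp q = p then g q else 0) :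
    Y ⟶ nakRightObj G i :=
  kernel.lift (nakRightRel G i) (biproduct.lift fun p => g p.2) (by
    refine biproduct.hom_ext _ _ fun r => ?_
    rw [nakRightRel, Category.assoc, biproduct.lift_π, zero_comp, Preadditive.comp_sub,
      sub_eq_zero, ← Category.assoc, biproduct.lift_π, h, Preadditive.comp_sum]
    refine Finset.sum_congr rfl fun q _ => ?_
    split_ifs
    · rw [biproduct.lift_π]
    · rw [comp_zero])

open Classical in
lemma nakRightLift_π (G : Paths Q ⥤ B) {i : Q} {Y : B}
    (g : ∀ {j : Q}, Quiver.Path j i → (Y ⟶ vert G j))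
    (h : ∀ {j l : Q} (p : Quiver.Path j i) (β : j ⟶ l),
      g p ≫ arr G β = ∑ q : Quiver.Path l i, if β.toPath.comp q = p then g q else 0)
    {j : Q} (p : Quiver.Path j i) : nakRightLift G g h ≫ nakRightπ G p = g p := by
  rw [nakRightπ, nakRightLift, kernel.lift_ι_assoc, biproduct.lift_π]

lemma nakRight_ext {G : Paths Q ⥤ B} {i : Q} {Y : B} {f g : Y ⟶ nakRightObj G i}
    (h : ∀ {j : Q} (p : Quiver.Path j i), f ≫ nakRightπ G p = g ≫ nakRightπ G p) : f = g := by
  refine (cancel_mono (kernel.ι (nakRightRel G i))).1 (biproduct.hom_ext _ _ fun p => ?_)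
  have := h p.2
  rwa [nakRightπ, ← Category.assoc, ← Category.assoc] at this

open Classical in
lemma nakRightMap_rel (G : Paths Q ⥤ B) {i i' : Q} (α : i ⟶ i') {j l : Q} (p : Quiver.Path j i')
    (β : j ⟶ l) :
    (∑ q : Quiver.Path j i, if q.cons α = p then nakRightπ G q else 0) ≫ arr G β =
      ∑ q : Quiver.Path l i', if β.toPath.comp q = p then
        (∑ q' : Quiver.Path l i, if q'.cons α = q then nakRightπ G q' else 0) else 0 := by
  have e : ∀ q : Quiver.Path j i,
      (if q.cons α = p then nakRightπ G q else 0) ≫ arr G β =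
        if q.cons α = p then
          (∑ q' : Quiver.Path l i, if β.toPath.comp q' = q then nakRightπ G q' else 0)
          else 0 := by
    intro q
    split_ifs
    · exact nakRightπ_arr G q β
    · exact zero_comp
  rw [Preadditive.sum_comp, Finset.sum_congr rfl fun q _ => e q]
  exact (sum_fiber (fun q : Quiver.Path j i => q.cons α)
    (fun q' : Quiver.Path l i => β.toPath.comp q') (fun q' => nakRightπ G q') p).trans
    (sum_fiber (fun q : Quiver.Path l i' => β.toPath.comp q)
    (fun q' : Quiver.Path l i => q'.cons α) (fun q' => nakRightπ G q') p).symm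

open Classical in
/-- The action of an arrow `α : i ⟶ i'` on `ν⁻(G)`, induced by the dual
`D(kQ(-, i')) ⟶ D(kQ(-, i))` of composition with `α`: it sends `p^*` to the sum of all `q^*`
with `qα = p` (`q` followed by `α`). -/
noncomputable def nakRightMap (G : Paths Q ⥤ B) {i i' : Q} (α : i ⟶ i') :
    nakRightObj G i ⟶ nakRightObj G i' :=
  nakRightLift G (fun {j} p => ∑ q : Quiver.Path j i,
    if q.cons α = p then nakRightπ G q else 0) (nakRightMap_rel G α)

open Classical in
lemma nakRightMap_π (G : Paths Q ⥤ B) {i i' j : Q} (α : i ⟶ i') (p : Quiver.Path j i') :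
    nakRightMap G α ≫ nakRightπ G p =
      ∑ q : Quiver.Path j i, if q.cons α = p then nakRightπ G q else 0 :=
  nakRightLift_π G _ (nakRightMap_rel G α) p

/-- The representation `ν⁻(G) = Hom_{kQ}(D(kQ), G)`. -/
noncomputable abbrev nakRight (G : Paths Q ⥤ B) : Paths Q ⥤ B :=
  mkRep (nakRightObj G) (fun α => nakRightMap G α)

open Classical in
lemma nakRightHom_rel {F G : Paths Q ⥤ B} (f : F ⟶ G) {i j l : Q} (p : Quiver.Path j i)
    (β : j ⟶ l) :
    (nakRightπ F p ≫ comp f j) ≫ arr G β =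
      ∑ q : Quiver.Path l i, if β.toPath.comp q = p then nakRightπ F q ≫ comp f l else 0 := by
  rw [Category.assoc, ← comp_naturality, ← Category.assoc, nakRightπ_arr, Preadditive.sum_comp]
  refine Finset.sum_congr rfl fun q _ => ?_
  split_ifs
  · rfl
  · exact zero_comp

/-- The morphism `ν⁻(F)(i) ⟶ ν⁻(G)(i)` induced by a morphism `F ⟶ G`. -/
noncomputable def nakRightHom {F G : Paths Q ⥤ B} (f : F ⟶ G) (i : Q) :
    nakRightObj F i ⟶ nakRightObj G i :=
  nakRightLift G (fun {j} p => nakRightπ F p ≫ comp f j) (nakRightHom_rel f)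

lemma nakRightHom_π {F G : Paths Q ⥤ B} (f : F ⟶ G) {i j : Q} (p : Quiver.Path j i) :
    nakRightHom f i ≫ nakRightπ G p = nakRightπ F p ≫ comp f j :=
  nakRightLift_π G _ (nakRightHom_rel f) p

lemma nakRightMap_nakRightHom {F G : Paths Q ⥤ B} (f : F ⟶ G) {i i' : Q} (α : i ⟶ i') :
    nakRightMap F α ≫ nakRightHom f i' = nakRightHom f i ≫ nakRightMap G α := by
  refine nakRight_ext fun {j} p => ?_
  rw [Category.assoc, Category.assoc, nakRightMap_π, nakRightHom_π, ← Category.assoc,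
    nakRightMap_π, Preadditive.sum_comp, Preadditive.comp_sum]
  refine Finset.sum_congr rfl fun q _ => ?_
  split_ifs
  · exact (nakRightHom_π f q).symm
  · rw [zero_comp, comp_zero]

variable (Q B) in
/-- The functor `ν⁻ = Hom_{kQ}(D(kQ), -)`. -/
noncomputable def nakayamaRight : (Paths Q ⥤ B) ⥤ (Paths Q ⥤ B) where
  obj G := nakRight G
  map f := mapRep (nakRightHom f) (nakRightMap_nakRightHom f)
  map_id F := mapRep_id fun i => nakRight_ext fun {j} p => by
    rw [nakRightHom_π, Category.id_comp]
    exact Category.comp_id _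
  map_comp {F G H} f g := mapRep_comp fun i => nakRight_ext fun {j} p => by
    rw [nakRightHom_π, Category.assoc, nakRightHom_π, ← Category.assoc, nakRightHom_π]
    exact (Category.assoc _ _ _).symm

open Classical in
lemma nakToRight_rel {F G : Paths Q ⥤ B} (t : nak F ⟶ G) {i j l : Q} (p : Quiver.Path i j)
    (β : i ⟶ l) :
    (nakι F p ≫ compDesc t i) ≫ arr G β =
      ∑ q : Quiver.Path l j, if β.toPath.comp q = p then nakι F q ≫ compDesc t l else 0 := by
  rw [Category.assoc, ← compDesc_naturality, ← Category.assoc, nakι_map, Preadditive.sum_comp]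
  refine Finset.sum_congr rfl fun q _ => ?_
  split_ifs
  · rfl
  · exact zero_comp

/-- The components of the morphism `F ⟶ ν⁻(G)` adjoint to `t : ν(F) ⟶ G`. -/
noncomputable def nakToRight {F G : Paths Q ⥤ B} (t : nak F ⟶ G) (j : Q) :
    vert F j ⟶ nakRightObj G j :=
  nakRightLift G (fun {i} p => nakι F p ≫ compDesc t i) (nakToRight_rel t)

lemma nakToRight_π {F G : Paths Q ⥤ B} (t : nak F ⟶ G) {i j : Q} (p : Quiver.Path i j) :
    nakToRight t j ≫ nakRightπ G p = nakι F p ≫ compDesc t i :=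
  nakRightLift_π G _ (nakToRight_rel t) p

open Classical in
lemma nakOfRight_rel {F G : Paths Q ⥤ B} (t : F ⟶ nakRight G) {i j l : Q} (p : Quiver.Path i l)
    (α : j ⟶ l) :
    arr F α ≫ compLift t l ≫ nakRightπ G p =
      ∑ q : Quiver.Path i j, if q.cons α = p then compLift t j ≫ nakRightπ G q else 0 := by
  rw [← Category.assoc, compLift_naturality, Category.assoc, nakRightMap_π, Preadditive.comp_sum]
  refine Finset.sum_congr rfl fun q _ => ?_
  split_ifs
  · rfl
  · exact comp_zero

/-- The components of the morphism `ν(F) ⟶ G` adjoint to `t : F ⟶ ν⁻(G)`. -/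
noncomputable def nakOfRight {F G : Paths Q ⥤ B} (t : F ⟶ nakRight G) (i : Q) :
    nakObj F i ⟶ vert G i :=
  nakDesc F (fun {j} p => compLift t j ≫ nakRightπ G p) (nakOfRight_rel t)

lemma nakι_ofRight {F G : Paths Q ⥤ B} (t : F ⟶ nakRight G) {i j : Q} (p : Quiver.Path i j) :
    nakι F p ≫ nakOfRight t i = compLift t j ≫ nakRightπ G p :=
  nakι_desc F _ (nakOfRight_rel t) p

/-- Morphisms `ν(F) ⟶ G` correspond to morphisms `F ⟶ ν⁻(G)`: both are given by families of
morphisms `F(j) ⟶ G(i)` indexed by the paths from `i` to `j`, with the same conditions. -/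
noncomputable def nakayamaHomEquiv (F G : Paths Q ⥤ B) : (nak F ⟶ G) ≃ (F ⟶ nakRight G) where
  toFun t := liftRep (nakToRight t) (fun {j l} α => by
    refine nakRight_ext fun {i} p => ?_
    rw [Category.assoc, Category.assoc, nakToRight_π, nakRightMap_π, ← Category.assoc,
      arr_nakι, Preadditive.sum_comp, Preadditive.comp_sum]
    refine Finset.sum_congr rfl fun q _ => ?_
    split_ifs
    · rw [nakToRight_π]
    · rw [zero_comp, comp_zero])
  invFun t := descRep (nakOfRight t) (fun {i l} β => by
    refine nak_ext fun {j} p => ?_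
    rw [← Category.assoc, ← Category.assoc, nakι_ofRight, nakι_map, Category.assoc,
      nakRightπ_arr, Preadditive.sum_comp, Preadditive.comp_sum]
    refine Finset.sum_congr rfl fun q _ => ?_
    split_ifs
    · rw [nakι_ofRight]
    · rw [zero_comp, comp_zero])
  left_inv t := compDesc_ext fun i => nak_ext fun {j} p => by
    rw [compDesc_descRep, nakι_ofRight, compLift_liftRep, nakToRight_π]
  right_inv t := compLift_ext fun j => nakRight_ext fun {i} p => by
    rw [compLift_liftRep, nakToRight_π, compDesc_descRep, nakι_ofRight]

lemma nakOfRight_naturality {E F G : Paths Q ⥤ B} (f : E ⟶ F) (g : F ⟶ nakRight G) (i : Q) :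
    nakOfRight (f ≫ g) i = nakHom f i ≫ nakOfRight g i := nak_ext fun {j} p => by
  rw [nakι_ofRight, ← Category.assoc, nakι_hom, Category.assoc, nakι_ofRight, compLift_comp,
    Category.assoc]

lemma nakToRight_naturality {E F G : Paths Q ⥤ B} (f : nak E ⟶ F) (g : F ⟶ G) (j : Q) :
    nakToRight (f ≫ g) j = nakToRight f j ≫ nakRightHom g j := nakRight_ext fun {i} p => by
  rw [nakToRight_π, Category.assoc, nakRightHom_π, ← Category.assoc, nakToRight_π, compDesc_comp,
    Category.assoc]

variable (Q B) in
/-- The adjunction `ν ⊣ ν⁻`. -/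
noncomputable def nakayamaAdjunction : nakayama Q B ⊣ nakayamaRight Q B :=
  Adjunction.mkOfHomEquiv
    { homEquiv := fun F G => nakayamaHomEquiv F G
      homEquiv_naturality_left_symm := fun f g =>
        compDesc_ext fun i => nakOfRight_naturality f g i
      homEquiv_naturality_right := fun f g =>
        compLift_ext fun j => nakToRight_naturality f g j }

instance nakayama_additive : (nakayama Q B).Additive where
  map_add {F G f g} := compDesc_ext fun i => nak_ext fun {j} p => by
    refine (nakι_hom (f + g) p).trans ?_
    refine Eq.trans ?_ (Preadditive.comp_add _ _ _ (nakι F p) (nakHom f i) (nakHom g i)).symm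
    rw [nakι_hom, nakι_hom]
    exact Preadditive.add_comp _ _ _ (comp f j) (comp g j) (nakι G p)

instance nakayamaRight_additive : (nakayamaRight Q B).Additive where
  map_add {F G f g} := compLift_ext fun i => nakRight_ext fun {j} p => by
    refine (nakRightHom_π (f + g) p).trans ?_
    refine Eq.trans ?_ (Preadditive.add_comp _ _ _ (nakRightHom f i) (nakRightHom g i)
      (nakRightπ G p)).symm
    rw [nakRightHom_π, nakRightHom_π]
    exact Preadditive.comp_add _ _ _ (nakRightπ F p) (comp f j) (comp g j)

end NakayamaRight

section Main

variable {Q : Type u} [Quiver.{v} Q] [LocallyBoundedQuiver Q]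
  {B : Type u₁} [Category.{v₁} B] [Abelian B]

variable (Q B) in
/-- The endofunctor `P = i_! ∘ i^*` of the category of representations of `Q` over `B`. -/
noncomputable def endoP : (Paths Q ⥤ B) ⥤ (Paths Q ⥤ B) := iStar Q B ⋙ iShriek Q B

/-- A representation is monic if the map `⨁_{t(α) = i} F(s(α)) ⟶ F(i)` with components `f_α` is
a monomorphism for every vertex `i`. -/
def IsMonic (F : Paths Q ⥤ B) : Prop :=
  ∀ i : Q, Mono (biproduct.desc (f := fun α : (Σ j : Q, (j ⟶ i)) => vert F α.1)
    fun α => arr F α.2)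

end Main

end QuiverRep

namespace QuiverRep

/-! The proof rests on a canonical short exact sequence 0 → i_!(W) → P(F) → F → 0, where W(j) is the
sum of the F(s(α)) over the arrows α ending in j (`standardSeq_shortExact`). Its two left terms are
values of i_!, hence P-projective, and it exists over every abelian category. The kernel of ν
applied to its first map therefore serves as L₁ν(F) even when there are no projective resolutions.

Since ν ∘ i_! ≅ i_* (`shriekNakayamaIso`), ν of the first map becomes an explicit map between finite
sums indexed by paths. It is triangular with respect to path length, with the maps ⨁ F(s(α)) ⟶ F(c)
on the diagonal, and path lengths at a vertex are bounded. Hence it is a monomorphism exactly when F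
is monic (`isMonic_iff_mono_nakayama`). Diagram chases then give the closure properties that a
vanishing L₁ν would give (`isMonic_X₃`, `mono_nakayama_map`).

A Gorenstein P-projective object embeds in a P-projective one, and subobjects of monic
representations are monic. Conversely, a monic F is resolved on the left by the standard sequence.
On the right, the unit F ⟶ ν⁻ν(F) is a monomorphism, and embedding ν(F) in i_*i^*ν(F) and using ν⁻ ∘
i_* ≅ i_! gives a monomorphism F ⟶ P(ν(F)) that ν preserves and whose cokernel is again monic.
Splicing produces the complete resolution.

For modules, L₁ν(F) = 0 is the same as F being monic, and the higher Lᵢν vanish because subobjects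
of projectives are monic. By adjunction, Rⁱν⁻ is tested by extensions out of i_*(X) with X
projective at each vertex; the standard sequence of i_*(X) is then a projective resolution of length
one, so Rⁱν⁻ = 0 for i ≥ 2, and R¹ν⁻ = 0 would make i_*(X) monic. If k ≠ 0 and there is an arrow,
some i_*(X) is not monic and m = 1; otherwise all relations vanish and m = 0. -/

lemma isIso_of_comp {Q : Type u} [Quiver.{v} Q] {B : Type u₁} [Category.{v₁} B]
    {F G : Paths Q ⥤ B} (f : F ⟶ G) (h : ∀ i : Q, IsIso (comp f i)) : IsIso f :=
  (NatTrans.isIso_iff_isIso_app f).2 h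

lemma comp_comp {Q : Type u} [Quiver.{v} Q] {B : Type u₁} [Category.{v₁} B]
    {F G H : Paths Q ⥤ B} (f : F ⟶ G) (g : G ⟶ H) (i : Q) :
    comp (f ≫ g) i = comp f i ≫ comp g i := rfl

/-! ### Components of i_!, i_*, ν and ν⁻ -/

section ShriekStar

variable {Q : Type u} [Quiver.{v} Q] [LocallyBoundedQuiver Q]
  {B : Type u₁} [Category.{v₁} B] [Abelian B]

/-- The summand of `i_!(X)(j)` that belongs to a path ending in `j`. -/
noncomputable def shriekIn (X : Q → B) {c j : Q} (p : Quiver.Path c j) :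
    X c ⟶ vert ((iShriek Q B).obj X) j :=
  biproduct.ι (fun p : PathsTo j => X p.1) ⟨c, p⟩

/-- The projection of `i_!(X)(j)` that belongs to a path ending in `j`. -/
noncomputable def shriekOut (X : Q → B) {c j : Q} (p : Quiver.Path c j) :
    vert ((iShriek Q B).obj X) j ⟶ X c :=
  biproduct.π (fun p : PathsTo j => X p.1) ⟨c, p⟩

/-- The morphism out of `i_!(X)(j)` with given components. -/
noncomputable def shriekDescAt (X : Q → B) {j : Q} {Y : B}
    (g : ∀ {c : Q}, Quiver.Path c j → (X c ⟶ Y)) : vert ((iShriek Q B).obj X) j ⟶ Y :=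
  biproduct.desc (f := fun p : PathsTo j => X p.1) fun p => g p.2

/-- The morphism into `i_!(X)(j)` with given components. -/
noncomputable def shriekLiftAt (X : Q → B) {j : Q} {Y : B}
    (g : ∀ {c : Q}, Quiver.Path c j → (Y ⟶ X c)) : Y ⟶ vert ((iShriek Q B).obj X) j :=
  biproduct.lift (f := fun p : PathsTo j => X p.1) fun p => g p.2

lemma shriekIn_out_self (X : Q → B) {c j : Q} (p : Quiver.Path c j) :
    shriekIn X p ≫ shriekOut X p = 𝟙 _ :=
  biproduct.ι_π_self (fun p : PathsTo j => X p.1) ⟨c, p⟩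

lemma shriekIn_out_ne (X : Q → B) {c d j : Q} {p : Quiver.Path c j} {q : Quiver.Path d j}
    (h : (⟨c, p⟩ : PathsTo j) ≠ ⟨d, q⟩) : shriekIn X p ≫ shriekOut X q = 0 :=
  biproduct.ι_π_ne (fun p : PathsTo j => X p.1) h

lemma shriekIn_desc (X : Q → B) {j : Q} {Y : B}
    (g : ∀ {c : Q}, Quiver.Path c j → (X c ⟶ Y)) {c : Q} (p : Quiver.Path c j) :
    shriekIn X p ≫ shriekDescAt X g = g p :=
  biproduct.ι_desc (f := fun p : PathsTo j => X p.1) _ _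

lemma shriekLift_out (X : Q → B) {j : Q} {Y : B}
    (g : ∀ {c : Q}, Quiver.Path c j → (Y ⟶ X c)) {c : Q} (p : Quiver.Path c j) :
    shriekLiftAt X g ≫ shriekOut X p = g p :=
  biproduct.lift_π (f := fun p : PathsTo j => X p.1) _ _

lemma shriek_hom_ext {X : Q → B} {j : Q} {Y : B} {f g : vert ((iShriek Q B).obj X) j ⟶ Y}
    (h : ∀ {c : Q} (p : Quiver.Path c j), shriekIn X p ≫ f = shriekIn X p ≫ g) : f = g :=
  biproduct.hom_ext' (f := fun p : PathsTo j => X p.1) _ _ fun p => h p.2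

lemma shriek_hom_ext' {X : Q → B} {j : Q} {Y : B} {f g : Y ⟶ vert ((iShriek Q B).obj X) j}
    (h : ∀ {c : Q} (p : Quiver.Path c j), f ≫ shriekOut X p = g ≫ shriekOut X p) : f = g :=
  biproduct.hom_ext (f := fun p : PathsTo j => X p.1) _ _ fun p => h p.2

lemma shriekIn_arr (X : Q → B) {c i j : Q} (p : Quiver.Path c i) (α : i ⟶ j) :
    shriekIn X p ≫ arr ((iShriek Q B).obj X) α = shriekIn X (p.cons α) :=
  (congrArg (fun t : shriekObj X i ⟶ shriekObj X j => shriekι X p ≫ t)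
    (arr_mkRep (shriekObj X) (fun α => shriekMap X α) α)).trans (shriekι_cons X p α).symm

lemma shriekIn_map {X Y : Q → B} (f : X ⟶ Y) {c i : Q} (p : Quiver.Path c i) :
    shriekIn X p ≫ comp ((iShriek Q B).map f) i = f c ≫ shriekIn Y p :=
  shriekι_desc X (fun {c} p => f c ≫ shriekι Y p) p

/-- The summand of `i_*(X)(j)` that belongs to a path starting in `j`. -/
noncomputable def starIn (X : Q → B) {j c : Q} (p : Quiver.Path j c) :
    X c ⟶ vert ((iLowerStar Q B).obj X) j :=
  biproduct.ι (fun p : PathsFrom j => X p.1) ⟨c, p⟩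

/-- The projection of `i_*(X)(j)` that belongs to a path starting in `j`. -/
noncomputable def starOut (X : Q → B) {j c : Q} (p : Quiver.Path j c) :
    vert ((iLowerStar Q B).obj X) j ⟶ X c :=
  biproduct.π (fun p : PathsFrom j => X p.1) ⟨c, p⟩

/-- The morphism out of `i_*(X)(j)` with given components. -/
noncomputable def starDescAt (X : Q → B) {j : Q} {Y : B}
    (g : ∀ {c : Q}, Quiver.Path j c → (X c ⟶ Y)) : vert ((iLowerStar Q B).obj X) j ⟶ Y :=
  biproduct.desc (f := fun p : PathsFrom j => X p.1) fun p => g p.2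

lemma starIn_out_self (X : Q → B) {j c : Q} (p : Quiver.Path j c) :
    starIn X p ≫ starOut X p = 𝟙 _ :=
  biproduct.ι_π_self (fun p : PathsFrom j => X p.1) ⟨c, p⟩

lemma starIn_out_ne (X : Q → B) {j c d : Q} {p : Quiver.Path j c} {q : Quiver.Path j d}
    (h : (⟨c, p⟩ : PathsFrom j) ≠ ⟨d, q⟩) : starIn X p ≫ starOut X q = 0 :=
  biproduct.ι_π_ne (fun p : PathsFrom j => X p.1) h

lemma starIn_desc (X : Q → B) {j : Q} {Y : B}
    (g : ∀ {c : Q}, Quiver.Path j c → (X c ⟶ Y)) {c : Q} (p : Quiver.Path j c) :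
    starIn X p ≫ starDescAt X g = g p :=
  biproduct.ι_desc (f := fun p : PathsFrom j => X p.1) _ _

lemma star_hom_ext {X : Q → B} {j : Q} {Y : B} {f g : vert ((iLowerStar Q B).obj X) j ⟶ Y}
    (h : ∀ {c : Q} (p : Quiver.Path j c), starIn X p ≫ f = starIn X p ≫ g) : f = g :=
  biproduct.hom_ext' (f := fun p : PathsFrom j => X p.1) _ _ fun p => h p.2

lemma star_hom_ext' {X : Q → B} {j : Q} {Y : B} {f g : Y ⟶ vert ((iLowerStar Q B).obj X) j}
    (h : ∀ {c : Q} (p : Quiver.Path j c), f ≫ starOut X p = g ≫ starOut X p) : f = g :=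
  biproduct.hom_ext (f := fun p : PathsFrom j => X p.1) _ _ fun p => h p.2

lemma arr_starOut (X : Q → B) {c i j : Q} (α : i ⟶ j) (p : Quiver.Path j c) :
    arr ((iLowerStar Q B).obj X) α ≫ starOut X p = starOut X (α.toPath.comp p) :=
  (congrArg (fun t : starObj X i ⟶ starObj X j => t ≫ starπ X p)
    (arr_mkRep (starObj X) (fun α => starMap X α) α)).trans (starLift_π _ _ _)

lemma map_starOut {X Y : Q → B} (f : X ⟶ Y) {c i : Q} (p : Quiver.Path i c) :
    comp ((iLowerStar Q B).map f) i ≫ starOut Y p = starOut X p ≫ f c :=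
  starLift_π Y (fun {_} p => starπ X p ≫ f _) p

lemma starIn_map {X Y : Q → B} (f : X ⟶ Y) {i c : Q} (r : Quiver.Path i c) :
    starIn X r ≫ comp ((iLowerStar Q B).map f) i = f c ≫ starIn Y r := by
  refine star_hom_ext' fun {d} p => ?_
  rw [Category.assoc, map_starOut, Category.assoc]
  by_cases h : (⟨c, r⟩ : PathsFrom i) = ⟨d, p⟩
  · cases h
    rw [starIn_out_self, Category.comp_id, ← Category.assoc, starIn_out_self, Category.id_comp]
  · rw [starIn_out_ne Y h, ← Category.assoc, starIn_out_ne X h, comp_zero, zero_comp]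

-- This is the transpose of `arr_starOut`. Left composition with β is injective, so at most one
-- summand is nonzero; the sum form matches the action of β on ν.
open Classical in
lemma starIn_arr (X : Q → B) {i j c : Q} (β : i ⟶ j) (r : Quiver.Path i c) :
    starIn X r ≫ arr ((iLowerStar Q B).obj X) β =
      ∑ s : Quiver.Path j c, if β.toPath.comp s = r then starIn X s else 0 := by
  refine star_hom_ext' fun {e} s' => ?_
  rw [Category.assoc, arr_starOut, Preadditive.sum_comp]
  by_cases h : (⟨c, r⟩ : PathsFrom i) = ⟨e, β.toPath.comp s'⟩
  · cases h
    rw [starIn_out_self, Finset.sum_eq_single s', if_pos rfl, starIn_out_self]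
    · intro s _ hs
      rw [if_neg (fun h => hs (Quiver.Path.comp_inj_right.1 h)), zero_comp]
    · exact fun h => absurd (Finset.mem_univ _) h
  · rw [starIn_out_ne X h]
    refine (Finset.sum_eq_zero fun s _ => ?_).symm
    split_ifs with hs
    · refine starIn_out_ne X fun h' => h ?_
      cases h'
      rw [hs]
    · exact zero_comp

/-- The structure maps of `ν(F)`. -/
noncomputable def nakIn (F : Paths Q ⥤ B) {i j : Q} (p : Quiver.Path i j) :
    vert F j ⟶ vert ((nakayama Q B).obj F) i := nakι F p

lemma nak_hom_ext {F : Paths Q ⥤ B} {i : Q} {Y : B} {f g : vert ((nakayama Q B).obj F) i ⟶ Y}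
    (h : ∀ {j : Q} (p : Quiver.Path i j), nakIn F p ≫ f = nakIn F p ≫ g) : f = g := nak_ext h

open Classical in
lemma arr_nakIn (F : Paths Q ⥤ B) {i j l : Q} (p : Quiver.Path i l) (α : j ⟶ l) :
    arr F α ≫ nakIn F p = ∑ q : Quiver.Path i j, if q.cons α = p then nakIn F q else 0 :=
  arr_nakι F p α

open Classical in
lemma nakIn_arr (F : Paths Q ⥤ B) {i i' j : Q} (β : i ⟶ i') (p : Quiver.Path i j) :
    nakIn F p ≫ arr ((nakayama Q B).obj F) β =
      ∑ q : Quiver.Path i' j, if β.toPath.comp q = p then nakIn F q else 0 :=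
  (congrArg (fun t : nakObj F i ⟶ nakObj F i' => nakι F p ≫ t)
    (arr_mkRep (nakObj F) (fun β => nakMap F β) β)).trans (nakι_map F β p)

lemma nakIn_map {F G : Paths Q ⥤ B} (f : F ⟶ G) {i j : Q} (p : Quiver.Path i j) :
    nakIn F p ≫ comp ((nakayama Q B).map f) i = comp f j ≫ nakIn G p := nakι_hom f p

/-- The structure maps of `ν⁻(G)`. -/
noncomputable def nakRightOut (G : Paths Q ⥤ B) {j i : Q} (p : Quiver.Path j i) :
    vert ((nakayamaRight Q B).obj G) i ⟶ vert G j := nakRightπ G p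

lemma nakRight_hom_ext {G : Paths Q ⥤ B} {i : Q} {Y : B}
    {f g : Y ⟶ vert ((nakayamaRight Q B).obj G) i}
    (h : ∀ {j : Q} (p : Quiver.Path j i), f ≫ nakRightOut G p = g ≫ nakRightOut G p) : f = g :=
  nakRight_ext h

open Classical in
lemma nakRightOut_arr (G : Paths Q ⥤ B) {j l i : Q} (p : Quiver.Path j i) (β : j ⟶ l) :
    nakRightOut G p ≫ arr G β =
      ∑ q : Quiver.Path l i, if β.toPath.comp q = p then nakRightOut G q else 0 :=
  nakRightπ_arr G p β

lemma homEquiv_nakRightOut {F G : Paths Q ⥤ B} (t : (nakayama Q B).obj F ⟶ G) {i j : Q}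
    (p : Quiver.Path i j) :
    comp ((nakayamaAdjunction Q B).homEquiv F G t) j ≫ nakRightOut G p = nakIn F p ≫ comp t i := by
  rw [nakayamaAdjunction, Adjunction.mkOfHomEquiv_homEquiv]
  exact nakToRight_π t p

end ShriekStar

/-! ### The isomorphisms ν ∘ i_! ≅ i_* and i_! ≅ ν⁻ ∘ i_* -/

section NakayamaShriek

variable {Q : Type u} [Quiver.{v} Q] [LocallyBoundedQuiver Q]
  {B : Type u₁} [Category.{v₁} B] [Abelian B]

open Classical in
/-- The map `i_!(X)(j) ⟶ i_*(X)(i)` that belongs to a path `p` from `i` to `j`: it sends the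
summand at `q` to the sum of the summands at all `r` with `rq = p`. -/
noncomputable def shriekToStar (X : Q → B) {i j : Q} (p : Quiver.Path i j) :
    vert ((iShriek Q B).obj X) j ⟶ vert ((iLowerStar Q B).obj X) i :=
  shriekDescAt X fun {d} q => ∑ r : Quiver.Path i d, if r.comp q = p then starIn X r else 0

open Classical in
lemma shriekIn_toStar (X : Q → B) {i j d : Q} (p : Quiver.Path i j) (q : Quiver.Path d j) :
    shriekIn X q ≫ shriekToStar X p =
      ∑ r : Quiver.Path i d, if r.comp q = p then starIn X r else 0 :=
  shriekIn_desc X _ q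

lemma shriekIn_nil_toStar (X : Q → B) {i j : Q} (p : Quiver.Path i j) :
    shriekIn X Quiver.Path.nil ≫ shriekToStar X p = starIn X p := by
  classical
  rw [shriekIn_toStar, Finset.sum_eq_single p, if_pos (Quiver.Path.comp_nil p)]
  · exact fun r _ hr => if_neg hr
  · exact fun h => absurd (Finset.mem_univ _) h

-- On the summand at s, both sides are the sum over all r with r followed by s and then α equal to
-- p; the right side groups these r by the intermediate path q = rs.
open Classical in
lemma shriekToStar_rel (X : Q → B) {i j l : Q} (p : Quiver.Path i l) (α : j ⟶ l) :
    arr ((iShriek Q B).obj X) α ≫ shriekToStar X p =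
      ∑ q : Quiver.Path i j, if q.cons α = p then shriekToStar X q else 0 := by
  refine shriek_hom_ext fun {c} s => ?_
  rw [← Category.assoc, shriekIn_arr, shriekIn_toStar, Preadditive.comp_sum]
  refine (sum_fiber (fun q : Quiver.Path i j => q.cons α)
    (fun r : Quiver.Path i c => r.comp s) (fun r => starIn X r) p).symm.trans ?_
  refine Finset.sum_congr rfl fun q _ => ?_
  split_ifs
  · exact (shriekIn_toStar X q s).symm
  · exact comp_zero.symm

/-- The map `ν(i_!(X)) ⟶ i_*(X)` at a vertex. -/
noncomputable def nakShriekToStar (X : Q → B) (i : Q) :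
    vert ((nakayama Q B).obj ((iShriek Q B).obj X)) i ⟶ vert ((iLowerStar Q B).obj X) i :=
  nakDesc ((iShriek Q B).obj X) (fun {_} p => shriekToStar X p) (shriekToStar_rel X)

lemma nakIn_toStar (X : Q → B) {i j : Q} (p : Quiver.Path i j) :
    nakIn ((iShriek Q B).obj X) p ≫ nakShriekToStar X i = shriekToStar X p :=
  nakι_desc ((iShriek Q B).obj X) _ (shriekToStar_rel X) p

/-- The summand of `ν(i_!(X))` at a path. -/
noncomputable def nakShriekIn (X : Q → B) {i c : Q} (r : Quiver.Path i c) :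
    X c ⟶ vert ((nakayama Q B).obj ((iShriek Q B).obj X)) i :=
  shriekIn X Quiver.Path.nil ≫ nakIn ((iShriek Q B).obj X) r

lemma nakShriekIn_toStar (X : Q → B) {i c : Q} (r : Quiver.Path i c) :
    nakShriekIn X r ≫ nakShriekToStar X i = starIn X r := by
  rw [nakShriekIn, Category.assoc, nakIn_toStar, shriekIn_nil_toStar]

-- The summand at q is the trivial one acted on by q, so the tensor relations move q across to p^*.
-- Thus ν(i_!(X))(i) is generated by the trivial summands placed at the paths r, and
-- `nakShriekToStar` sends these to the summands of i_*(X)(i).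
open Classical in
lemma shriekIn_nakIn (X : Q → B) {i j d : Q} (q : Quiver.Path d j) (p : Quiver.Path i j) :
    shriekIn X q ≫ nakIn ((iShriek Q B).obj X) p =
      ∑ r : Quiver.Path i d, if r.comp q = p then nakShriekIn X r else 0 := by
  induction q with
  | nil =>
    rw [Finset.sum_eq_single p, if_pos (Quiver.Path.comp_nil p), nakShriekIn]
    · exact fun r _ hr => if_neg hr
    · exact fun h => absurd (Finset.mem_univ _) h
  | cons q α ih =>
    rw [← shriekIn_arr, Category.assoc, arr_nakIn, Preadditive.comp_sum]
    refine Eq.trans ?_ (sum_fiber (fun q : Quiver.Path i _ => q.cons α)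
      (fun r : Quiver.Path i d => r.comp q) (fun r => nakShriekIn X r) p)
    refine Finset.sum_congr rfl fun q' _ => ?_
    split_ifs
    · exact ih q'
    · exact comp_zero

lemma nakShriek_hom_ext {X : Q → B} {i : Q} {Y : B}
    {f g : vert ((nakayama Q B).obj ((iShriek Q B).obj X)) i ⟶ Y}
    (h : ∀ {c : Q} (r : Quiver.Path i c), nakShriekIn X r ≫ f = nakShriekIn X r ≫ g) :
    f = g := by
  classical
  refine nak_hom_ext fun {j} p => shriek_hom_ext fun {d} q => ?_
  rw [← Category.assoc, ← Category.assoc, shriekIn_nakIn, Preadditive.sum_comp,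
    Preadditive.sum_comp]
  refine Finset.sum_congr rfl fun r _ => ?_
  split_ifs
  · exact h r
  · rw [zero_comp, zero_comp]

/-- The isomorphism `ν(i_!(X))(i) ≅ i_*(X)(i)`. -/
noncomputable def nakShriekIsoAt (X : Q → B) (i : Q) :
    vert ((nakayama Q B).obj ((iShriek Q B).obj X)) i ≅ vert ((iLowerStar Q B).obj X) i where
  hom := nakShriekToStar X i
  inv := starDescAt X fun {_} r => nakShriekIn X r
  hom_inv_id := nakShriek_hom_ext fun {c} r => by
    rw [← Category.assoc, nakShriekIn_toStar, starIn_desc, Category.comp_id]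
  inv_hom_id := star_hom_ext fun {c} r => by
    rw [← Category.assoc, starIn_desc, nakShriekIn_toStar, Category.comp_id]

open Classical in
lemma nakShriekIn_arr (X : Q → B) {i i' c : Q} (β : i ⟶ i') (r : Quiver.Path i c) :
    nakShriekIn X r ≫ arr ((nakayama Q B).obj ((iShriek Q B).obj X)) β =
      ∑ s : Quiver.Path i' c, if β.toPath.comp s = r then nakShriekIn X s else 0 := by
  rw [nakShriekIn, Category.assoc, nakIn_arr, Preadditive.comp_sum]
  refine Finset.sum_congr rfl fun s _ => ?_
  split_ifs
  · rfl
  · exact comp_zero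

lemma nakShriekToStar_naturality (X : Q → B) {i i' : Q} (β : i ⟶ i') :
    arr ((nakayama Q B).obj ((iShriek Q B).obj X)) β ≫ nakShriekToStar X i' =
      nakShriekToStar X i ≫ arr ((iLowerStar Q B).obj X) β := by
  classical
  refine nakShriek_hom_ext fun {c} r => ?_
  rw [← Category.assoc, ← Category.assoc, nakShriekIn_toStar, starIn_arr, nakShriekIn_arr,
    Preadditive.sum_comp]
  refine Finset.sum_congr rfl fun s _ => ?_
  split_ifs
  · exact nakShriekIn_toStar X s
  · exact zero_comp

/-- The morphism of representations `ν(i_!(X)) ⟶ i_*(X)`. -/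
noncomputable def nakShriekHom (X : Q → B) :
    (nakayama Q B).obj ((iShriek Q B).obj X) ⟶ (iLowerStar Q B).obj X :=
  mkHom (nakShriekToStar X) (nakShriekToStar_naturality X)

lemma nakShriekIn_hom (X : Q → B) {i c : Q} (r : Quiver.Path i c) :
    nakShriekIn X r ≫ comp (nakShriekHom X) i = starIn X r := nakShriekIn_toStar X r

lemma nakIn_shriekHom (X : Q → B) {i j : Q} (p : Quiver.Path i j) :
    nakIn ((iShriek Q B).obj X) p ≫ comp (nakShriekHom X) i = shriekToStar X p :=
  nakIn_toStar X p

instance isIso_nakShriekHom (X : Q → B) : IsIso (nakShriekHom X) :=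
  isIso_of_comp _ fun i => inferInstanceAs (IsIso (nakShriekIsoAt X i).hom)

lemma nakShriekIn_map {X Y : Q → B} (f : X ⟶ Y) {i c : Q} (r : Quiver.Path i c) :
    nakShriekIn X r ≫ comp ((nakayama Q B).map ((iShriek Q B).map f)) i =
      f c ≫ nakShriekIn Y r := by
  rw [nakShriekIn, Category.assoc, nakIn_map, ← Category.assoc, shriekIn_map, Category.assoc,
    nakShriekIn]

variable (Q B) in
/-- The Nakayama functor takes `i_!` to `i_*`. -/
noncomputable def shriekNakayamaIso : iShriek Q B ⋙ nakayama Q B ≅ iLowerStar Q B :=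
  NatIso.ofComponents (fun X => asIso (nakShriekHom X)) fun {X Y} f =>
    hom_ext fun i => nakShriek_hom_ext fun {c} r => by
      refine (Category.assoc _ _ _).symm.trans (Eq.trans ?_ (Category.assoc _ _ _))
      refine (congrArg (fun t => t ≫ comp (nakShriekHom Y) i) (nakShriekIn_map f r)).trans ?_
      refine Eq.trans ?_ (congrArg (fun t => t ≫ comp ((iLowerStar Q B).map f) i)
        (nakShriekIn_hom X r)).symm
      rw [starIn_map, Category.assoc, nakShriekIn_hom]

/-- The component at `q` of an element `h` of `ν⁻(i_*(X))(j)`, i.e. `h_q` at the empty path. -/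
noncomputable def nakRightStarToShriek (X : Q → B) (j : Q) :
    vert ((nakayamaRight Q B).obj ((iLowerStar Q B).obj X)) j ⟶ vert ((iShriek Q B).obj X) j :=
  shriekLiftAt X fun {_} q => nakRightOut _ q ≫ starOut X Quiver.Path.nil

-- Linearity of an element of ν⁻(i_*(X)) transfers r from the path coordinate of i_* to the index p,
-- so every component is determined by those at trivial paths.
open Classical in
lemma nakRightOut_starOut (X : Q → B) {c d j : Q} (p : Quiver.Path c j) (r : Quiver.Path c d) :
    nakRightOut ((iLowerStar Q B).obj X) p ≫ starOut X r =
      ∑ q : Quiver.Path d j, if r.comp q = p then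
        nakRightOut ((iLowerStar Q B).obj X) q ≫ starOut X Quiver.Path.nil else 0 := by
  -- Induction on r strips its last arrow, which must then be prepended to a path s; hence s has to
  -- be arbitrary.
  suffices h : ∀ {e : Q} (s : Quiver.Path d e),
      nakRightOut ((iLowerStar Q B).obj X) p ≫ starOut X (r.comp s) =
      ∑ q : Quiver.Path d j, if r.comp q = p then
        nakRightOut ((iLowerStar Q B).obj X) q ≫ starOut X s else 0 from h Quiver.Path.nil
  induction r with
  | nil =>
    intro e s
    rw [Finset.sum_eq_single p, if_pos (Quiver.Path.nil_comp p), Quiver.Path.nil_comp]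
    · exact fun q _ hq => if_neg fun h => hq ((Quiver.Path.nil_comp q).symm.trans h)
    · exact fun h => absurd (Finset.mem_univ _) h
  | cons r β ih =>
    intro e s
    have e₁ : ∀ {a : Q} (t : Quiver.Path _ a), (r.cons β).comp t = r.comp (β.toPath.comp t) := by
      intro a t
      rw [← Quiver.Path.comp_assoc]; rfl
    rw [e₁, ih]
    simp only [e₁]
    refine Eq.trans ?_ (sum_fiber (fun q : Quiver.Path _ j => r.comp q)
      (fun q : Quiver.Path _ j => β.toPath.comp q)
      (fun q => nakRightOut ((iLowerStar Q B).obj X) q ≫ starOut X s) p)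
    refine Finset.sum_congr rfl fun q _ => ?_
    split_ifs
    · rw [← arr_starOut, ← Category.assoc, nakRightOut_arr, Preadditive.sum_comp]
      refine Finset.sum_congr rfl fun q' _ => ?_
      split_ifs
      · rfl
      · exact zero_comp
    · rfl

lemma mono_nakRightStarToShriek (X : Q → B) (j : Q) : Mono (nakRightStarToShriek X j) := by
  classical
  refine ⟨fun {Z} f g h => nakRight_hom_ext fun {c} p => star_hom_ext' fun {d} r => ?_⟩
  have h' : ∀ {d : Q} (q : Quiver.Path d j),
      f ≫ nakRightOut ((iLowerStar Q B).obj X) q ≫ starOut X Quiver.Path.nil =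
        g ≫ nakRightOut ((iLowerStar Q B).obj X) q ≫ starOut X Quiver.Path.nil := fun {d} q => by
    have := h =≫ shriekOut X q
    rwa [Category.assoc, Category.assoc, nakRightStarToShriek, shriekLift_out] at this
  rw [Category.assoc, Category.assoc, nakRightOut_starOut, Preadditive.comp_sum,
    Preadditive.comp_sum]
  refine Finset.sum_congr rfl fun q _ => ?_
  split_ifs
  · exact h' q
  · rw [comp_zero, comp_zero]

/-- The morphism `i_!(X) ⟶ ν⁻(i_*(X))`. -/
noncomputable def shriekToNakRightStar (X : Q → B) :
    (iShriek Q B).obj X ⟶ (nakayamaRight Q B).obj ((iLowerStar Q B).obj X) :=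
  (nakayamaAdjunction Q B).homEquiv _ _ (nakShriekHom X)

/-- On summands, the entry from q to q' is a sum over r with rq = q of the component of r at the
trivial path, so only r trivial and q = q' contribute. -/
lemma shriekToNakRightStar_comp (X : Q → B) (j : Q) :
    comp (shriekToNakRightStar X) j ≫ nakRightStarToShriek X j = 𝟙 _ := by
  classical
  refine shriek_hom_ext fun {d} q => shriek_hom_ext' fun {d'} q' => ?_
  rw [Category.assoc, Category.assoc, nakRightStarToShriek, shriekLift_out, Category.comp_id,
    ← Category.assoc (comp _ _), shriekToNakRightStar, homEquiv_nakRightOut, nakIn_shriekHom,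
    ← Category.assoc, shriekIn_toStar, Preadditive.sum_comp]
  by_cases h : (⟨d, q⟩ : PathsTo j) = ⟨d', q'⟩
  · cases h
    rw [shriekIn_out_self, Finset.sum_eq_single Quiver.Path.nil,
      if_pos (Quiver.Path.nil_comp q), starIn_out_self]
    · exact fun r _ hr => by
        rw [if_neg fun h => hr (Quiver.Path.comp_inj_left.1 (h.trans (Quiver.Path.nil_comp q).symm)),
          zero_comp]
    · exact fun h => absurd (Finset.mem_univ _) h
  · rw [shriekIn_out_ne X h]
    refine Finset.sum_eq_zero fun r _ => ?_
    split_ifs with hr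
    · refine starIn_out_ne X fun h' => h ?_
      cases h'
      rw [← hr, Quiver.Path.nil_comp]
    · exact zero_comp

/-- Reading off trivial-path components is a monomorphism and has this map as a section, so both are
isomorphisms. -/
instance isIso_shriekToNakRightStar (X : Q → B) : IsIso (shriekToNakRightStar X) :=
  isIso_of_comp _ fun j => by
    have := mono_nakRightStarToShriek X j
    have : IsSplitEpi (nakRightStarToShriek X j) := ⟨⟨_, shriekToNakRightStar_comp X j⟩⟩
    have : IsIso (nakRightStarToShriek X j) := isIso_of_mono_of_isSplitEpi _
    have : IsIso (comp (shriekToNakRightStar X) j ≫ nakRightStarToShriek X j) := by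
      rw [shriekToNakRightStar_comp]
      infer_instance
    exact IsIso.of_isIso_comp_right _ (nakRightStarToShriek X j)

/-- The unit followed by ν⁻ of the isomorphism ν(i_!(X)) ≅ i_*(X) is the adjunct of that
isomorphism, which is invertible. -/
instance isIso_nakayama_unit_shriek (X : Q → B) :
    IsIso ((nakayamaAdjunction Q B).unit.app ((iShriek Q B).obj X)) := by
  have h : (nakayamaAdjunction Q B).unit.app ((iShriek Q B).obj X) ≫
      (nakayamaRight Q B).map (nakShriekHom X) = shriekToNakRightStar X :=
    ((nakayamaAdjunction Q B).homEquiv_unit _ _ _).symm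
  have : IsIso ((nakayamaAdjunction Q B).unit.app ((iShriek Q B).obj X) ≫
      (nakayamaRight Q B).map (nakShriekHom X)) := by
    rw [h]
    infer_instance
  exact IsIso.of_isIso_comp_right _ ((nakayamaRight Q B).map (nakShriekHom X))

end NakayamaShriek

end QuiverRep

namespace QuiverRep

/-! ### Cancellation and bounded lengths of paths -/

section Paths

variable {Q : Type u} [Quiver.{v} Q]

/-- Paths grow at their end, so the first arrow is reached by induction from the end; comparing
lengths excludes the case of one trivial and one nontrivial remainder. -/
lemma toPath_comp_inj {d j : Q} {b c : Q} {β : d ⟶ b} {α : d ⟶ c} {r : Quiver.Path b j}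
    {p : Quiver.Path c j} (h : β.toPath.comp r = α.toPath.comp p) :
    (⟨b, β, r⟩ : Σ b : Q, Σ _ : (d ⟶ b), Quiver.Path b j) = ⟨c, α, p⟩ := by
  induction r with
  | nil =>
    cases p with
    | nil => cases h; rfl
    | cons p γ =>
      have := congrArg Quiver.Path.length h
      simp at this
  | cons r γ ih =>
    cases p with
    | nil =>
      have := congrArg Quiver.Path.length h
      simp at this
    | cons p δ =>
      rw [Quiver.Path.comp_cons, Quiver.Path.comp_cons] at h
      obtain ⟨h₁, h₂, h₃⟩ := Quiver.Path.cons.inj h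
      subst h₁
      obtain rfl := eq_of_heq h₃
      cases ih (eq_of_heq h₂)
      rfl

variable [LocallyBoundedQuiver Q]

lemma exists_length_pathsTo_lt (j : Q) :
    ∃ N : ℕ, ∀ {c : Q} (p : Quiver.Path c j), p.length < N := by
  obtain ⟨N, hN⟩ := (Set.finite_range fun p : PathsTo j => p.2.length).bddAbove
  exact ⟨N + 1, fun {c} p => Nat.lt_succ_of_le (hN ⟨⟨c, p⟩, rfl⟩)⟩

lemma exists_length_pathsFrom_lt (j : Q) :
    ∃ N : ℕ, ∀ {c : Q} (p : Quiver.Path j c), p.length < N := by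
  obtain ⟨N, hN⟩ := (Set.finite_range fun p : PathsFrom j => p.2.length).bddAbove
  exact ⟨N + 1, fun {c} p => Nat.lt_succ_of_le (hN ⟨⟨c, p⟩, rfl⟩)⟩

noncomputable instance fintype_arrowsFrom (i : Q) : Fintype (Σ j : Q, (i ⟶ j)) :=
  Fintype.ofFinite _

/-- A quiver that is locally bounded has no oriented cycles. -/
lemma path_self_eq_nil {i : Q} (p : Quiver.Path i i) : p = Quiver.Path.nil := by
  refine Quiver.Path.eq_nil_of_length_zero p (by_contra fun h => ?_)
  obtain ⟨N, hN⟩ := exists_length_pathsTo_lt i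
  -- Powers of a nontrivial loop have unbounded length.
  have key : ∀ n : ℕ, ∃ q : Quiver.Path i i, n ≤ q.length := by
    intro n
    induction n with
    | zero => exact ⟨Quiver.Path.nil, Nat.zero_le _⟩
    | succ n ih =>
      obtain ⟨q, hq⟩ := ih
      refine ⟨q.comp p, ?_⟩
      rw [Quiver.Path.length_comp]
      omega
  obtain ⟨q, hq⟩ := key N
  exact absurd (hN q) (not_lt.2 hq)

end Paths

/-! ### The standard short exact sequence of a representation -/

section Relations

variable {Q : Type u} [Quiver.{v} Q] [LocallyBoundedQuiver Q]
  {B : Type u₁} [Category.{v₁} B] [Abelian B]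

variable (Q B) in
/-- The functor sending a family `X` to the sums of the `X(s(α))` over the arrows `α` ending in a
given vertex. -/
noncomputable def sumTo : (Q → B) ⥤ (Q → B) where
  obj X j := ⨁ fun α : (Σ i : Q, (i ⟶ j)) => X α.1
  map f j := biproduct.map fun α => f α.1
  map_id X := funext fun j => biproduct.hom_ext' _ _ fun α => by
    rw [biproduct.ι_map]
    exact (Category.id_comp _).trans (Category.comp_id _).symm
  map_comp f g := funext fun j => biproduct.hom_ext' _ _ fun α => by
    refine (biproduct.ι_map _ _).trans ?_
    refine Eq.trans ?_ (Category.assoc _ _ _)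
    rw [biproduct.ι_map, Category.assoc, biproduct.ι_map]
    exact Category.assoc _ _ _

/-- The inclusion of a summand of `sumTo`. -/
noncomputable def sumToIn (X : Q → B) {i j : Q} (α : i ⟶ j) : X i ⟶ (sumTo Q B).obj X j :=
  biproduct.ι (fun α : (Σ i : Q, (i ⟶ j)) => X α.1) ⟨i, α⟩

/-- The morphism out of `sumTo` with given components. -/
noncomputable def sumToDesc (X : Q → B) {j : Q} {Y : B} (g : ∀ {i : Q}, (i ⟶ j) → (X i ⟶ Y)) :
    (sumTo Q B).obj X j ⟶ Y :=
  biproduct.desc (f := fun α : (Σ i : Q, (i ⟶ j)) => X α.1) fun α => g α.2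

lemma sumToIn_desc (X : Q → B) {j : Q} {Y : B} (g : ∀ {i : Q}, (i ⟶ j) → (X i ⟶ Y)) {i : Q}
    (α : i ⟶ j) : sumToIn X α ≫ sumToDesc X g = g α :=
  biproduct.ι_desc (f := fun α : (Σ i : Q, (i ⟶ j)) => X α.1) _ _

lemma sumToIn_map {X Y : Q → B} (f : X ⟶ Y) {i j : Q} (α : i ⟶ j) :
    sumToIn X α ≫ (sumTo Q B).map f j = f i ≫ sumToIn Y α :=
  biproduct.ι_map (f := fun α : (Σ i : Q, (i ⟶ j)) => X α.1)
    (g := fun α : (Σ i : Q, (i ⟶ j)) => Y α.1) (fun α => f α.1) ⟨i, α⟩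

lemma sumTo_hom_ext {X : Q → B} {j : Q} {Y : B} {f g : (sumTo Q B).obj X j ⟶ Y}
    (h : ∀ {i : Q} (α : i ⟶ j), sumToIn X α ≫ f = sumToIn X α ≫ g) : f = g :=
  biproduct.hom_ext' (f := fun α : (Σ i : Q, (i ⟶ j)) => X α.1) _ _ fun α => h α.2

variable (Q B) in
/-- The functor sending a family `X` to the sums of the `X(t(α))` over the arrows `α` starting in
a given vertex. -/
noncomputable def prodFrom : (Q → B) ⥤ (Q → B) where
  obj X i := ⨁ fun α : (Σ j : Q, (i ⟶ j)) => X α.1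
  map f i := biproduct.map fun α => f α.1
  map_id X := funext fun j => biproduct.hom_ext' _ _ fun α => by
    rw [biproduct.ι_map]
    exact (Category.id_comp _).trans (Category.comp_id _).symm
  map_comp f g := funext fun j => biproduct.hom_ext' _ _ fun α => by
    refine (biproduct.ι_map _ _).trans ?_
    refine Eq.trans ?_ (Category.assoc _ _ _)
    rw [biproduct.ι_map, Category.assoc, biproduct.ι_map]
    exact Category.assoc _ _ _

/-- The projection to a summand of `prodFrom`. -/
noncomputable def prodFromOut (X : Q → B) {i j : Q} (α : i ⟶ j) : (prodFrom Q B).obj X i ⟶ X j :=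
  biproduct.π (fun α : (Σ j : Q, (i ⟶ j)) => X α.1) ⟨j, α⟩

/-- The morphism into `prodFrom` with given components. -/
noncomputable def prodFromLift (X : Q → B) {i : Q} {Y : B}
    (g : ∀ {j : Q}, (i ⟶ j) → (Y ⟶ X j)) : Y ⟶ (prodFrom Q B).obj X i :=
  biproduct.lift (f := fun α : (Σ j : Q, (i ⟶ j)) => X α.1) fun α => g α.2

lemma prodFromLift_out (X : Q → B) {i : Q} {Y : B} (g : ∀ {j : Q}, (i ⟶ j) → (Y ⟶ X j)) {j : Q}
    (α : i ⟶ j) : prodFromLift X g ≫ prodFromOut X α = g α :=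
  biproduct.lift_π (f := fun α : (Σ j : Q, (i ⟶ j)) => X α.1) _ _

lemma map_prodFromOut {X Y : Q → B} (f : X ⟶ Y) {i j : Q} (α : i ⟶ j) :
    (prodFrom Q B).map f i ≫ prodFromOut Y α = prodFromOut X α ≫ f j :=
  biproduct.map_π (f := fun α : (Σ j : Q, (i ⟶ j)) => X α.1)
    (g := fun α : (Σ j : Q, (i ⟶ j)) => Y α.1) (fun α => f α.1) ⟨j, α⟩

lemma prodFrom_hom_ext {X : Q → B} {i : Q} {Y : B} {f g : Y ⟶ (prodFrom Q B).obj X i}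
    (h : ∀ {j : Q} (α : i ⟶ j), f ≫ prodFromOut X α = g ≫ prodFromOut X α) : f = g :=
  biproduct.hom_ext (f := fun α : (Σ j : Q, (i ⟶ j)) => X α.1) _ _ fun α => h α.2

variable (Q B) in
/-- `sumTo` is left adjoint to `prodFrom`. -/
noncomputable def sumToAdjunction : sumTo Q B ⊣ prodFrom Q B :=
  Adjunction.mkOfHomEquiv
    { homEquiv := fun X Y =>
        { toFun := fun t i => prodFromLift Y fun {j} α => sumToIn X α ≫ t j
          invFun := fun t j => sumToDesc X fun {i} α => t i ≫ prodFromOut Y α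
          left_inv := fun t => funext fun j => sumTo_hom_ext fun α => by
            rw [sumToIn_desc, prodFromLift_out]
          right_inv := fun t => funext fun i => prodFrom_hom_ext fun α => by
            rw [prodFromLift_out, sumToIn_desc] }
      homEquiv_naturality_left_symm := fun {X X' Y} f g => funext fun j =>
        sumTo_hom_ext fun {i} α => by
          refine (sumToIn_desc X (fun {i} α => (f i ≫ g i) ≫ prodFromOut Y α) α).trans ?_
          refine Eq.trans ?_ (Category.assoc (sumToIn X α) ((sumTo Q B).map f j)
            (sumToDesc X' fun {i} α => g i ≫ prodFromOut Y α))
          rw [sumToIn_map, Category.assoc, Category.assoc, sumToIn_desc]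
      homEquiv_naturality_right := fun {X Y Y'} f g => funext fun i =>
        prodFrom_hom_ext fun {j} α => by
          refine (prodFromLift_out Y' (fun {j} α => sumToIn X α ≫ f j ≫ g j) α).trans ?_
          refine Eq.trans ?_ (Category.assoc (prodFromLift Y fun α => sumToIn X α ≫ f _)
            ((prodFrom Q B).map g i) (prodFromOut Y' α)).symm
          rw [map_prodFromOut, ← Category.assoc, ← Category.assoc, prodFromLift_out] }

variable (Q B) in
/-- The functor of relations, `F ↦ i_!(W)` with `W(j)` the sum of the `F(s(α))` over the arrows
`α` ending in `j`. -/
noncomputable def relations : (Paths Q ⥤ B) ⥤ (Paths Q ⥤ B) :=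
  (iStar Q B ⋙ sumTo Q B) ⋙ iShriek Q B

variable (Q B) in
/-- The functor of relations has a right adjoint. -/
noncomputable def relationsAdjunction :
    relations Q B ⊣ iStar Q B ⋙ prodFrom Q B ⋙ iLowerStar Q B :=
  ((starAdjunction Q B).comp (sumToAdjunction Q B)).comp (shriekAdjunction Q B)

variable (Q B) in
/-- The functor `i_! ∘ i^*` has a right adjoint. -/
noncomputable def endoPAdjunction : endoP Q B ⊣ iStar Q B ⋙ iLowerStar Q B :=
  (starAdjunction Q B).comp (shriekAdjunction Q B)

/-- The sum of the `F(s(α))` over the arrows `α` ending in a given vertex. -/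
noncomputable abbrev srcObj (F : Paths Q ⥤ B) (j : Q) : B :=
  ⨁ fun α : (Σ i : Q, (i ⟶ j)) => vert F α.1

/-- The inclusion of a summand of `srcObj`. -/
noncomputable def srcIn (F : Paths Q ⥤ B) {i j : Q} (α : i ⟶ j) : vert F i ⟶ srcObj F j :=
  biproduct.ι (fun α : (Σ i : Q, (i ⟶ j)) => vert F α.1) ⟨i, α⟩

/-- The projection to a summand of `srcObj`. -/
noncomputable def srcOut (F : Paths Q ⥤ B) {i j : Q} (α : i ⟶ j) : srcObj F j ⟶ vert F i :=
  biproduct.π (fun α : (Σ i : Q, (i ⟶ j)) => vert F α.1) ⟨i, α⟩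

/-- The map `⨁ F(s(α)) ⟶ F(i)` with components `f_α`. -/
noncomputable def srcDesc (F : Paths Q ⥤ B) (j : Q) : srcObj F j ⟶ vert F j :=
  biproduct.desc (f := fun α : (Σ i : Q, (i ⟶ j)) => vert F α.1) fun α => arr F α.2

lemma srcIn_desc (F : Paths Q ⥤ B) {i j : Q} (α : i ⟶ j) : srcIn F α ≫ srcDesc F j = arr F α :=
  biproduct.ι_desc (f := fun α : (Σ i : Q, (i ⟶ j)) => vert F α.1) _ _

lemma srcIn_out_self (F : Paths Q ⥤ B) {i j : Q} (α : i ⟶ j) : srcIn F α ≫ srcOut F α = 𝟙 _ :=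
  biproduct.ι_π_self (fun α : (Σ i : Q, (i ⟶ j)) => vert F α.1) ⟨i, α⟩

lemma srcIn_out_ne (F : Paths Q ⥤ B) {i i' j : Q} {α : i ⟶ j} {β : i' ⟶ j}
    (h : (⟨i, α⟩ : Σ i : Q, (i ⟶ j)) ≠ ⟨i', β⟩) : srcIn F α ≫ srcOut F β = 0 :=
  biproduct.ι_π_ne (fun α : (Σ i : Q, (i ⟶ j)) => vert F α.1) h

lemma src_hom_ext {F : Paths Q ⥤ B} {j : Q} {Y : B} {f g : srcObj F j ⟶ Y}
    (h : ∀ {i : Q} (α : i ⟶ j), srcIn F α ≫ f = srcIn F α ≫ g) : f = g :=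
  biproduct.hom_ext' (f := fun α : (Σ i : Q, (i ⟶ j)) => vert F α.1) _ _ fun α => h α.2

lemma src_hom_ext' {F : Paths Q ⥤ B} {j : Q} {Y : B} {f g : Y ⟶ srcObj F j}
    (h : ∀ {i : Q} (α : i ⟶ j), f ≫ srcOut F α = g ≫ srcOut F α) : f = g :=
  biproduct.hom_ext (f := fun α : (Σ i : Q, (i ⟶ j)) => vert F α.1) _ _ fun α => h α.2

lemma isMonic_iff (F : Paths Q ⥤ B) : IsMonic F ↔ ∀ i, Mono (srcDesc F i) := Iff.rfl

/-- The inclusion of a summand of `P(F)`. -/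
noncomputable def genIn (F : Paths Q ⥤ B) {c j : Q} (p : Quiver.Path c j) :
    vert F c ⟶ vert ((endoP Q B).obj F) j :=
  shriekIn ((iStar Q B).obj F) p

/-- The projection to a summand of `P(F)`. -/
noncomputable def genOut (F : Paths Q ⥤ B) {c j : Q} (p : Quiver.Path c j) :
    vert ((endoP Q B).obj F) j ⟶ vert F c :=
  shriekOut ((iStar Q B).obj F) p

lemma genIn_out_self (F : Paths Q ⥤ B) {c j : Q} (p : Quiver.Path c j) :
    genIn F p ≫ genOut F p = 𝟙 _ := shriekIn_out_self _ p

lemma genIn_out_ne (F : Paths Q ⥤ B) {c d j : Q} {p : Quiver.Path c j} {q : Quiver.Path d j}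
    (h : (⟨c, p⟩ : PathsTo j) ≠ ⟨d, q⟩) : genIn F p ≫ genOut F q = 0 := shriekIn_out_ne _ h

lemma genIn_arr (F : Paths Q ⥤ B) {c i j : Q} (p : Quiver.Path c i) (α : i ⟶ j) :
    genIn F p ≫ arr ((endoP Q B).obj F) α = genIn F (p.cons α) := shriekIn_arr _ p α

lemma genIn_pathMap (F : Paths Q ⥤ B) {c i j : Q} (p : Quiver.Path c i) (q : Quiver.Path i j) :
    genIn F p ≫ pathMap ((endoP Q B).obj F) q = genIn F (p.comp q) := by
  induction q with
  | nil => rw [pathMap_nil, Category.comp_id, Quiver.Path.comp_nil]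
  | cons q α ih => rw [pathMap_cons, ← Category.assoc, ih, genIn_arr, Quiver.Path.comp_cons]

lemma genIn_map {F G : Paths Q ⥤ B} (f : F ⟶ G) {c j : Q} (p : Quiver.Path c j) :
    genIn F p ≫ comp ((endoP Q B).map f) j = comp f c ≫ genIn G p :=
  shriekIn_map _ p

lemma gen_mor_ext {F G : Paths Q ⥤ B} {f g : (endoP Q B).obj F ⟶ G}
    (h : ∀ i : Q, genIn F Quiver.Path.nil ≫ comp f i = genIn F Quiver.Path.nil ≫ comp g i) :
    f = g :=
  (shriekHomEquiv ((iStar Q B).obj F) G).injective (funext h)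

/-- The morphism out of `P(F)` that belongs to a family of morphisms. -/
noncomputable def genMk {F G : Paths Q ⥤ B} (g : ∀ i : Q, vert F i ⟶ vert G i) :
    (endoP Q B).obj F ⟶ G := (shriekHomEquiv ((iStar Q B).obj F) G).symm g

lemma genIn_mk {F G : Paths Q ⥤ B} (g : ∀ i : Q, vert F i ⟶ vert G i) {c i : Q}
    (p : Quiver.Path c i) : genIn F p ≫ comp (genMk g) i = g c ≫ pathMap G p :=
  shriekι_desc ((iStar Q B).obj F) (fun {c} p => g c ≫ pathMap G p) p

/-- The morphism out of `i_!(X)` that belongs to a family of morphisms. -/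
noncomputable def shriekMk {X : Q → B} {F : Paths Q ⥤ B} (g : ∀ i : Q, X i ⟶ vert F i) :
    (iShriek Q B).obj X ⟶ F := (shriekHomEquiv X F).symm g

lemma shriekIn_nil_mk {X : Q → B} {F : Paths Q ⥤ B} (g : ∀ i : Q, X i ⟶ vert F i) (i : Q) :
    shriekIn X Quiver.Path.nil ≫ comp (shriekMk g) i = g i :=
  congrFun ((shriekHomEquiv X F).apply_symm_apply g) i

lemma shriekMk_ext {X : Q → B} {F : Paths Q ⥤ B} {f g : (iShriek Q B).obj X ⟶ F}
    (h : ∀ i : Q, shriekIn X Quiver.Path.nil ≫ comp f i = shriekIn X Quiver.Path.nil ≫ comp g i) :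
    f = g :=
  (shriekHomEquiv X F).injective (funext h)

/-- The inclusion of a summand of the relations. -/
noncomputable def relIn (F : Paths Q ⥤ B) {i c j : Q} (α : i ⟶ c) (p : Quiver.Path c j) :
    vert F i ⟶ vert ((relations Q B).obj F) j :=
  sumToIn ((iStar Q B).obj F) α ≫ shriekIn ((sumTo Q B).obj ((iStar Q B).obj F)) p

/-- The projection from the relations that belongs to a path. -/
noncomputable def relOut (F : Paths Q ⥤ B) {c j : Q} (p : Quiver.Path c j) :
    vert ((relations Q B).obj F) j ⟶ srcObj F c :=
  shriekOut ((sumTo Q B).obj ((iStar Q B).obj F)) p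

lemma relIn_out_self (F : Paths Q ⥤ B) {i c j : Q} (α : i ⟶ c) (p : Quiver.Path c j) :
    relIn F α p ≫ relOut F p = srcIn F α :=
  (Category.assoc _ _ _).trans ((congrArg (fun t => sumToIn ((iStar Q B).obj F) α ≫ t)
    (shriekIn_out_self ((sumTo Q B).obj ((iStar Q B).obj F)) p)).trans (Category.comp_id _))

lemma relIn_out_ne (F : Paths Q ⥤ B) {i c d j : Q} (α : i ⟶ c) {p : Quiver.Path c j}
    {q : Quiver.Path d j} (h : (⟨c, p⟩ : PathsTo j) ≠ ⟨d, q⟩) : relIn F α p ≫ relOut F q = 0 :=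
  (Category.assoc _ _ _).trans ((congrArg (fun t => sumToIn ((iStar Q B).obj F) α ≫ t)
    (shriekIn_out_ne ((sumTo Q B).obj ((iStar Q B).obj F)) h)).trans comp_zero)

lemma rel_hom_ext {F : Paths Q ⥤ B} {j : Q} {Y : B} {f g : vert ((relations Q B).obj F) j ⟶ Y}
    (h : ∀ {i c : Q} (α : i ⟶ c) (p : Quiver.Path c j), relIn F α p ≫ f = relIn F α p ≫ g) :
    f = g :=
  shriek_hom_ext (X := (sumTo Q B).obj ((iStar Q B).obj F)) fun p => sumTo_hom_ext fun α =>
    (Category.assoc _ _ _).symm.trans ((h α p).trans (Category.assoc _ _ _))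

lemma rel_hom_ext' {F : Paths Q ⥤ B} {j : Q} {Y : B} {f g : Y ⟶ vert ((relations Q B).obj F) j}
    (h : ∀ {c : Q} (p : Quiver.Path c j), f ≫ relOut F p = g ≫ relOut F p) : f = g :=
  shriek_hom_ext' (X := (sumTo Q B).obj ((iStar Q B).obj F)) h

lemma rel_mor_ext {F G : Paths Q ⥤ B} {f g : (relations Q B).obj F ⟶ G}
    (h : ∀ {i j : Q} (α : i ⟶ j),
      relIn F α Quiver.Path.nil ≫ comp f j = relIn F α Quiver.Path.nil ≫ comp g j) : f = g :=
  (shriekHomEquiv ((sumTo Q B).obj ((iStar Q B).obj F)) G).injective (funext fun _ =>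
    sumTo_hom_ext fun α =>
      (Category.assoc _ _ _).symm.trans ((h α).trans (Category.assoc _ _ _)))

lemma relIn_map {F G : Paths Q ⥤ B} (f : F ⟶ G) {i c j : Q} (α : i ⟶ c) (p : Quiver.Path c j) :
    relIn F α p ≫ comp ((relations Q B).map f) j = comp f i ≫ relIn G α p := by
  refine (Category.assoc _ _ _).trans ?_
  refine (congrArg (fun t => sumToIn ((iStar Q B).obj F) α ≫ t)
    (shriekIn_map ((sumTo Q B).map ((iStar Q B).map f)) p)).trans ?_
  refine (Category.assoc _ _ _).symm.trans ?_
  exact (congrArg (fun t => t ≫ shriekIn ((sumTo Q B).obj ((iStar Q B).obj G)) p)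
    (sumToIn_map ((iStar Q B).map f) α)).trans (Category.assoc _ _ _)

/-- The morphism out of the relations that belongs to a family of morphisms. -/
noncomputable def relMk {F G : Paths Q ⥤ B} (g : ∀ {i j : Q}, (i ⟶ j) → (vert F i ⟶ vert G j)) :
    (relations Q B).obj F ⟶ G :=
  (shriekHomEquiv ((sumTo Q B).obj ((iStar Q B).obj F)) G).symm fun _ =>
    sumToDesc ((iStar Q B).obj F) fun {_} α => g α

lemma relIn_mk {F G : Paths Q ⥤ B} (g : ∀ {i j : Q}, (i ⟶ j) → (vert F i ⟶ vert G j)) {i c j : Q}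
    (α : i ⟶ c) (p : Quiver.Path c j) :
    relIn F α p ≫ comp (relMk g) j = g α ≫ pathMap G p := by
  refine (Category.assoc _ _ _).trans ?_
  refine (congrArg (fun t => sumToIn ((iStar Q B).obj F) α ≫ t)
    (shriekι_desc ((sumTo Q B).obj ((iStar Q B).obj F)) (fun p =>
      sumToDesc ((iStar Q B).obj F) (fun {i} α => g α) ≫ pathMap G p) p)).trans ?_
  refine (Category.assoc _ _ _).symm.trans ?_
  exact congrArg (fun t => t ≫ pathMap G p) (sumToIn_desc ((iStar Q B).obj F) (fun {i} α => g α) α)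

/-- The canonical epimorphism `i_!(i^*(F)) ⟶ F`. -/
noncomputable def cover (F : Paths Q ⥤ B) : (endoP Q B).obj F ⟶ F :=
  genMk fun _ => 𝟙 _

lemma genIn_cover (F : Paths Q ⥤ B) {i j : Q} (p : Quiver.Path i j) :
    genIn F p ≫ comp (cover F) j = pathMap F p := by
  rw [cover, genIn_mk, Category.id_comp]

instance epi_cover (F : Paths Q ⥤ B) : Epi (cover F) :=
  (epi_iff_comp _).2 fun i => by
    have : IsSplitEpi (comp (cover F) i) :=
      ⟨⟨genIn F Quiver.Path.nil, by rw [genIn_cover, pathMap_nil]⟩⟩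
    infer_instance

/-- The inclusion of the relations. -/
noncomputable def relHom (F : Paths Q ⥤ B) : (relations Q B).obj F ⟶ (endoP Q B).obj F :=
  relMk fun α => arr F α ≫ genIn F Quiver.Path.nil - genIn F α.toPath

lemma relIn_relHom (F : Paths Q ⥤ B) {i c j : Q} (α : i ⟶ c) (p : Quiver.Path c j) :
    relIn F α p ≫ comp (relHom F) j = arr F α ≫ genIn F p - genIn F (α.toPath.comp p) := by
  rw [relHom, relIn_mk, Preadditive.sub_comp, Category.assoc, genIn_pathMap, genIn_pathMap,
    Quiver.Path.nil_comp]

lemma relHom_cover (F : Paths Q ⥤ B) : relHom F ≫ cover F = 0 := by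
  refine rel_mor_ext fun {i j} α => ?_
  rw [comp_comp, ← Category.assoc, relIn_relHom, Preadditive.sub_comp, Category.assoc,
    genIn_cover, genIn_cover, pathMap_nil, Category.comp_id]
  refine Eq.trans ?_ comp_zero.symm
  exact sub_self (arr F α)

/-- A morphism out of `i_!(i^*(F))` that vanishes on the relations factors through `F`. -/
noncomputable def coverDesc {F G : Paths Q ⥤ B} (g : (endoP Q B).obj F ⟶ G)
    (h : relHom F ≫ g = 0) : F ⟶ G :=
  mkHom (fun i => genIn F Quiver.Path.nil ≫ comp g i) fun {i j} α => by
    have h₁ := relIn_relHom F α Quiver.Path.nil =≫ comp g j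
    have h₂ : comp (relHom F) j ≫ comp g j = 0 := congrArg (fun t => comp t j) h
    rw [Category.assoc, h₂, comp_zero, Preadditive.sub_comp, Category.assoc] at h₁
    refine (sub_eq_zero.1 h₁.symm).trans ?_
    rw [Category.assoc, ← comp_naturality, ← Category.assoc, genIn_arr]
    rfl

variable (Q B) in
/-- The sequence `i_!(W) ⟶ i_!(i^*(F)) ⟶ F`. -/
noncomputable abbrev standardSeq (F : Paths Q ⥤ B) : ShortComplex (Paths Q ⥤ B) :=
  ShortComplex.mk (relHom F) (cover F) (relHom_cover F)

/-- A morphism out of P(F) is a family F(i) ⟶ G(i), and it vanishes on the relations exactly when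
the family commutes with the arrows. So F is the cokernel. -/
lemma standardSeq_exact (F : Paths Q ⥤ B) : (standardSeq Q B F).Exact := by
  have : Epi (standardSeq Q B F).g := epi_cover F
  refine ShortComplex.exact_of_g_is_cokernel _ (CokernelCofork.IsColimit.ofπ' _ _ fun {G} g h => ?_)
  refine ⟨coverDesc g h, gen_mor_ext fun i => ?_⟩
  refine (Category.assoc _ _ _).symm.trans ?_
  refine (congrArg (fun t => t ≫ comp (coverDesc g h) i) (genIn_cover F Quiver.Path.nil)).trans ?_
  rw [pathMap_nil, Category.id_comp]
  rfl

/-- The relation of β at r has one term at the path r and one at βr. The summand at αp receives the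
first when r = αp, and the second only when β = α and r = p, by `toPath_comp_inj`. -/
lemma relHom_out (F : Paths Q ⥤ B) {d c j : Q} (α : d ⟶ c) (p : Quiver.Path c j) :
    comp (relHom F) j ≫ genOut F (α.toPath.comp p) =
      relOut F (α.toPath.comp p) ≫ srcDesc F d - relOut F p ≫ srcOut F α := by
  refine rel_hom_ext fun {e b} β r => ?_
  rw [Preadditive.comp_sub, ← Category.assoc, ← Category.assoc, ← Category.assoc,
    relIn_relHom, Preadditive.sub_comp]
  congr 1
  · by_cases h : (⟨b, r⟩ : PathsTo j) = ⟨d, α.toPath.comp p⟩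
    · cases h
      rw [Category.assoc, genIn_out_self, relIn_out_self, srcIn_desc, Category.comp_id]
    · rw [Category.assoc, genIn_out_ne _ h, relIn_out_ne _ _ h, comp_zero, zero_comp]
  · by_cases h : (⟨e, β.toPath.comp r⟩ : PathsTo j) = ⟨d, α.toPath.comp p⟩
    · obtain ⟨rfl, h⟩ := Sigma.mk.inj h
      cases toPath_comp_inj (eq_of_heq h)
      rw [genIn_out_self, relIn_out_self, srcIn_out_self]
    · rw [genIn_out_ne _ h]
      by_cases h' : (⟨b, r⟩ : PathsTo j) = ⟨c, p⟩
      · cases h'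
        rw [relIn_out_self, srcIn_out_ne]
        intro h''
        cases h''
        exact h rfl
      · rw [relIn_out_ne _ _ h', zero_comp]

instance mono_relHom (F : Paths Q ⥤ B) : Mono (relHom F) :=
  (mono_iff_comp _).2 fun j => by
    refine Preadditive.mono_of_cancel_zero _ fun {Z} x hx => ?_
    obtain ⟨N, hN⟩ := exists_length_pathsTo_lt j
    -- Descending induction on the length of p, starting above the bound N. By `relHom_out` at αp,
    -- the α-component at p is determined by the component at the longer path αp, which already
    -- vanishes.
    have key : ∀ (n : ℕ) {c : Q} (p : Quiver.Path c j), N ≤ p.length + n →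
        x ≫ relOut F p = 0 := by
      intro n
      induction n with
      | zero => exact fun p hp => absurd (hN p) (not_lt.2 hp)
      | succ n ih =>
        refine fun {c} p hp => src_hom_ext' fun {d} α => ?_
        have h := x ≫= relHom_out F α p
        have h' := ih (α.toPath.comp p) (by
          rw [Quiver.Path.length_comp, Quiver.Path.length_toPath]
          omega)
        rw [← Category.assoc, hx, zero_comp, Preadditive.comp_sub, ← Category.assoc, h',
          zero_comp, zero_sub] at h
        rw [Category.assoc, zero_comp]
        exact neg_eq_zero.1 h.symm
    refine rel_hom_ext' fun {c} p => ?_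
    rw [key N p (Nat.le_add_left _ _), zero_comp]

lemma standardSeq_shortExact (F : Paths Q ⥤ B) : (standardSeq Q B F).ShortExact where
  exact := standardSeq_exact F
  mono_f := mono_relHom F
  epi_g := epi_cover F

variable (Q B) in
/-- The inclusion of the relations as a natural transformation. -/
noncomputable def relNatTrans : relations Q B ⟶ endoP Q B where
  app F := relHom F
  naturality F G f := rel_mor_ext fun {i j} α => by
    rw [comp_comp, comp_comp, ← Category.assoc, relIn_map, Category.assoc,
      relIn_relHom, ← Category.assoc, relIn_relHom, Preadditive.sub_comp, Category.assoc,
      genIn_map, genIn_map, Preadditive.comp_sub, ← Category.assoc, ← Category.assoc,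
      comp_naturality]

variable (Q B) in
/-- The canonical epimorphisms as a natural transformation. -/
noncomputable def coverNatTrans : endoP Q B ⟶ 𝟭 _ where
  app F := cover F
  naturality F G f := gen_mor_ext fun j => by
    rw [comp_comp, comp_comp, ← Category.assoc, genIn_map, Category.assoc,
      genIn_cover, ← Category.assoc, genIn_cover, comp_pathMap]
    rfl

end Relations

end QuiverRep

namespace QuiverRep

/-! ### Monic representations as those for which ν keeps the relations injective -/

section NakayamaRelations

variable {Q : Type u} [Quiver.{v} Q] [LocallyBoundedQuiver Q]
  {B : Type u₁} [Category.{v₁} B] [Abelian B]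

/-- The representation `i_*(i^*(F)) ≅ ν(P(F))`. -/
noncomputable def genStar (F : Paths Q ⥤ B) : Paths Q ⥤ B :=
  (iLowerStar Q B).obj ((iStar Q B).obj F)

/-- The image under `ν` of the relations, up to isomorphism. -/
noncomputable def relStar (F : Paths Q ⥤ B) : Paths Q ⥤ B :=
  (iLowerStar Q B).obj ((sumTo Q B).obj ((iStar Q B).obj F))

/-- The isomorphism `ν(P(F)) ≅ i_*(i^*(F))`. -/
noncomputable def genStarHom (F : Paths Q ⥤ B) :
    (nakayama Q B).obj ((endoP Q B).obj F) ⟶ genStar F :=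
  nakShriekHom ((iStar Q B).obj F)

/-- The isomorphism from the image under `ν` of the relations. -/
noncomputable def relStarHom (F : Paths Q ⥤ B) :
    (nakayama Q B).obj ((relations Q B).obj F) ⟶ relStar F :=
  nakShriekHom ((sumTo Q B).obj ((iStar Q B).obj F))

instance isIso_genStarHom (F : Paths Q ⥤ B) : IsIso (genStarHom F) :=
  isIso_nakShriekHom _

instance isIso_relStarHom (F : Paths Q ⥤ B) : IsIso (relStarHom F) :=
  isIso_nakShriekHom _

/-- The inclusion of a summand of `i_*(i^*(F))`. -/
noncomputable def genStarIn (F : Paths Q ⥤ B) {i c : Q} (r : Quiver.Path i c) :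
    vert F c ⟶ vert (genStar F) i := starIn ((iStar Q B).obj F) r

/-- The projection to a summand of `i_*(i^*(F))`. -/
noncomputable def genStarOut (F : Paths Q ⥤ B) {i c : Q} (r : Quiver.Path i c) :
    vert (genStar F) i ⟶ vert F c := starOut ((iStar Q B).obj F) r

lemma genStarIn_out_self (F : Paths Q ⥤ B) {i c : Q} (r : Quiver.Path i c) :
    genStarIn F r ≫ genStarOut F r = 𝟙 _ := starIn_out_self _ r

lemma genStarIn_out_ne (F : Paths Q ⥤ B) {i c d : Q} {r : Quiver.Path i c} {s : Quiver.Path i d}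
    (h : (⟨c, r⟩ : PathsFrom i) ≠ ⟨d, s⟩) : genStarIn F r ≫ genStarOut F s = 0 :=
  starIn_out_ne _ h

/-- The inclusion of a summand of `relStar F`. -/
noncomputable def relStarIn (F : Paths Q ⥤ B) {i c d : Q} (α : d ⟶ c) (r : Quiver.Path i c) :
    vert F d ⟶ vert (relStar F) i :=
  sumToIn ((iStar Q B).obj F) α ≫ starIn ((sumTo Q B).obj ((iStar Q B).obj F)) r

/-- The inclusion of `⨁ F(s(α))` in `relStar F` that belongs to a path. -/
noncomputable def relStarSrc (F : Paths Q ⥤ B) {i c : Q} (r : Quiver.Path i c) :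
    srcObj F c ⟶ vert (relStar F) i :=
  starIn ((sumTo Q B).obj ((iStar Q B).obj F)) r

/-- The projection from `relStar F` that belongs to a path. -/
noncomputable def relStarOut (F : Paths Q ⥤ B) {i c : Q} (r : Quiver.Path i c) :
    vert (relStar F) i ⟶ srcObj F c :=
  starOut ((sumTo Q B).obj ((iStar Q B).obj F)) r

lemma srcIn_relStarSrc (F : Paths Q ⥤ B) {i c d : Q} (α : d ⟶ c) (r : Quiver.Path i c) :
    srcIn F α ≫ relStarSrc F r = relStarIn F α r := rfl

lemma relStarSrc_out (F : Paths Q ⥤ B) {i c : Q} (r : Quiver.Path i c) :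
    relStarSrc F r ≫ relStarOut F r = 𝟙 _ := starIn_out_self _ r

lemma relStarSrc_out_ne (F : Paths Q ⥤ B) {i c d : Q} {r : Quiver.Path i c} {s : Quiver.Path i d}
    (h : (⟨c, r⟩ : PathsFrom i) ≠ ⟨d, s⟩) : relStarSrc F r ≫ relStarOut F s = 0 :=
  starIn_out_ne _ h

lemma relStarIn_out_self (F : Paths Q ⥤ B) {i c d : Q} (α : d ⟶ c) (r : Quiver.Path i c) :
    relStarIn F α r ≫ relStarOut F r = srcIn F α := by
  rw [← srcIn_relStarSrc, Category.assoc, relStarSrc_out, Category.comp_id]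

lemma relStarIn_out_ne (F : Paths Q ⥤ B) {i c c' d : Q} (α : d ⟶ c) {r : Quiver.Path i c}
    {s : Quiver.Path i c'} (h : (⟨c, r⟩ : PathsFrom i) ≠ ⟨c', s⟩) :
    relStarIn F α r ≫ relStarOut F s = 0 := by
  rw [← srcIn_relStarSrc, Category.assoc, relStarSrc_out_ne F h, comp_zero]

lemma relStar_hom_ext {F : Paths Q ⥤ B} {i : Q} {Y : B} {f g : vert (relStar F) i ⟶ Y}
    (h : ∀ {d c : Q} (α : d ⟶ c) (r : Quiver.Path i c),
      relStarIn F α r ≫ f = relStarIn F α r ≫ g) : f = g :=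
  star_hom_ext (X := (sumTo Q B).obj ((iStar Q B).obj F)) fun r => sumTo_hom_ext fun α =>
    (Category.assoc _ _ _).symm.trans ((h α r).trans (Category.assoc _ _ _))

lemma relStar_hom_ext' {F : Paths Q ⥤ B} {i : Q} {Y : B} {f g : Y ⟶ vert (relStar F) i}
    (h : ∀ {c : Q} (r : Quiver.Path i c), f ≫ relStarOut F r = g ≫ relStarOut F r) : f = g :=
  star_hom_ext' (X := (sumTo Q B).obj ((iStar Q B).obj F)) h

lemma relIn_nakIn_relStarHom (F : Paths Q ⥤ B) {i c d : Q} (α : d ⟶ c) (r : Quiver.Path i c) :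
    (relIn F α Quiver.Path.nil ≫ nakIn ((relations Q B).obj F) r) ≫ comp (relStarHom F) i =
      relStarIn F α r := by
  refine (Category.assoc _ _ _).trans ((Category.assoc _ _ _).trans ?_)
  refine congrArg (fun t => sumToIn ((iStar Q B).obj F) α ≫ t) ?_
  exact (Category.assoc _ _ _).symm.trans
    (nakShriekIn_hom ((sumTo Q B).obj ((iStar Q B).obj F)) r)

lemma genIn_nil_nakIn_genStarHom (F : Paths Q ⥤ B) {i c : Q} (r : Quiver.Path i c) :
    genIn F Quiver.Path.nil ≫ nakIn ((endoP Q B).obj F) r ≫ comp (genStarHom F) i =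
      genStarIn F r :=
  (Category.assoc _ _ _).symm.trans (nakShriekIn_hom ((iStar Q B).obj F) r)

open Classical in
lemma genIn_nakIn_genStarHom (F : Paths Q ⥤ B) {i j d : Q} (q : Quiver.Path d j)
    (p : Quiver.Path i j) :
    genIn F q ≫ nakIn ((endoP Q B).obj F) p ≫ comp (genStarHom F) i =
      ∑ r : Quiver.Path i d, if r.comp q = p then genStarIn F r else 0 := by
  refine (congrArg (fun t => genIn F q ≫ t) (nakIn_shriekHom ((iStar Q B).obj F) p)).trans ?_
  exact shriekIn_toStar ((iStar Q B).obj F) p q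

/-- The map `ν(relHom F)`, up to isomorphism. -/
noncomputable def relStarMap (F : Paths Q ⥤ B) : relStar F ⟶ genStar F :=
  inv (relStarHom F) ≫ (nakayama Q B).map (relHom F) ≫ genStarHom F

lemma relStarHom_map (F : Paths Q ⥤ B) :
    relStarHom F ≫ relStarMap F = (nakayama Q B).map (relHom F) ≫ genStarHom F := by
  rw [relStarMap, IsIso.hom_inv_id_assoc]

lemma mono_relStarMap_iff (F : Paths Q ⥤ B) :
    Mono (relStarMap F) ↔ Mono ((nakayama Q B).map (relHom F)) := by
  constructor
  · intro h
    have : Mono ((nakayama Q B).map (relHom F) ≫ genStarHom F) := by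
      rw [← relStarHom_map]
      infer_instance
    exact mono_of_mono _ (genStarHom F)
  · intro h
    rw [relStarMap]
    infer_instance

-- Placing the relation α at r^* turns its second term into r^* · α by the tensor relations. At most
-- one s contributes, and none does unless r ends with α.
open Classical in
lemma relStarIn_map (F : Paths Q ⥤ B) {i c d : Q} (α : d ⟶ c) (r : Quiver.Path i c) :
    relStarIn F α r ≫ comp (relStarMap F) i = arr F α ≫ genStarIn F r -
      ∑ s : Quiver.Path i d, if s.cons α = r then genStarIn F s else 0 := by
  have h : comp (relStarHom F) i ≫ comp (relStarMap F) i =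
      comp ((nakayama Q B).map (relHom F)) i ≫ comp (genStarHom F) i :=
    congrArg (fun t => comp t i) (relStarHom_map F)
  rw [← relIn_nakIn_relStarHom, Category.assoc, h, Category.assoc, ← Category.assoc (nakIn _ _),
    nakIn_map, ← Category.assoc, ← Category.assoc, relIn_relHom, Category.assoc,
    Preadditive.sub_comp, Category.assoc, genIn_nil_nakIn_genStarHom, genIn_nakIn_genStarHom]
  rfl

/-- This is the triangular form of ν(`relHom`): besides the diagonal entry at q, only paths longer
by one arrow contribute. -/
lemma relStarMap_out (F : Paths Q ⥤ B) {i c : Q} (q : Quiver.Path i c) :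
    comp (relStarMap F) i ≫ genStarOut F q = relStarOut F q ≫ srcDesc F c -
      ∑ β : (Σ e : Q, (c ⟶ e)), relStarOut F (q.cons β.2) ≫ srcOut F β.2 := by
  classical
  refine relStar_hom_ext fun {d c'} α r => ?_
  rw [← Category.assoc, relStarIn_map, Preadditive.comp_sub, Preadditive.sub_comp,
    ← Category.assoc]
  congr 1
  · by_cases h : (⟨c', r⟩ : PathsFrom i) = ⟨c, q⟩
    · cases h
      rw [Category.assoc, genStarIn_out_self, relStarIn_out_self, srcIn_desc, Category.comp_id]
    · rw [Category.assoc, genStarIn_out_ne _ h, relStarIn_out_ne _ _ h, comp_zero, zero_comp]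
  · rw [Preadditive.sum_comp, Preadditive.comp_sum]
    -- The summand (α, r) meets the term of β only if r is q followed by β and α = β. Bundling the
    -- end points, the path and the arrow into one tuple expresses this without casts.
    have e : ∀ β : (Σ e : Q, (c ⟶ e)),
        (⟨d, c', r, α⟩ : Σ d c' : Q, Σ _ : Quiver.Path i c', (d ⟶ c')) ≠
          ⟨c, β.1, q.cons β.2, β.2⟩ →
        relStarIn F α r ≫ relStarOut F (q.cons β.2) ≫ srcOut F β.2 = 0 := by
      rintro ⟨e, β⟩ hβ
      rw [← Category.assoc]
      by_cases h : (⟨c', r⟩ : PathsFrom i) = ⟨e, q.cons β⟩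
      · cases h
        rw [relStarIn_out_self, srcIn_out_ne]
        intro h
        cases h
        exact hβ rfl
      · rw [relStarIn_out_ne _ _ h, zero_comp]
    by_cases h : ∃ β : (Σ e : Q, (c ⟶ e)),
        (⟨d, c', r, α⟩ : Σ d c' : Q, Σ _ : Quiver.Path i c', (d ⟶ c')) =
          ⟨c, β.1, q.cons β.2, β.2⟩
    · obtain ⟨⟨b, β⟩, h⟩ := h
      cases h
      rw [Finset.sum_eq_single q, if_pos rfl, genStarIn_out_self,
        Finset.sum_eq_single ⟨b, β⟩, ← Category.assoc, relStarIn_out_self, srcIn_out_self]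
      · rintro ⟨e', β'⟩ _ hβ
        refine e _ fun h => hβ ?_
        cases h
        rfl
      · exact fun h => absurd (Finset.mem_univ _) h
      · intro s _ hs
        rw [if_neg fun h => hs (eq_of_heq (Quiver.Path.cons.inj h).2.1), zero_comp]
      · exact fun h => absurd (Finset.mem_univ _) h
    · rw [Finset.sum_eq_zero, Finset.sum_eq_zero]
      · exact fun β _ => e β fun h' => h ⟨β, h'⟩
      · intro s _
        split_ifs with hs
        · refine genStarIn_out_ne _ fun h' => h ?_
          cases h'
          exact ⟨⟨c', α⟩, by rw [hs]⟩
        · exact zero_comp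

lemma IsMonic.mono_relStarMap {F : Paths Q ⥤ B} (hF : IsMonic F) : Mono (relStarMap F) :=
  (mono_iff_comp _).2 fun i => by
    refine Preadditive.mono_of_cancel_zero _ fun {Z} x hx => ?_
    obtain ⟨N, hN⟩ := exists_length_pathsFrom_lt i
    -- Descending induction on length again: the terms at paths p followed by β vanish, so the
    -- component at p is killed by the monomorphism ⨁ F(s(α)) ⟶ F(c).
    have key : ∀ (n : ℕ) {c : Q} (p : Quiver.Path i c), N ≤ p.length + n →
        x ≫ relStarOut F p = 0 := by
      intro n
      induction n with
      | zero => exact fun p hp => absurd (hN p) (not_lt.2 hp)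
      | succ n ih =>
        intro c p hp
        have h := x ≫= relStarMap_out F p
        have h' : x ≫ ∑ β : (Σ e : Q, (c ⟶ e)), relStarOut F (p.cons β.2) ≫ srcOut F β.2 = 0 := by
          rw [Preadditive.comp_sum]
          refine Finset.sum_eq_zero fun β _ => ?_
          rw [← Category.assoc, ih (p.cons β.2) (by rw [Quiver.Path.length_cons]; omega),
            zero_comp]
        rw [← Category.assoc, hx, zero_comp, Preadditive.comp_sub, h', sub_zero,
          ← Category.assoc] at h
        have := (isMonic_iff F).1 hF c
        exact zero_of_comp_mono (srcDesc F c) h.symm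
    refine relStar_hom_ext' fun {c} p => ?_
    rw [key N p (Nat.le_add_left _ _), zero_comp]

lemma isMonic_of_mono_relStarMap {F : Paths Q ⥤ B} (h : Mono (relStarMap F)) : IsMonic F := by
  classical
  refine (isMonic_iff F).2 fun i => Preadditive.mono_of_cancel_zero _ fun {Z} y hy => ?_
  -- At the trivial path the correction sum is empty, since no path ending with α is trivial. The
  -- map ⨁ F(s(α)) ⟶ F(i) is therefore a restriction of `relStarMap`.
  have e : relStarSrc F (Quiver.Path.nil : Quiver.Path i i) ≫ comp (relStarMap F) i =
      srcDesc F i ≫ genStarIn F Quiver.Path.nil := by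
    refine src_hom_ext fun {d} α => ?_
    rw [← Category.assoc, ← Category.assoc, srcIn_relStarSrc, srcIn_desc, relStarIn_map,
      Finset.sum_eq_zero, sub_zero]
    exact fun s _ => if_neg (Quiver.Path.cons_ne_nil s α)
  have := (mono_iff_comp _).1 h i
  have h₀ : y ≫ relStarSrc F (Quiver.Path.nil : Quiver.Path i i) = 0 := by
    refine zero_of_comp_mono (comp (relStarMap F) i) ?_
    rw [Category.assoc, e, ← Category.assoc, hy, zero_comp]
  have h₁ := h₀ =≫ relStarOut F Quiver.Path.nil
  rwa [Category.assoc, relStarSrc_out, Category.comp_id, zero_comp] at h₁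

/-- A representation is monic if and only if `ν` preserves the injectivity of its relations. -/
lemma isMonic_iff_mono_nakayama (F : Paths Q ⥤ B) :
    IsMonic F ↔ Mono ((nakayama Q B).map (relHom F)) :=
  ⟨fun h => (mono_relStarMap_iff F).1 h.mono_relStarMap,
    fun h => isMonic_of_mono_relStarMap ((mono_relStarMap_iff F).2 h)⟩

end NakayamaRelations

end QuiverRep

namespace RelGorenstein

/-! ### Fragments of the snake lemma for an exact sequence of functors -/

section Diagrams

variable {C D : Type*} [Category* C] [Category* D] [Abelian C] [Abelian D]
  {T₁ T₂ T₃ : C ⥤ D} [T₁.PreservesZeroMorphisms] [T₂.PreservesZeroMorphisms]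
  {τ : T₁ ⟶ T₂} {σ : T₂ ⟶ T₃} {hz : ∀ X, τ.app X ≫ σ.app X = 0}
  (he : ∀ X, (ShortComplex.mk (τ.app X) (σ.app X) (hz X)).Exact)
  {S : ShortComplex C}

include he in
/-- A part of the snake lemma for two natural transformations. -/
lemma mono_app_X₃ [Epi (T₁.map S.g)] (h₂ : (S.map T₂).Exact) [Mono (T₂.map S.f)]
    [Mono (τ.app S.X₂)] [Mono (T₃.map S.f)] : Mono (τ.app S.X₃) := by
  refine Preadditive.mono_of_cancel_zero _ fun {Z} x hx => ?_
  obtain ⟨A, π, _, y, hy⟩ := surjective_up_to_refinements_of_epi (T₁.map S.g) x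
  have h₃ : (y ≫ τ.app S.X₂) ≫ T₂.map S.g = 0 := by
    rw [Category.assoc, ← τ.naturality, ← Category.assoc, ← hy, Category.assoc, hx, comp_zero]
  -- The image of y in T₂(X₂) lifts to z in T₂(X₁). Injectivity of T₃(f) puts z in the kernel of σ,
  -- hence in the image of τ, so y comes from T₁(X₁) and dies in T₁(X₃).
  obtain ⟨A', π', _, z, hz'⟩ : ∃ (A' : D) (π' : A' ⟶ A) (_ : Epi π') (z : A' ⟶ T₂.obj S.X₁),
      π' ≫ y ≫ τ.app S.X₂ = z ≫ T₂.map S.f := h₂.exact_up_to_refinements (y ≫ τ.app S.X₂) h₃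
  have h₄ : z ≫ σ.app S.X₁ = 0 := by
    refine zero_of_comp_mono (T₃.map S.f) ?_
    rw [Category.assoc, ← σ.naturality, ← Category.assoc, ← hz']
    simp [hz]
  obtain ⟨A'', π'', _, t, ht⟩ : ∃ (A'' : D) (π'' : A'' ⟶ A') (_ : Epi π'')
      (t : A'' ⟶ T₁.obj S.X₁), π'' ≫ z = t ≫ τ.app S.X₁ := (he S.X₁).exact_up_to_refinements z h₄
  have h₅ : π'' ≫ π' ≫ y = t ≫ T₁.map S.f := by
    rw [← cancel_mono (τ.app S.X₂), Category.assoc, Category.assoc, Category.assoc,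
      τ.naturality, ← Category.assoc t, ← ht, hz', Category.assoc]
  rw [← cancel_epi π, ← cancel_epi π', ← cancel_epi π'', hy, ← Category.assoc, ← Category.assoc,
    Category.assoc π'', h₅, Category.assoc, ← T₁.map_comp, S.zero, T₁.map_zero]
  simp

include he in
/-- A part of the snake lemma for two natural transformations. -/
lemma mono_map_f (h₁ : (S.map T₁).Exact) [Mono (T₂.map S.f)]
    [Mono (τ.app S.X₃)] [Epi (σ.app S.X₁)] [T₃.PreservesZeroMorphisms] :
    Mono (T₃.map S.f) := by
  refine Preadditive.mono_of_cancel_zero _ fun {Z} z hz₀ => ?_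
  obtain ⟨A, π, _, y, hy⟩ := surjective_up_to_refinements_of_epi (σ.app S.X₁) z
  have h₃ : (y ≫ T₂.map S.f) ≫ σ.app S.X₂ = 0 := by
    rw [Category.assoc, σ.naturality, ← Category.assoc, ← hy, Category.assoc, hz₀, comp_zero]
  obtain ⟨A', π', _, t, ht⟩ : ∃ (A' : D) (π' : A' ⟶ A) (_ : Epi π') (t : A' ⟶ T₁.obj S.X₂),
      π' ≫ y ≫ T₂.map S.f = t ≫ τ.app S.X₂ := (he S.X₂).exact_up_to_refinements _ h₃
  have h₄ : t ≫ T₁.map S.g = 0 := by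
    refine zero_of_comp_mono (τ.app S.X₃) ?_
    rw [Category.assoc, τ.naturality, ← Category.assoc, ← ht, Category.assoc, Category.assoc,
      ← T₂.map_comp, S.zero, T₂.map_zero, comp_zero, comp_zero]
  -- Since t dies in T₁(X₃), it comes from s in T₁(X₁); injectivity of T₂(f) identifies y with τ(s),
  -- so its image z under σ is zero.
  obtain ⟨A'', π'', _, s, hs⟩ : ∃ (A'' : D) (π'' : A'' ⟶ A') (_ : Epi π'')
      (s : A'' ⟶ T₁.obj S.X₁), π'' ≫ t = s ≫ T₁.map S.f := h₁.exact_up_to_refinements t h₄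
  have h₅ : π'' ≫ π' ≫ y = s ≫ τ.app S.X₁ := by
    rw [← cancel_mono (T₂.map S.f), Category.assoc, Category.assoc, Category.assoc,
      ← τ.naturality, ht, ← Category.assoc, hs, Category.assoc]
  rw [← cancel_epi π, ← cancel_epi π', ← cancel_epi π'', hy, ← Category.assoc, ← Category.assoc,
    Category.assoc π'', h₅, Category.assoc, hz]
  simp

end Diagrams

end RelGorenstein

namespace QuiverRep

/-! ### Closure properties of monic representations and their embedding in P-projectives -/

section Homological

variable {Q : Type u} [Quiver.{v} Q] [LocallyBoundedQuiver Q]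
  {B : Type u₁} [Category.{v₁} B] [Abelian B]

/-- These adjoint instances supply all one-sided exactness below: ν, P and the relations functor
preserve epimorphisms and cokernels, while ν⁻, i^* and i_* preserve monomorphisms and kernels. -/
instance isLeftAdjoint_nakayama : (nakayama Q B).IsLeftAdjoint :=
  (nakayamaAdjunction Q B).isLeftAdjoint

instance isRightAdjoint_nakayamaRight : (nakayamaRight Q B).IsRightAdjoint :=
  (nakayamaAdjunction Q B).isRightAdjoint

instance isLeftAdjoint_relations : (relations Q B).IsLeftAdjoint :=
  (relationsAdjunction Q B).isLeftAdjoint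

instance isLeftAdjoint_endoP : (endoP Q B).IsLeftAdjoint :=
  (endoPAdjunction Q B).isLeftAdjoint

instance isRightAdjoint_iStar : (iStar Q B).IsRightAdjoint :=
  (shriekAdjunction Q B).isRightAdjoint

instance isRightAdjoint_iLowerStar : (iLowerStar Q B).IsRightAdjoint :=
  (starAdjunction Q B).isRightAdjoint

/-- Although ν is only right exact, ν ∘ P ≅ i_* ∘ i^* is a composite of right adjoints. This
provides the injective middle map in the two snake arguments. -/
instance preservesMonomorphisms_endoP_nakayama :
    (endoP Q B ⋙ nakayama Q B).PreservesMonomorphisms :=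
  Functor.PreservesMonomorphisms.of_iso (F := iStar Q B ⋙ iLowerStar Q B)
    (Functor.isoWhiskerLeft (iStar Q B) (shriekNakayamaIso Q B)).symm

lemma shortComplex_map_exact {C D : Type*} [Category* C] [Category* D] [Abelian C] [Abelian D]
    (T : C ⥤ D) [T.PreservesZeroMorphisms] [T.IsLeftAdjoint] {S : ShortComplex C} (hS : S.Exact)
    [Epi S.g] : (S.map T).Exact :=
  hS.map_of_epi_of_preservesCokernel T inferInstance inferInstance

variable (Q B) in
/-- The images under `ν` of the relations. -/
noncomputable abbrev nakRelNatTrans : relations Q B ⋙ nakayama Q B ⟶ endoP Q B ⋙ nakayama Q B :=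
  Functor.whiskerRight (relNatTrans Q B) (nakayama Q B)

variable (Q B) in
/-- The images under `ν` of the canonical epimorphisms. -/
noncomputable abbrev nakCoverNatTrans : endoP Q B ⋙ nakayama Q B ⟶ 𝟭 _ ⋙ nakayama Q B :=
  Functor.whiskerRight (coverNatTrans Q B) (nakayama Q B)

lemma nakRel_nakCover (F : Paths Q ⥤ B) :
    (nakRelNatTrans Q B).app F ≫ (nakCoverNatTrans Q B).app F = 0 :=
  ((nakayama Q B).map_comp (relHom F) (cover F)).symm.trans
    ((congrArg (nakayama Q B).map (relHom_cover F)).trans ((nakayama Q B).map_zero _ _))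

lemma nakRel_nakCover_exact (F : Paths Q ⥤ B) :
    (ShortComplex.mk ((nakRelNatTrans Q B).app F) ((nakCoverNatTrans Q B).app F)
      (nakRel_nakCover F)).Exact := by
  have : Epi (standardSeq Q B F).g := epi_cover F
  have h := shortComplex_map_exact (nakayama Q B) (standardSeq_exact F)
  exact h

/-- In terms of derived functors: if L₁ν(X₂) = 0, then L₁ν(X₃) is the kernel of ν(X₁) ⟶ ν(X₂). The
kernel of ν(`relHom`) stands in for L₁ν. -/
lemma isMonic_X₃ {S : ShortComplex (Paths Q ⥤ B)} (hS : S.ShortExact) (h₂ : IsMonic S.X₂)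
    (hν : Mono ((nakayama Q B).map S.f)) : IsMonic S.X₃ := by
  have := hS.epi_g
  have := hS.mono_f
  have : Mono ((nakRelNatTrans Q B).app S.X₂) := (isMonic_iff_mono_nakayama _).1 h₂
  have : Mono ((𝟭 _ ⋙ nakayama Q B).map S.f) := hν
  exact (isMonic_iff_mono_nakayama _).2 (RelGorenstein.mono_app_X₃ nakRel_nakCover_exact
    (S := S) (shortComplex_map_exact _ hS.exact))

/-- The kernel of ν(X₁) ⟶ ν(X₂) is a quotient of L₁ν(X₃), which is again replaced by the kernel of
ν(`relHom`). -/
lemma mono_nakayama_map {S : ShortComplex (Paths Q ⥤ B)} (hS : S.ShortExact)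
    (h₃ : IsMonic S.X₃) : Mono ((nakayama Q B).map S.f) := by
  have := hS.epi_g
  have := hS.mono_f
  have : Mono ((nakRelNatTrans Q B).app S.X₃) := (isMonic_iff_mono_nakayama _).1 h₃
  have : Epi ((nakCoverNatTrans Q B).app S.X₁) :=
    inferInstanceAs (Epi ((nakayama Q B).map (cover S.X₁)))
  exact RelGorenstein.mono_map_f nakRel_nakCover_exact (S := S)
    (shortComplex_map_exact (relations Q B ⋙ nakayama Q B) hS.exact)

lemma nakayama_shortExact {S : ShortComplex (Paths Q ⥤ B)} (hS : S.ShortExact)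
    (h : Mono ((nakayama Q B).map S.f)) : (S.map (nakayama Q B)).ShortExact where
  exact := by
    have := hS.epi_g
    exact shortComplex_map_exact _ hS.exact
  mono_f := h
  epi_g := by
    have := hS.epi_g
    exact inferInstanceAs (Epi ((nakayama Q B).map S.g))

/-- The square formed by ⨁ F(s(α)) ⟶ F(j) and its analogue for G commutes, and the map between the
two sums is a monomorphism on each summand. -/
lemma isMonic_of_mono {F G : Paths Q ⥤ B} (f : F ⟶ G) [hf : Mono f] (hG : IsMonic G) :
    IsMonic F := by
  refine (isMonic_iff F).2 fun j => Preadditive.mono_of_cancel_zero _ fun {Z} x hx => ?_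
  have := (isMonic_iff G).1 hG j
  let m : srcObj F j ⟶ srcObj G j := biproduct.map fun α => comp f α.1
  have hm : m ≫ srcDesc G j = srcDesc F j ≫ comp f j := src_hom_ext fun {i} α => by
    have e : srcIn F α ≫ m = comp f i ≫ srcIn G α :=
      biproduct.ι_map (f := fun α : (Σ i : Q, (i ⟶ j)) => vert F α.1)
        (g := fun α : (Σ i : Q, (i ⟶ j)) => vert G α.1) (fun α => comp f α.1) ⟨i, α⟩
    rw [← Category.assoc, e, Category.assoc, srcIn_desc, ← Category.assoc, srcIn_desc,
      comp_naturality]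
  have h₁ : x ≫ m = 0 := by
    refine zero_of_comp_mono (srcDesc G j) ?_
    rw [Category.assoc, hm, ← Category.assoc, hx, zero_comp]
  refine src_hom_ext' fun {i} α => ?_
  have := (mono_iff_comp f).1 hf i
  have e : m ≫ srcOut G α = srcOut F α ≫ comp f i :=
    biproduct.map_π (f := fun α : (Σ i : Q, (i ⟶ j)) => vert F α.1)
      (g := fun α : (Σ i : Q, (i ⟶ j)) => vert G α.1) (fun α => comp f α.1) ⟨i, α⟩
  have h₂ : (x ≫ srcOut F α) ≫ comp f i = 0 := by
    rw [Category.assoc, ← e, ← Category.assoc, h₁, zero_comp]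
  rw [zero_of_comp_mono _ h₂, zero_comp]

/-- A section splits the standard sequence, and any functor preserves split monomorphisms. This
covers both the values of i_! and the projective representations. -/
lemma isMonic_of_section {F : Paths Q ⥤ B} (s : F ⟶ (endoP Q B).obj F) (hs : s ≫ cover F = 𝟙 F) :
    IsMonic F := by
  have := ((ShortComplex.Splitting.ofExactOfSection _ (standardSeq_exact F) s hs
    (mono_relHom F)).map (nakayama Q B)).isSplitMono_f
  exact (isMonic_iff_mono_nakayama F).2
    (inferInstanceAs (Mono ((standardSeq Q B F).map (nakayama Q B)).f))

lemma isMonic_shriek (X : Q → B) : IsMonic ((iShriek Q B).obj X) :=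
  isMonic_of_section (shriekMk fun _ => shriekIn X Quiver.Path.nil ≫
    genIn ((iShriek Q B).obj X) Quiver.Path.nil) (shriekMk_ext fun i => by
      rw [comp_comp, ← Category.assoc, shriekIn_nil_mk, Category.assoc, genIn_cover, pathMap_nil]
      rfl)

lemma isMonic_of_isRelProjective {F : Paths Q ⥤ B}
    (h : RelGorenstein.IsRelProjective (endoP Q B) F) : IsMonic F := by
  obtain ⟨Y, ⟨r⟩⟩ := h
  exact isMonic_of_mono r.i (isMonic_shriek ((iStar Q B).obj Y))

/-- By a triangle identity, the counit at i_!(X) is a retraction onto i_!(X) of P(i_!(X)). -/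
lemma isRelProjective_shriek (X : Q → B) :
    RelGorenstein.IsRelProjective (endoP Q B) ((iShriek Q B).obj X) :=
  ⟨(iShriek Q B).obj X,
    ⟨{ i := shriekMk fun _ => shriekIn X Quiver.Path.nil ≫
        genIn ((iShriek Q B).obj X) Quiver.Path.nil
       r := cover _
       retract := shriekMk_ext fun i => by
        rw [comp_comp, ← Category.assoc, shriekIn_nil_mk, Category.assoc, genIn_cover, pathMap_nil]
        rfl }⟩⟩

instance isIso_nakayama_unit_endoP (F : Paths Q ⥤ B) :
    IsIso ((nakayamaAdjunction Q B).unit.app ((endoP Q B).obj F)) :=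
  isIso_nakayama_unit_shriek _

instance isIso_nakayama_unit_relations (F : Paths Q ⥤ B) :
    IsIso ((nakayamaAdjunction Q B).unit.app ((relations Q B).obj F)) :=
  isIso_nakayama_unit_shriek _

/-- For monic F, ν keeps the standard sequence short exact and ν⁻ is left exact. The unit is
invertible on the two left terms, so an element of F killed by the unit lifts to P(F) and comes from
the relations. -/
lemma IsMonic.mono_unit {F : Paths Q ⥤ B} (hF : IsMonic F) :
    Mono ((nakayamaAdjunction Q B).unit.app F) := by
  have hS : ((standardSeq Q B F).map (nakayama Q B)).ShortExact :=
    nakayama_shortExact (standardSeq_shortExact F) ((isMonic_iff_mono_nakayama F).1 hF)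
  have hS' : (((standardSeq Q B F).map (nakayama Q B)).map (nakayamaRight Q B)).Exact :=
    hS.exact.map_of_mono_of_preservesKernel _ hS.mono_f inferInstance
  refine Preadditive.mono_of_cancel_zero _ fun {Z} (z : Z ⟶ F) hz => ?_
  obtain ⟨A, π, _, y, hy⟩ := surjective_up_to_refinements_of_epi (cover F) z
  have h₁ : (y ≫ (nakayamaAdjunction Q B).unit.app ((endoP Q B).obj F)) ≫
      (nakayamaRight Q B).map ((nakayama Q B).map (cover F)) = 0 := by
    have e := (nakayamaAdjunction Q B).unit.naturality (cover F)
    dsimp at e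
    rw [Category.assoc, ← e, ← Category.assoc, ← hy, Category.assoc]
    exact (congrArg (fun t => π ≫ t) hz).trans comp_zero
  obtain ⟨A', π', _, t, ht⟩ : ∃ (A' : Paths Q ⥤ B) (π' : A' ⟶ A) (_ : Epi π')
      (t : A' ⟶ (nakayama Q B ⋙ nakayamaRight Q B).obj ((relations Q B).obj F)),
      π' ≫ y ≫ (nakayamaAdjunction Q B).unit.app ((endoP Q B).obj F) =
        t ≫ (nakayama Q B ⋙ nakayamaRight Q B).map (relHom F) :=
    hS'.exact_up_to_refinements _ h₁
  have h₂ : π' ≫ y = (t ≫ inv ((nakayamaAdjunction Q B).unit.app ((relations Q B).obj F))) ≫ relHom F := by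
    have e := (nakayamaAdjunction Q B).unit.naturality (relHom F)
    dsimp at e
    rw [← cancel_mono ((nakayamaAdjunction Q B).unit.app ((endoP Q B).obj F)), Category.assoc, ht, Category.assoc,
      Category.assoc, e, IsIso.inv_hom_id_assoc]
    rfl
  rw [← cancel_epi π, ← cancel_epi π', hy, ← Category.assoc, h₂, Category.assoc, relHom_cover]
  simp

/-- The canonical monomorphism `F ⟶ i_*(i^*(F))`. -/
noncomputable def hull (F : Paths Q ⥤ B) : F ⟶ (iLowerStar Q B).obj ((iStar Q B).obj F) :=
  starHomEquiv F ((iStar Q B).obj F) fun _ => 𝟙 _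

instance mono_hull (F : Paths Q ⥤ B) : Mono (hull F) :=
  (mono_iff_comp _).2 fun i => by
    have e : comp (hull F) i ≫ starOut ((iStar Q B).obj F) Quiver.Path.nil = 𝟙 _ :=
      congrFun ((starHomEquiv F ((iStar Q B).obj F)).symm_apply_apply fun _ => 𝟙 _) i
    have : IsSplitMono (comp (hull F) i) := ⟨⟨_, e⟩⟩
    infer_instance

/-- The morphism `F ⟶ P(ν(F))` that corresponds to the canonical map `ν(F) ⟶ i_*(i^*(ν(F)))`. -/
noncomputable def coresolve (F : Paths Q ⥤ B) : F ⟶ (endoP Q B).obj ((nakayama Q B).obj F) :=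
  (nakayamaAdjunction Q B).homEquiv _ _ (hull ((nakayama Q B).obj F)) ≫
    (inv (shriekToNakRightStar ((iStar Q B).obj ((nakayama Q B).obj F))) :
      _ ⟶ (iShriek Q B).obj ((iStar Q B).obj ((nakayama Q B).obj F)))

lemma IsMonic.mono_coresolve {F : Paths Q ⥤ B} (hF : IsMonic F) : Mono (coresolve F) := by
  have := hF.mono_unit
  have h₁ : Mono ((nakayamaAdjunction Q B).homEquiv _ _ (hull ((nakayama Q B).obj F))) := by
    rw [Adjunction.homEquiv_unit]
    infer_instance
  have h₂ : Mono (inv (shriekToNakRightStar ((iStar Q B).obj ((nakayama Q B).obj F))) :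
      _ ⟶ (iShriek Q B).obj ((iStar Q B).obj ((nakayama Q B).obj F))) := inferInstance
  exact @mono_comp _ _ _ _ _ _ h₁ _ h₂

/-- By adjunction, ν(`coresolve`) followed by the isomorphism ν ∘ i_! ≅ i_* is the canonical
monomorphism of ν(F) into i_*i^*ν(F). Monicity of F is not involved. -/
lemma mono_nakayama_coresolve (F : Paths Q ⥤ B) : Mono ((nakayama Q B).map (coresolve F)) := by
  have e : (nakayama Q B).map (coresolve F) ≫
      nakShriekHom ((iStar Q B).obj ((nakayama Q B).obj F)) = hull ((nakayama Q B).obj F) := by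
    refine ((nakayamaAdjunction Q B).homEquiv _ _).injective ?_
    refine ((nakayamaAdjunction Q B).homEquiv_naturality_left _ _).trans ?_
    refine (Category.assoc _ _ _).trans ?_
    exact (congrArg _ (IsIso.inv_hom_id (shriekToNakRightStar ((iStar Q B).obj ((nakayama Q B).obj F))))).trans (Category.comp_id _)
  have : Mono ((nakayama Q B).map (coresolve F) ≫
      nakShriekHom ((iStar Q B).obj ((nakayama Q B).obj F))) := by
    rw [e]
    infer_instance
  exact mono_of_mono _ (nakShriekHom ((iStar Q B).obj ((nakayama Q B).obj F)))

end Homological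

end QuiverRep

namespace RelGorenstein

/-! ### Splicing short exact sequences into a complete resolution -/

section Splicing

variable {A : Type u₁} [Category.{v₁} A] [Abelian A]

/-- There is an exact sequence `0 ⟶ X ⟶ K ⟶ Y ⟶ 0` with `K` a `P`-projective object, which stays
exact under `ν`. -/
def IsSyzygy (P ν : A ⥤ A) [ν.PreservesZeroMorphisms] (X Y : A) : Prop :=
  ∃ (K : A) (f : X ⟶ K) (g : K ⟶ Y) (w : f ≫ g = 0), IsRelProjective P K ∧
    (ShortComplex.mk f g w).ShortExact ∧ ((ShortComplex.mk f g w).map ν).ShortExact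

/-- Choice functions for successors and predecessors are iterated in the two directions from x. -/
lemma exists_int_seq {α : Type*} (R : α → α → Prop) (x : α) (hs : ∀ a, ∃ b, R b a)
    (hp : ∀ a, ∃ b, R a b) : ∃ Z : ℤ → α, Z 1 = x ∧ ∀ n, R (Z (n + 1)) (Z n) := by
  choose s hs using hs
  choose p hp using hp
  let Z : ℤ → α := fun n => match n with
    | Int.ofNat n => s^[n] x
    | Int.negSucc n => p^[n + 1] x
  have hZ : ∀ n, R (Z (n + 1)) (Z n) := by
    rintro (n | n)
    · change R (s^[n + 1] x) (s^[n] x)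
      rw [Function.iterate_succ_apply']
      exact hs _
    · cases n with
      | zero => exact hp x
      | succ n =>
        have e : Int.negSucc (n + 1) + 1 = Int.negSucc n := by omega
        rw [e]
        change R (p^[n + 1] x) (p^[n + 1 + 1] x)
        rw [Function.iterate_succ_apply' p (n + 1)]
        exact hp _
  -- The shift puts x at index 1: with K n between Z (n + 1) and Z n, the kernel of K 0 ⟶ K (-1) is
  -- Z 1.
  refine ⟨fun n => Z (n - 1), rfl, fun n => ?_⟩
  have h := hZ (n - 1)
  rw [sub_add_cancel] at h
  change R (Z (n + 1 - 1)) (Z (n - 1))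
  rwa [add_sub_cancel_right]

/-- Exactness at K depends only on the image of the incoming map and the kernel of the outgoing one;
precomposing with an epimorphism and postcomposing with a monomorphism change neither. -/
lemma exact_splice {X Y K K' K'' : A} {g : K'' ⟶ X} {f : X ⟶ K} {g' : K ⟶ Y} {f' : Y ⟶ K'}
    (w : f ≫ g' = 0) (w' : (g ≫ f) ≫ g' ≫ f' = 0) [Epi g] [Mono f']
    (h : (ShortComplex.mk f g' w).Exact) : (ShortComplex.mk (g ≫ f) (g' ≫ f') w').Exact := by
  let S₁ := ShortComplex.mk (g ≫ f) (g' ≫ f') w'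
  let S₂ := ShortComplex.mk (g ≫ f) g' (by rw [Category.assoc, w, comp_zero])
  let S₃ := ShortComplex.mk f g' w
  let φ : S₂ ⟶ S₁ := { τ₁ := 𝟙 _, τ₂ := 𝟙 _, τ₃ := f' }
  let ψ : S₂ ⟶ S₃ := { τ₁ := g, τ₂ := 𝟙 _, τ₃ := 𝟙 _ }
  have : Epi φ.τ₁ := inferInstanceAs (Epi (𝟙 _))
  have : IsIso φ.τ₂ := inferInstanceAs (IsIso (𝟙 _))
  have : Mono φ.τ₃ := inferInstanceAs (Mono f')
  have : Epi ψ.τ₁ := inferInstanceAs (Epi g)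
  have : IsIso ψ.τ₂ := inferInstanceAs (IsIso (𝟙 _))
  have : Mono ψ.τ₃ := inferInstanceAs (Mono (𝟙 _))
  exact (ShortComplex.exact_iff_of_epi_of_isIso_of_mono φ).1
    ((ShortComplex.exact_iff_of_epi_of_isIso_of_mono ψ).2 h)

lemma isGorensteinProjective_of_seq (P ν : A ⥤ A) [ν.PreservesZeroMorphisms] (Z : ℤ → A)
    (h : ∀ n, IsSyzygy P ν (Z (n + 1)) (Z n)) : IsGorensteinProjective P ν (Z 1) := by
  choose K f g w hK hS hν using h
  have hd : ∀ n, (g (n + 1 + 1) ≫ f (n + 1)) ≫ g (n + 1) ≫ f n = 0 := fun n => by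
    rw [Category.assoc, ← Category.assoc (f (n + 1)), w, zero_comp, comp_zero]
  let C : ChainComplex A ℤ := ChainComplex.of K (fun n => g (n + 1) ≫ f n) hd
  have hC : ∀ n : ℤ, C.d (n + 1) n = g (n + 1) ≫ f n := fun n =>
    ChainComplex.of_d K (fun n => g (n + 1) ≫ f n) n
  have hf : ∀ n, Mono (f n) := fun n => (hS n).mono_f
  have hg : ∀ n, Epi (g n) := fun n => (hS n).epi_g
  have hf' : ∀ n, Mono (ν.map (f n)) := fun n => (hν n).mono_f
  have hg' : ∀ n, Epi (ν.map (g n)) := fun n => (hν n).epi_g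
  refine ⟨C, hK, fun m => ?_, fun m => ?_, ?_⟩
  · obtain ⟨n, rfl⟩ : ∃ n, m = n + 1 := ⟨m - 1, by omega⟩
    rw [HomologicalComplex.exactAt_iff' _ (n + 1 + 1) (n + 1) n (by simp) (by simp)]
    have e : C.sc' (n + 1 + 1) (n + 1) n =
        ShortComplex.mk (g (n + 1 + 1) ≫ f (n + 1)) (g (n + 1) ≫ f n) (hd n) := by
      dsimp only [HomologicalComplex.sc', HomologicalComplex.shortComplexFunctor']
      congr 1 <;> exact hC _
    rw [e]
    exact exact_splice (w (n + 1)) (hd n) (hS (n + 1)).exact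
  · obtain ⟨n, rfl⟩ : ∃ n, m = n + 1 := ⟨m - 1, by omega⟩
    rw [HomologicalComplex.exactAt_iff' _ (n + 1 + 1) (n + 1) n (by simp) (by simp)]
    have hd' : (ν.map (g (n + 1 + 1)) ≫ ν.map (f (n + 1))) ≫
        ν.map (g (n + 1)) ≫ ν.map (f n) = 0 := by
      rw [← ν.map_comp, ← ν.map_comp, ← ν.map_comp, hd, ν.map_zero]
    have e : ((ν.mapHomologicalComplex (ComplexShape.down ℤ)).obj C).sc' (n + 1 + 1) (n + 1) n =
        ShortComplex.mk (ν.map (g (n + 1 + 1)) ≫ ν.map (f (n + 1)))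
          (ν.map (g (n + 1)) ≫ ν.map (f n)) hd' := by
      dsimp only [HomologicalComplex.sc', HomologicalComplex.shortComplexFunctor']
      congr 1
      · exact (congrArg ν.map (hC _)).trans (ν.map_comp _ _)
      · exact (congrArg ν.map (hC _)).trans (ν.map_comp _ _)
    rw [e]
    exact exact_splice _ hd' (hν (n + 1)).exact
  -- Variable indices allow `a = b + 1` to be substituted, so that the differential from 0 to -1
  -- needs no casts. Its kernel is that of `g`, as `f` is a monomorphism.
  · have key : ∀ a b : ℤ, a = b + 1 → Nonempty (Z (b + 1 + 1) ≅ kernel (C.d a b)) := by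
      rintro _ b rfl
      exact ⟨IsLimit.conePointUniqueUpToIso (hS (b + 1)).fIsKernel (kernelIsKernel (g (b + 1))) ≪≫
        (kernelCompMono (g (b + 1)) (f b)).symm ≪≫ kernelIsoOfEq (hC b).symm⟩
    exact key 0 (-1) (by norm_num)

end Splicing

end RelGorenstein

namespace QuiverRep

/-! ### Monic representations are the Gorenstein P-projectives -/

section Gorenstein

variable {Q : Type u} [Quiver.{v} Q] [LocallyBoundedQuiver Q]
  {B : Type u₁} [Category.{v₁} B] [Abelian B]

open RelGorenstein

lemma isSyzygy_relations {F : Paths Q ⥤ B} (hF : IsMonic F) :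
    IsSyzygy (endoP Q B) (nakayama Q B) ((relations Q B).obj F) F :=
  ⟨_, _, _, relHom_cover F, isRelProjective_shriek _, standardSeq_shortExact F,
    nakayama_shortExact (standardSeq_shortExact F) ((isMonic_iff_mono_nakayama F).1 hF)⟩

/-- `coresolve` and its image under ν are monomorphisms, so the cokernel is again monic by
`isMonic_X₃` and the step can be repeated. -/
lemma exists_isSyzygy {F : Paths Q ⥤ B} (hF : IsMonic F) :
    ∃ G : Paths Q ⥤ B, IsMonic G ∧ IsSyzygy (endoP Q B) (nakayama Q B) F G := by
  have := hF.mono_coresolve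
  have hS : (ShortComplex.mk (coresolve F) (cokernel.π (coresolve F))
      (cokernel.condition _)).ShortExact :=
    { exact := ShortComplex.exact_of_g_is_cokernel _ (cokernelIsCokernel _)
      mono_f := this
      epi_g := inferInstanceAs (Epi (cokernel.π (coresolve F))) }
  exact ⟨cokernel (coresolve F), isMonic_X₃ hS (isMonic_shriek _) (mono_nakayama_coresolve F),
    _, _, _, cokernel.condition _, isRelProjective_shriek _, hS,
    nakayama_shortExact hS (mono_nakayama_coresolve F)⟩

/-- A representation is monic if and only if it is Gorenstein `P`-projective. -/
theorem isMonic_iff_isGorensteinProjective (F : Paths Q ⥤ B) :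
    IsMonic F ↔ IsGorensteinProjective (endoP Q B) (nakayama Q B) F := by
  constructor
  · intro hF
    -- Both continuations stay among the monic representations: to the left the relations are a
    -- value of i_!, to the right the cokernel of `coresolve` is monic.
    obtain ⟨Z, h₁, hZ⟩ := exists_int_seq
      (fun F G : { F : Paths Q ⥤ B // IsMonic F } =>
        IsSyzygy (endoP Q B) (nakayama Q B) F.1 G.1) ⟨F, hF⟩
      (fun F => ⟨⟨_, isMonic_shriek _⟩, isSyzygy_relations F.2⟩)
      (fun F => by
        obtain ⟨G, hG, h⟩ := exists_isSyzygy F.2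
        exact ⟨⟨G, hG⟩, h⟩)
    have h := isGorensteinProjective_of_seq _ _ (fun n => (Z n).1) hZ
    rwa [h₁] at h
  -- Only the embedding in the P-projective object K₀ matters; neither exactness condition is
  -- needed.
  · rintro ⟨K, hK, -, -, ⟨e⟩⟩
    exact isMonic_of_mono (e.hom ≫ kernel.ι (K.d 0 (-1))) (isMonic_of_isRelProjective (hK 0))

end Gorenstein

end QuiverRep

/-! ### Derived functors and extensions read off from resolutions -/

section DerivedFunctors

variable {C D : Type*} [Category* C] [Category* D] [Abelian C] [Abelian D]

lemma isZero_leftDerived_succ_iff [HasProjectiveResolutions C] (T : C ⥤ D) [T.Additive] {X : C}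
    (P : ProjectiveResolution X) (n : ℕ) :
    IsZero ((T.leftDerived (n + 1)).obj X) ↔
      (ShortComplex.mk (T.map (P.complex.d (n + 2) (n + 1))) (T.map (P.complex.d (n + 1) n))
        (by rw [← T.map_comp, HomologicalComplex.d_comp_d, T.map_zero])).Exact := by
  rw [(P.isoLeftDerivedObj T (n + 1)).isZero_iff]
  exact (HomologicalComplex.exactAt_iff_isZero_homology _ _).symm.trans
    (HomologicalComplex.exactAt_iff' _ (n + 2) (n + 1) n (by simp) (by simp))

lemma isZero_rightDerived_succ_iff [HasInjectiveResolutions C] (T : C ⥤ D) [T.Additive] {X : C}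
    (I : InjectiveResolution X) (n : ℕ) :
    IsZero ((T.rightDerived (n + 1)).obj X) ↔
      (ShortComplex.mk (T.map (I.cocomplex.d n (n + 1))) (T.map (I.cocomplex.d (n + 1) (n + 2)))
        (by rw [← T.map_comp, HomologicalComplex.d_comp_d, T.map_zero])).Exact := by
  rw [(I.isoRightDerivedObj T (n + 1)).isZero_iff]
  exact (HomologicalComplex.exactAt_iff_isZero_homology _ _).symm.trans
    (HomologicalComplex.exactAt_iff' _ n (n + 1) (n + 2) (by simp) (by simp))

/-- This is vanishing of Ext in degree at least 2 out of an object with a projective resolution of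
length one. A lift y of the cocycle to X₂ is corrected by extending its obstruction on X₁ along f,
using injectivity of I₀, so that it descends to X₃. -/
lemma exists_lift_of_projective_resolution {S : ShortComplex C} (hS : S.ShortExact)
    [Projective S.X₁] [Projective S.X₂] {I₀ I₁ I₂ I₃ : C} [Injective I₀] {d₀ : I₀ ⟶ I₁}
    {d₁ : I₁ ⟶ I₂} {d₂ : I₂ ⟶ I₃} {w₁ : d₀ ≫ d₁ = 0} {w₂ : d₁ ≫ d₂ = 0}
    (h₁ : (ShortComplex.mk d₀ d₁ w₁).Exact) (h₂ : (ShortComplex.mk d₁ d₂ w₂).Exact)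
    (a : S.X₃ ⟶ I₂) (ha : a ≫ d₂ = 0) : ∃ b : S.X₃ ⟶ I₁, b ≫ d₁ = a := by
  have := hS.mono_f
  have := hS.epi_g
  obtain ⟨y, hy⟩ : ∃ y : S.X₂ ⟶ I₁, y ≫ d₁ = S.g ≫ a :=
    ⟨h₂.liftFromProjective (S.g ≫ a) (by dsimp; rw [Category.assoc, ha, comp_zero]),
      h₂.liftFromProjective_comp _ _⟩
  have hy₀ : (S.f ≫ y) ≫ d₁ = 0 := by
    rw [Category.assoc, hy, ← Category.assoc, S.zero, zero_comp]
  obtain ⟨z, hz⟩ : ∃ z : S.X₁ ⟶ I₀, z ≫ d₀ = S.f ≫ y :=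
    ⟨h₁.liftFromProjective (S.f ≫ y) hy₀, h₁.liftFromProjective_comp _ _⟩
  have hw : S.f ≫ (y - Injective.factorThru z S.f ≫ d₀) = 0 := by
    rw [Preadditive.comp_sub, ← Category.assoc, Injective.comp_factorThru, hz, sub_self]
  refine ⟨hS.exact.desc _ hw, ?_⟩
  rw [← cancel_epi S.g, ← Category.assoc, hS.exact.g_desc, Preadditive.sub_comp, hy,
    Category.assoc, w₁, comp_zero, sub_zero]

/-- The hypothesis says that Ext¹(X₃, X₁), computed by I, vanishes. Extending X₁ ⟶ I⁰ over X₂ and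
applying the differential gives the cocycle of the extension S; trivialising it corrects the
extended map into one landing in X₁. -/
lemma exists_retraction_of_injective_resolution {S : ShortComplex C} (hS : S.ShortExact)
    (I : InjectiveResolution S.X₁)
    (h : ∀ a : S.X₃ ⟶ I.cocomplex.X 1, a ≫ I.cocomplex.d 1 2 = 0 →
      ∃ b : S.X₃ ⟶ I.cocomplex.X 0, b ≫ I.cocomplex.d 0 1 = a) :
    ∃ r : S.X₂ ⟶ S.X₁, S.f ≫ r = 𝟙 S.X₁ := by
  have := hS.mono_f
  have := hS.epi_g
  obtain ⟨ι, hm, w, hι⟩ : ∃ (ι : S.X₁ ⟶ I.cocomplex.X 0) (_ : Mono ι)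
      (w : ι ≫ I.cocomplex.d 0 1 = 0), (ShortComplex.mk ι (I.cocomplex.d 0 1) w).Exact :=
    ⟨I.ι.f 0, inferInstanceAs (Mono (I.ι.f 0)), I.ι_f_zero_comp_complex_d, I.exact₀⟩
  have he : S.f ≫ Injective.factorThru ι S.f ≫ I.cocomplex.d 0 1 = 0 := by
    rw [← Category.assoc, Injective.comp_factorThru, w]
  obtain ⟨b, hb⟩ := h (hS.exact.desc _ he) (by
    rw [← cancel_epi S.g, ← Category.assoc, hS.exact.g_desc, Category.assoc,
      HomologicalComplex.d_comp_d, comp_zero, comp_zero])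
  have hr : (Injective.factorThru ι S.f - S.g ≫ b) ≫ I.cocomplex.d 0 1 = 0 := by
    rw [Preadditive.sub_comp, Category.assoc, hb, hS.exact.g_desc, sub_self]
  have : Mono (ShortComplex.mk ι (I.cocomplex.d 0 1) w).f := hm
  have hl : hι.lift _ hr ≫ ι = _ := hι.lift_f _ hr
  refine ⟨hι.lift _ hr, ?_⟩
  rw [← cancel_mono ι, Category.assoc, hl, Preadditive.comp_sub, Injective.comp_factorThru,
    ← Category.assoc, S.zero, zero_comp, sub_zero, Category.id_comp]

lemma shortExact_coimage {X Y : C} (h : X ⟶ Y) :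
    (ShortComplex.mk (kernel.ι h) (cokernel.π (kernel.ι h)) (cokernel.condition _)).ShortExact where
  exact := ShortComplex.exact_of_g_is_cokernel _ (cokernelIsCokernel _)
  mono_f := inferInstanceAs (Mono (kernel.ι h))
  epi_g := inferInstanceAs (Epi (cokernel.π (kernel.ι h)))

/-- The map g factors through the kernel of h by an epimorphism, and right exactness of T preserves
the resulting sequence X ⟶ Y ⟶ ker h. Only injectivity of T(ker h) ⟶ T(Z) is missing. -/
lemma map_exact_of_mono_map_kernel (T : C ⥤ D) [T.PreservesZeroMorphisms] [T.IsLeftAdjoint]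
    {X Y Z W : C} {f : X ⟶ Y} {g : Y ⟶ Z} {h : Z ⟶ W}
    {w₁ : f ≫ g = 0} {w₂ : g ≫ h = 0} (h₁ : (ShortComplex.mk f g w₁).Exact)
    (h₂ : (ShortComplex.mk g h w₂).Exact) (hι : Mono (T.map (kernel.ι h)))
    (w : T.map f ≫ T.map g = 0) : (ShortComplex.mk (T.map f) (T.map g) w).Exact := by
  have hp : Epi (kernel.lift h g w₂) := h₂.epi_kernelLift
  have w₃ : f ≫ kernel.lift h g w₂ = 0 := by
    rw [← cancel_mono (kernel.ι h), Category.assoc, kernel.lift_ι, w₁, zero_comp]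
  have h₃ : (ShortComplex.mk f (kernel.lift h g w₂) w₃).Exact :=
    (ShortComplex.exact_iff_of_epi_of_isIso_of_mono
      (S₁ := ShortComplex.mk f (kernel.lift h g w₂) w₃) (S₂ := ShortComplex.mk f g w₁)
      { τ₁ := 𝟙 _, τ₂ := 𝟙 _, τ₃ := kernel.ι h }).2 h₁
  have h₄ : (ShortComplex.mk (T.map f) (T.map (kernel.lift h g w₂))
      (by rw [← Functor.map_comp, w₃, Functor.map_zero])).Exact :=
    h₃.map_of_epi_of_preservesCokernel T hp inferInstance
  refine (ShortComplex.exact_iff_of_epi_of_isIso_of_mono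
    (S₁ := ShortComplex.mk (T.map f) (T.map (kernel.lift h g w₂)) _) (S₂ := ShortComplex.mk _ _ w)
    { τ₁ := 𝟙 _, τ₂ := 𝟙 _, τ₃ := T.map (kernel.ι h), comm₂₃ := ?_ }).1 h₄
  dsimp
  rw [Category.id_comp, ← Functor.map_comp, kernel.lift_ι]

lemma projective_biproduct {ι : Type*} [Finite ι] (X : ι → C) (hX : ∀ i, Projective (X i)) :
    Projective (⨁ X) where
  factors f e he := ⟨biproduct.desc fun i => Projective.factorThru (biproduct.ι X i ≫ f) e, by
    refine biproduct.hom_ext' _ _ fun i => ?_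
    rw [← Category.assoc, biproduct.ι_desc, Projective.factorThru_comp]⟩

end DerivedFunctors

namespace QuiverRep

/-! ### Derived functors of ν and ν⁻ -/

section DerivedNakayama

variable {Q : Type u} [Quiver.{v} Q] [LocallyBoundedQuiver Q]
  {B : Type u₁} [Category.{v₁} B] [Abelian B]

/-- The coimage of h embeds in W and is therefore monic, so ν preserves the monomorphism ker h ⟶ Z.
-/
lemma exact_nakayama_map {X Y Z W : Paths Q ⥤ B} {f : X ⟶ Y} {g : Y ⟶ Z} {h : Z ⟶ W}
    {w₁ : f ≫ g = 0} {w₂ : g ≫ h = 0} (h₁ : (ShortComplex.mk f g w₁).Exact)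
    (h₂ : (ShortComplex.mk g h w₂).Exact) (hW : IsMonic W)
    (w : (nakayama Q B).map f ≫ (nakayama Q B).map g = 0) :
    (ShortComplex.mk ((nakayama Q B).map f) ((nakayama Q B).map g) w).Exact := by
  have hc : IsMonic (Abelian.coimage h) := isMonic_of_mono (Abelian.factorThruCoimage h) hW
  have hι : Mono ((nakayama Q B).map (kernel.ι h)) :=
    mono_nakayama_map (S := ShortComplex.mk (kernel.ι h) (cokernel.π (kernel.ι h))
      (cokernel.condition _)) (shortExact_coimage h) hc
  exact map_exact_of_mono_map_kernel (nakayama Q B) h₁ h₂ hι w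

lemma isMonic_of_projective (F : Paths Q ⥤ B) [Projective F] : IsMonic F :=
  isMonic_of_section (Projective.factorThru (𝟙 F) (cover F)) (Projective.factorThru_comp _ _)

section Left

variable [HasProjectiveResolutions (Paths Q ⥤ B)]

/-- In degree n + 2 the resolution continues to the projective, hence monic, term Pₙ, which plays
the role of W in `exact_nakayama_map`. -/
lemma isZero_leftDerived_nakayama (n : ℕ) : IsZero ((nakayama Q B).leftDerived (n + 2)) := by
  refine (Functor.isZero_iff _).2 fun F => ?_
  obtain ⟨P⟩ := (HasProjectiveResolutions.out F).out
  exact (isZero_leftDerived_succ_iff _ P (n + 1)).2 (exact_nakayama_map (P.exact_succ (n + 1))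
    (P.exact_succ n) (isMonic_of_projective _) _)

/-- In degree 1 the object F itself plays the role of W. Conversely, exactness at ν(P₁) makes ν(ker
π) ⟶ ν(P₀) a monomorphism, and `isMonic_X₃` applies. -/
lemma isMonic_iff_isZero_leftDerived (F : Paths Q ⥤ B) :
    IsMonic F ↔ IsZero (((nakayama Q B).leftDerived 1).obj F) := by
  obtain ⟨P⟩ := (HasProjectiveResolutions.out F).out
  obtain ⟨π, hπ, w, h⟩ : ∃ (π : P.complex.X 0 ⟶ F) (_ : Epi π) (w : P.complex.d 1 0 ≫ π = 0),
      (ShortComplex.mk (P.complex.d 1 0) π w).Exact :=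
    ⟨P.π.f 0, inferInstanceAs (Epi (P.π.f 0)), P.complex_d_comp_π_f_zero, P.exact₀⟩
  rw [isZero_leftDerived_succ_iff _ P 0]
  refine ⟨fun hF => exact_nakayama_map (P.exact_succ 0) h hF _, fun h₀ => ?_⟩
  have hS : (ShortComplex.mk (kernel.ι π) π (kernel.condition π)).ShortExact :=
    { exact := ShortComplex.exact_of_f_is_kernel _ (kernelIsKernel _)
      mono_f := inferInstanceAs (Mono (kernel.ι π))
      epi_g := hπ }
  refine isMonic_X₃ hS (isMonic_of_projective (P.complex.X 0)) ?_
  let p : P.complex.X 1 ⟶ kernel π := kernel.lift π (P.complex.d 1 0) w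
  have hp : Epi p := h.epi_kernelLift
  have hpι : (nakayama Q B).map p ≫ (nakayama Q B).map (kernel.ι π) =
      (nakayama Q B).map (P.complex.d 1 0) := by
    rw [← Functor.map_comp, kernel.lift_ι]
  have hpd : P.complex.d 2 1 ≫ p = 0 := by
    rw [← cancel_mono (kernel.ι π), Category.assoc, kernel.lift_ι, HomologicalComplex.d_comp_d,
      zero_comp]
  change Mono ((nakayama Q B).map (kernel.ι π))
  refine Preadditive.mono_of_cancel_zero _ fun {Z} z hz => ?_
  obtain ⟨A, q, _, y, hy⟩ := surjective_up_to_refinements_of_epi ((nakayama Q B).map p) z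
  have h₁ : y ≫ (nakayama Q B).map (P.complex.d 1 0) = 0 := by
    rw [← hpι, ← Category.assoc, ← hy, Category.assoc, hz, comp_zero]
  obtain ⟨A', q', _, t, ht⟩ : ∃ (A' : Paths Q ⥤ B) (q' : A' ⟶ A) (_ : Epi q')
      (t : A' ⟶ (nakayama Q B).obj (P.complex.X 2)),
      q' ≫ y = t ≫ (nakayama Q B).map (P.complex.d 2 1) := h₀.exact_up_to_refinements y h₁
  rw [← cancel_epi q, ← cancel_epi q', hy, ← Category.assoc, ht, Category.assoc,
    ← Functor.map_comp, hpd, Functor.map_zero, comp_zero, comp_zero, comp_zero]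

end Left

lemma projective_shriek {X : Q → B} (hX : ∀ i, Projective (X i)) :
    Projective ((iShriek Q B).obj X) where
  factors {E G} f e he := by
    have he' : ∀ i : Q, Epi (comp e i) := (epi_iff_comp e).1 he
    refine ⟨shriekMk fun i =>
      Projective.factorThru (shriekIn X Quiver.Path.nil ≫ comp f i) (comp e i),
      shriekMk_ext fun i => ?_⟩
    rw [comp_comp, ← Category.assoc, shriekIn_nil_mk, Projective.factorThru_comp]

lemma projective_vert_star {X : Q → B} (hX : ∀ i, Projective (X i)) (i : Q) :
    Projective (vert ((iLowerStar Q B).obj X) i) :=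
  projective_biproduct (fun p : PathsFrom i => X p.1) fun p => hX p.1

lemma projective_endoP {F : Paths Q ⥤ B} (hF : ∀ i, Projective (vert F i)) :
    Projective ((endoP Q B).obj F) :=
  projective_shriek hF

lemma projective_relations {F : Paths Q ⥤ B} (hF : ∀ i, Projective (vert F i)) :
    Projective ((relations Q B).obj F) :=
  projective_shriek (X := (sumTo Q B).obj ((iStar Q B).obj F)) fun j =>
    projective_biproduct (fun α : (Σ i : Q, (i ⟶ j)) => vert F α.1) fun α => hF α.1

lemma exists_shriek_cover [EnoughProjectives B] (F : Paths Q ⥤ B) :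
    ∃ (X : Q → B) (_ : ∀ i, Projective (X i)) (π : (iShriek Q B).obj X ⟶ F), Epi π := by
  refine ⟨fun i => Projective.over (vert F i), fun i => inferInstance,
    shriekMk fun i => Projective.π (vert F i), (epi_iff_comp _).2 fun i => ?_⟩
  have h := shriekIn_nil_mk (fun i => Projective.π (vert F i)) i
  exact epi_of_epi_fac h

/-- Morphisms `i_*(X) ⟶ G` correspond to morphisms `i_!(X) ⟶ ν⁻(G)`. -/
noncomputable def starNakRightEquiv (X : Q → B) (G : Paths Q ⥤ B) :
    ((iLowerStar Q B).obj X ⟶ G) ≃ ((iShriek Q B).obj X ⟶ (nakayamaRight Q B).obj G) :=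
  ((asIso (nakShriekHom X)).symm.homCongr (Iso.refl G)).trans
    ((nakayamaAdjunction Q B).homEquiv _ _)

lemma starNakRightEquiv_comp {X : Q → B} {G H : Paths Q ⥤ B} (a : (iLowerStar Q B).obj X ⟶ G)
    (f : G ⟶ H) :
    starNakRightEquiv X H (a ≫ f) = starNakRightEquiv X G a ≫ (nakayamaRight Q B).map f := by
  refine Eq.trans ?_ ((nakayamaAdjunction Q B).homEquiv_naturality_right _ f)
  refine congrArg ((nakayamaAdjunction Q B).homEquiv _ _) ?_
  simp

lemma starNakRightEquiv_zero (X : Q → B) (G : Paths Q ⥤ B) : starNakRightEquiv X G 0 = 0 := by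
  have h := starNakRightEquiv_comp (0 : (iLowerStar Q B).obj X ⟶ G) (0 : G ⟶ G)
  rwa [Functor.map_zero, comp_zero, comp_zero] at h

/-- The i_!(X) with X projective at each vertex are projective and cover every representation, so
they detect exactness; and maps i_!(X) ⟶ ν⁻(G) are maps i_*(X) ⟶ G. Thus Rⁱν⁻ is controlled by the
extensions out of the i_*(X). -/
lemma exact_nakayamaRight_map_iff [EnoughProjectives B] {G₀ G₁ G₂ : Paths Q ⥤ B} {f : G₀ ⟶ G₁}
    {g : G₁ ⟶ G₂} (w : (nakayamaRight Q B).map f ≫ (nakayamaRight Q B).map g = 0) :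
    (ShortComplex.mk ((nakayamaRight Q B).map f) ((nakayamaRight Q B).map g) w).Exact ↔
      ∀ X : Q → B, (∀ i, Projective (X i)) → ∀ a : (iLowerStar Q B).obj X ⟶ G₁, a ≫ g = 0 →
        ∃ b : (iLowerStar Q B).obj X ⟶ G₀, b ≫ f = a := by
  constructor
  · intro h X hX a ha
    have := projective_shriek hX
    have ha' : starNakRightEquiv X G₁ a ≫ (nakayamaRight Q B).map g = 0 := by
      rw [← starNakRightEquiv_comp, ha, starNakRightEquiv_zero]
    have hy : h.liftFromProjective (starNakRightEquiv X G₁ a) ha' ≫ (nakayamaRight Q B).map f =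
      starNakRightEquiv X G₁ a := h.liftFromProjective_comp _ _
    refine ⟨(starNakRightEquiv X G₀).symm (h.liftFromProjective _ ha'),
      (starNakRightEquiv X G₁).injective ?_⟩
    rw [starNakRightEquiv_comp, Equiv.apply_symm_apply]
    exact hy
  · intro h
    rw [ShortComplex.exact_iff_exact_up_to_refinements]
    intro A (x : A ⟶ (nakayamaRight Q B).obj G₁) (hx : x ≫ (nakayamaRight Q B).map g = 0)
    obtain ⟨X, hX, π, hπ⟩ := exists_shriek_cover A
    obtain ⟨b, hb⟩ := h X hX ((starNakRightEquiv X G₁).symm (π ≫ x))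
      ((starNakRightEquiv X G₂).injective (by
        rw [starNakRightEquiv_comp, Equiv.apply_symm_apply, Category.assoc, hx, comp_zero,
          starNakRightEquiv_zero]))
    refine ⟨_, π, hπ, starNakRightEquiv X G₀ b, ?_⟩
    change π ≫ x = starNakRightEquiv X G₀ b ≫ (nakayamaRight Q B).map f
    rw [← starNakRightEquiv_comp, hb, Equiv.apply_symm_apply]

section Right

variable [EnoughProjectives B] [HasInjectiveResolutions (Paths Q ⥤ B)]

/-- The values of i_*(X) are finite sums of projectives, so the standard sequence of i_*(X) is a
projective resolution of length one. -/
lemma isZero_rightDerived_nakayamaRight (n : ℕ) :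
    IsZero ((nakayamaRight Q B).rightDerived (n + 2)) := by
  refine (Functor.isZero_iff _).2 fun F => ?_
  obtain ⟨I⟩ := (HasInjectiveResolutions.out F).out
  refine (isZero_rightDerived_succ_iff _ I (n + 1)).2
    ((exact_nakayamaRight_map_iff _).2 fun X hX a ha => ?_)
  have : Projective (standardSeq Q B ((iLowerStar Q B).obj X)).X₁ :=
    projective_relations (projective_vert_star hX)
  have : Projective (standardSeq Q B ((iLowerStar Q B).obj X)).X₂ :=
    projective_endoP (projective_vert_star hX)
  exact exists_lift_of_projective_resolution (standardSeq_shortExact ((iLowerStar Q B).obj X))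
    (I.exact_succ n) (I.exact_succ (n + 1)) a ha

/-- Vanishing of R¹ν⁻ at the relations of i_*(X) kills the extension class of the standard sequence
of i_*(X), which therefore splits. -/
lemma isMonic_star_of_isZero_rightDerived {X : Q → B} (hX : ∀ i, Projective (X i))
    (h : IsZero (((nakayamaRight Q B).rightDerived 1).obj
      ((relations Q B).obj ((iLowerStar Q B).obj X)))) : IsMonic ((iLowerStar Q B).obj X) := by
  obtain ⟨I⟩ := (HasInjectiveResolutions.out
    ((relations Q B).obj ((iLowerStar Q B).obj X))).out
  obtain ⟨r, hr⟩ := exists_retraction_of_injective_resolution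
    (standardSeq_shortExact ((iLowerStar Q B).obj X)) I
    ((exact_nakayamaRight_map_iff _).1 ((isZero_rightDerived_succ_iff _ I 0).1 h) X hX)
  let s := ShortComplex.Splitting.ofExactOfRetraction _
    (standardSeq_exact ((iLowerStar Q B).obj X)) r hr (epi_cover _)
  exact isMonic_of_section s.s s.s_g

end Right

end DerivedNakayama

end QuiverRep
namespace QuiverRep

open RelGorenstein

/-! ### The Gorenstein dimension -/

section GorensteinDimension

variable {Q : Type u} [Quiver.{v} Q] [LocallyBoundedQuiver Q]
  {B : Type u₁} [Category.{v₁} B] [Abelian B]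

lemma resolutionDim_le {F : Paths Q ⥤ B} {n : ℕ}
    (h : HasResolutionOfLength (IsGorensteinProjective (endoP Q B) (nakayama Q B)) n F) :
    resolutionDim (IsGorensteinProjective (endoP Q B) (nakayama Q B)) F ≤ n :=
  iInf_le (fun n : {n : ℕ // HasResolutionOfLength _ n F} => ((n : ℕ) : ℕ∞)) ⟨n, h⟩

lemma hasResolutionOfLength_zero_iff (F : Paths Q ⥤ B) :
    HasResolutionOfLength (IsGorensteinProjective (endoP Q B) (nakayama Q B)) 0 F ↔
      IsMonic F := by
  constructor
  · rintro ⟨G, hG, ⟨e⟩⟩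
    exact isMonic_of_mono e.inv ((isMonic_iff_isGorensteinProjective G).2 hG)
  · exact fun hF => ⟨F, (isMonic_iff_isGorensteinProjective F).1 hF, ⟨Iso.refl F⟩⟩

/-- The standard sequence is itself such a resolution, since both left terms are values of i_!. -/
lemma hasResolutionOfLength_one (F : Paths Q ⥤ B) :
    HasResolutionOfLength (IsGorensteinProjective (endoP Q B) (nakayama Q B)) 1 F :=
  ⟨standardSeq Q B F, standardSeq_shortExact F,
    (isMonic_iff_isGorensteinProjective _).1 (isMonic_shriek _), ⟨Iso.refl F⟩,
    (hasResolutionOfLength_zero_iff _).2 (isMonic_shriek _)⟩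

lemma globalResolutionDim_eq_zero (h : ∀ F : Paths Q ⥤ B, IsMonic F) :
    globalResolutionDim (IsGorensteinProjective (endoP Q B) (nakayama Q B)) = 0 :=
  le_antisymm (iSup_le fun F => resolutionDim_le ((hasResolutionOfLength_zero_iff F).2 (h F)))
    zero_le

lemma globalResolutionDim_eq_one {F : Paths Q ⥤ B} (hF : ¬ IsMonic F) :
    globalResolutionDim (IsGorensteinProjective (endoP Q B) (nakayama Q B)) = 1 := by
  refine le_antisymm (iSup_le fun G => resolutionDim_le (hasResolutionOfLength_one G))
    (le_trans (le_iInf ?_) (le_iSup (resolutionDim _) F))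
  rintro ⟨_ | n, hn⟩
  · exact absurd ((hasResolutionOfLength_zero_iff F).1 hn) hF
  · exact_mod_cast Nat.succ_le_succ (Nat.zero_le n)

lemma isMonic_of_isZero_relations {F : Paths Q ⥤ B} (h : IsZero ((relations Q B).obj F)) :
    IsMonic F :=
  (isMonic_iff_mono_nakayama F).2 ⟨fun _ _ _ => ((nakayama Q B).map_isZero h).eq_of_tgt _ _⟩

lemma isIso_cover_of_isZero_relations {F : Paths Q ⥤ B} (h : IsZero ((relations Q B).obj F)) :
    IsIso (cover F) := by
  have : Mono (cover F) := (standardSeq_exact F).mono_g (h.eq_of_src _ _)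
  exact isIso_of_mono_of_epi (cover F)

/-- With X concentrated at i, the arrow α acts as zero on i_*(X): a nonzero component would need a
path from j back to i, giving an oriented cycle. Yet X(i) is a nonzero summand of i_*(X)(i), so α
cannot act injectively. -/
lemma not_isMonic_star {X : Q → B} {i j : Q} (α : i ⟶ j) (hi : ¬ IsZero (X i))
    (h : ∀ c, c ≠ i → IsZero (X c)) : ¬ IsMonic ((iLowerStar Q B).obj X) := by
  intro hM
  have h₀ : arr ((iLowerStar Q B).obj X) α = 0 := star_hom_ext' fun {c} p => by
    rw [arr_starOut, zero_comp]
    by_cases hc : c = i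
    · subst hc
      have := congrArg Quiver.Path.length (path_self_eq_nil (α.toPath.comp p))
      simp [Quiver.Path.length_comp, Quiver.Hom.toPath] at this
    · exact (h c hc).eq_of_tgt _ _
  have := (isMonic_iff _).1 hM j
  have : IsSplitMono (srcIn ((iLowerStar Q B).obj X) α) := ⟨⟨_, srcIn_out_self _ α⟩⟩
  have hm : Mono (srcIn ((iLowerStar Q B).obj X) α ≫ srcDesc ((iLowerStar Q B).obj X) j) :=
    inferInstance
  rw [srcIn_desc, h₀] at hm
  have h₁ : IsZero (vert ((iLowerStar Q B).obj X) i) := 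
    @IsZero.of_mono_zero _ _ _ _ (vert ((iLowerStar Q B).obj X) j) hm
  refine hi ((IsZero.iff_id_eq_zero _).2 ?_)
  rw [← starIn_out_self X (Quiver.Path.nil : Quiver.Path i i), h₁.eq_of_tgt (starIn X _) 0,
    zero_comp]

variable [EnoughProjectives B] [EnoughInjectives B]

lemma isZero_derived_of_one_lt {i : ℕ} (hi : 1 < i) :
    IsZero ((nakayama Q B).leftDerived i) ∧ IsZero ((nakayamaRight Q B).rightDerived i) := by
  obtain ⟨n, rfl⟩ : ∃ n, i = n + 2 := ⟨i - 2, by omega⟩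
  exact ⟨isZero_leftDerived_nakayama n, isZero_rightDerived_nakayamaRight n⟩

lemma isGorensteinOfDim_one {X : Q → B} (hX : ∀ i, Projective (X i))
    (h : ¬ IsMonic ((iLowerStar Q B).obj X)) :
    IsGorensteinOfDim (endoP Q B) (nakayama Q B) (nakayamaRight Q B) 1 where
  isIwanagaGorenstein := ⟨1, fun _ => isZero_derived_of_one_lt⟩
  globalResolutionDim_eq := by exact_mod_cast globalResolutionDim_eq_one h
  isLeast_leftDerived := ⟨fun _ hi => (isZero_derived_of_one_lt hi).1, fun r hr =>
    -- The bound 0 would force the first derived functor to vanish, making i_*(X) monic; the same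
    -- applies to ν⁻ below.
    Nat.one_le_iff_ne_zero.2 fun h₀ => h ((isMonic_iff_isZero_leftDerived _).2
      ((hr 1 (by omega)).obj _))⟩
  isLeast_rightDerived := ⟨fun _ hi => (isZero_derived_of_one_lt hi).2, fun r hr =>
    Nat.one_le_iff_ne_zero.2 fun h₀ => h (isMonic_star_of_isZero_rightDerived hX
      ((hr 1 (by omega)).obj _))⟩

lemma isZero_derived_of_isZero_relations (h : ∀ F : Paths Q ⥤ B, IsZero ((relations Q B).obj F))
    {i : ℕ} (hi : 0 < i) :
    IsZero ((nakayama Q B).leftDerived i) ∧ IsZero ((nakayamaRight Q B).rightDerived i) := by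
  obtain rfl | hi := Nat.eq_or_lt_of_le (Nat.succ_le_of_lt hi)
  · refine ⟨(Functor.isZero_iff _).2 fun F => (isMonic_iff_isZero_leftDerived F).1
      (isMonic_of_isZero_relations (h F)), (Functor.isZero_iff _).2 fun F => ?_⟩
    obtain ⟨I⟩ := (HasInjectiveResolutions.out F).out
    refine (isZero_rightDerived_succ_iff _ I 0).2
      ((exact_nakayamaRight_map_iff _).2 fun X hX a ha => ?_)
    -- Without relations i_*(X) is isomorphic to P(i_*(X)), which is projective, so the lifting
    -- property is immediate.
    have := isIso_cover_of_isZero_relations (h ((iLowerStar Q B).obj X))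
    have := Projective.of_iso (asIso (cover ((iLowerStar Q B).obj X)))
      (projective_endoP (projective_vert_star hX))
    exact ⟨(I.exact_succ 0).liftFromProjective a ha, (I.exact_succ 0).liftFromProjective_comp a ha⟩
  · exact isZero_derived_of_one_lt hi

lemma isGorensteinOfDim_zero (h : ∀ F : Paths Q ⥤ B, IsZero ((relations Q B).obj F)) :
    IsGorensteinOfDim (endoP Q B) (nakayama Q B) (nakayamaRight Q B) 0 where
  isIwanagaGorenstein := ⟨0, fun _ => isZero_derived_of_isZero_relations h⟩
  globalResolutionDim_eq := by
    exact_mod_cast globalResolutionDim_eq_zero fun F => isMonic_of_isZero_relations (h F)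
  isLeast_leftDerived := ⟨fun _ hi => (isZero_derived_of_isZero_relations h hi).1,
    fun _ _ => Nat.zero_le _⟩
  isLeast_rightDerived := ⟨fun _ hi => (isZero_derived_of_isZero_relations h hi).2,
    fun _ _ => Nat.zero_le _⟩

end GorensteinDimension

/-- The endofunctor `P` of the category of representations over modules is `m`-Gorenstein for some
`m ≤ 1`. -/
theorem exists_isGorensteinOfDim (k : Type w) [CommRing k] (Q : Type u) [Quiver.{v} Q]
    [LocallyBoundedQuiver Q] :
    ∃ m : ℕ, m ≤ 1 ∧ IsGorensteinOfDim (endoP Q (ModuleCat.{w} k))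
      (nakayama Q (ModuleCat.{w} k)) (nakayamaRight Q (ModuleCat.{w} k)) m := by
  by_cases h : Nontrivial k ∧ ∃ i j : Q, Nonempty (i ⟶ j)
  · obtain ⟨hk, i, j, ⟨α⟩⟩ := h
    -- Free of rank one at i and zero elsewhere; the form as finitely supported functions makes
    -- freeness uniform in c.
    let X : Q → ModuleCat.{w} k := fun c => ModuleCat.of k (PLift (c = i) →₀ k)
    have hX : ∀ c, Projective (X c) := fun c =>
      (IsProjective.iff_projective (R := k) (PLift (c = i) →₀ k)).1 inferInstance
    refine ⟨1, le_rfl, isGorensteinOfDim_one hX (not_isMonic_star α (fun h₀ => ?_) fun c hc => ?_)⟩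
    · have h₁ : Subsingleton (PLift (i = i) →₀ k) := ModuleCat.subsingleton_of_isZero h₀
      have : Nonempty (PLift (i = i)) := ⟨⟨rfl⟩⟩
      exact not_subsingleton (PLift (i = i) →₀ k) h₁
    · have : IsEmpty (PLift (c = i)) := ⟨fun e => hc e.down⟩
      have : Subsingleton (X c) := inferInstanceAs (Subsingleton (PLift (c = i) →₀ k))
      exact ModuleCat.isZero_of_subsingleton _
  -- Either there are no arrows, so the sums defining the relations are empty, or k is trivial and
  -- every module is zero.
  · refine ⟨0, zero_le_one, isGorensteinOfDim_zero fun F => ?_⟩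
    by_cases hk : Nontrivial k
    · refine (IsZero.iff_id_eq_zero _).2 (rel_mor_ext fun {i j} α => ?_)
      exact absurd ⟨hk, i, j, ⟨α⟩⟩ h
    · have := not_nontrivial_iff_subsingleton.1 hk
      refine (Functor.isZero_iff _).2 fun j => ?_
      have := Module.subsingleton k (((relations Q (ModuleCat.{w} k)).obj F).obj j)
      exact ModuleCat.isZero_of_subsingleton _

end QuiverRep

theorem proposition9 {k : Type w} [CommRing k] {Q : Type u} [Quiver.{v} Q]
    [LocallyBoundedQuiver Q] :
    (∃ m : ℕ, m ≤ 1 ∧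
      RelGorenstein.IsGorensteinOfDim
        (QuiverRep.endoP Q (ModuleCat.{w} k))
        (QuiverRep.nakayama Q (ModuleCat.{w} k))
        (QuiverRep.nakayamaRight Q (ModuleCat.{w} k)) m) ∧
    (∀ {B : Type u₁} [Category.{v₁} B] [Abelian B] [Linear k B] (F : Paths Q ⥤ B),
      QuiverRep.IsMonic F ↔
        RelGorenstein.IsGorensteinProjective
          (QuiverRep.endoP Q B) (QuiverRep.nakayama Q B) F) :=
  ⟨QuiverRep.exists_isGorensteinOfDim k Q,
    fun F => QuiverRep.isMonic_iff_isGorensteinProjective F⟩
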